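/- Model. Fix a horizon $T\ge 0$, an interest rate $\rho>0$ and a bound $L>0$. Let $Q$ be a conservative generator matrix on the states $e_1,\dots,e_K$ (nonnegative off-diagonal entries, zero row sums), which does not depend on the investor's strategy (no market impact); let $\varsigma$ be a finite measure on $\mathcal Z\subseteq\mathbb R$, and let $G:[0,T]\times\{e_1,\dots,e_K\}\times\mathcal Z\to\mathbb R$ be measurable, continuous in time, with $1+G>0$. Fix $t\in[0,T]$, a state $e_i$ and $w>0$. On a filtered probability space $(\Omega,\mathcal F,\mathbb F,\mathbb P)$ let $Y$ be a càdlàg $\mathbb F$-Markov chain on $[t,T]$ with generator $Q$ and $Y_t=e_i$, and let $\mathcal N$ be an $\mathbb F$-Poisson random measure on $(t,T]\times\mathcal Z$ with intensity $ds\,\varsigma(d\zeta)$, independent of $Y$, with $\mathbb E\int_t^T\!\int_{\mathcal Z} G(s,Y_{s-},\zeta)^2\,\varsigma(d\zeta)\,ds<\infty$. Let $\mu(ds,dz)$ be the jump measure of the return process $R_s=\int_{(t,s]}\int_{\mathcal Z} G(r,Y_{r-},\zeta)\,\mathcal N(dr,d\zeta)$, and put $\eta^{\mathbb P}(s,e_j,A)=\varsigma\{\zeta: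 G(s,e_j,\zeta)\in A\setminus\{0\}\}$ for Borel sets $A\subseteq\mathbb R$. A strategy $h$ is admissible if it is $\mathbb F$-predictable with values in $[-L,L]$ and $\eta^{\mathbb P}(s,e_j,\{z:1+h_sz\le0\})=0$ for all $s\in(t,T]$ and all $j$. Its wealth process is the càdlàg adapted solution of $$dW_s=W_{s-}\Big((1-h_s)\rho\,ds+h_s\int_{\mathbb R} z\,\mu(ds,dz)\Big),\qquad W_t=w,$$ and the value function for logarithmic utility under full information is $V(t,w,e_i)=\sup_h\mathbb E^{t,w,i}[\log W^{(h)}_T]$, the supremum over all admissible $h$ (expectations with values in $[-\infty,\infty]$). Call $x\in[-L,L]$ a candidate at $(s,e_j)$ if $z/(1+xz)$ is $\eta^{\mathbb P}(s,e_j,dz)$-integrable and one of the following holds: the first order condition $$\int_{\mathbb R}\frac{z}{1+xz}\,\eta^{\mathbb P}(s,e_j,dz)=\rho;$$ or $x=L$ and $\int_{\mathbb R}\frac{z}{1+xz}\,\eta^{\mathbb P}(s,e_j,dz)\ge\rho$; or $x=-L$ and $\int_{\mathbb R}\frac{z}{1+xz}\,\eta^{\mathbb P}(s,e_j,dz)\le\rho$.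 Proposition. (o) If $s\le T$ and $\eta^{\mathbb P}(s,e_j,\{z:1+xz\le0\})=0$ for every $x\in[-L,L]$, then there is exactly one candidate at $(s,e_j)$. In particular, if the first order condition has no solution in $[-L,L]$, then the candidate is one of the boundary points $\pm L$. Let $h^*(s,e_j)$, for all $s\in(t,T]$ and all $j$, be a candidate at $(s,e_j)$ with $\eta^{\mathbb P}(s,e_k,\{z:1+h^*(s,e_j)z\le0\})=0$ for all $k$. Then: (i) the strategy $h^*_s=h^*(s,Y_{s-})$ is admissible and optimal: it has a wealth process, and $\mathbb E^{t,w,i}[\log W^{(h^*)}_T]=V(t,w,e_i)$; (ii) the value function is $$V(t,w,e_i)=\log w+\mathbb E^{t,i}\left[\int_t^T\Big((1-h^*_s)\rho+\int_{\mathbb R}\log(1+h^*_sz)\,\eta^{\mathbb P}(s,Y_{s-},dz)\Big)ds\right],$$ and $\mathbb E^{t,i}\int_t^T\int_{\mathbb R}|\log(1+h^*_sz)|\,\eta^{\mathbb P}(s,Y_{s-},dz)\,ds<\infty$. -/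

import Mathlib

open MeasureTheory ProbabilityTheory Set Filter Topology
open scoped NNReal ENNReal

noncomputable section

namespace RegimeMarket

/-- Lebesgue measure on the time axis `[0, ∞)`. -/
def leb : Measure ℝ≥0 := (volume : Measure ℝ).comap ((↑) : ℝ≥0 → ℝ)

/-- A path is right-continuous with left limits on `[a, b]`. -/
def CadlagOn {E : Type*} [TopologicalSpace E] (f : ℝ≥0 → E) (a b : ℝ≥0) : Prop :=
  (∀ s ∈ Ico a b, ContinuousWithinAt f (Ioi s) s) ∧
    ∀ s ∈ Ioc a b, ∃ l, Tendsto f (𝓝[<] s) (𝓝 l)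

/-- The jump measure on `(a, b] × ℝ` of a path `R`: the sum of the unit masses at the points
`(s, R s - R (s-))` over all jump times `s ∈ (a, b]`. -/
def jumpMeasure (R : ℝ≥0 → ℝ) (a b : ℝ≥0) : Measure (ℝ≥0 × ℝ) :=
  Measure.sum fun s : {s : ℝ≥0 // s ∈ Ioc a b ∧ R s ≠ Function.leftLim R s} =>
    Measure.dirac ((s : ℝ≥0), R s - Function.leftLim R s)

/-- Expectation of a real random variable with values in `[-∞, ∞]`:
`E[X⁺] - E[X⁻]` (equal to `-∞` if both parts are infinite). -/
def expectation {Ω : Type*} [MeasurableSpace Ω] (P : Measure Ω) (X : Ω → ℝ) : EReal :=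
  ((∫⁻ ω, ENNReal.ofReal (X ω) ∂P : ℝ≥0∞) : EReal) -
    ((∫⁻ ω, ENNReal.ofReal (-X ω) ∂P : ℝ≥0∞) : EReal)

/-- On the time interval `[a, b]`, `Y` is a càdlàg Markov chain with state space `Fin K`, with
respect to the filtration `𝓕`, with generator matrix `Q`, hence with transition
matrices `exp (u Q)`. -/
structure IsMarkovChain {K : ℕ} {Ω : Type*} [mΩ : MeasurableSpace Ω] (P : Measure Ω)
    (𝓕 : Filtration ℝ≥0 mΩ) (Q : Matrix (Fin K) (Fin K) ℝ) (Y : ℝ≥0 → Ω → Fin K)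
    (a b : ℝ≥0) : Prop where
  adapted : ∀ s ∈ Icc a b, Measurable[𝓕 s] (Y s)
  cadlag : ∀ ω, CadlagOn (fun s => Y s ω) a b
  markov : ∀ s u, a ≤ s → s ≤ u → u ≤ b → ∀ j : Fin K,
    P[{ω | Y u ω = j}.indicator (fun _ => (1 : ℝ)) | 𝓕 s] =ᵐ[P]
      fun ω => NormedSpace.exp (((u : ℝ) - (s : ℝ)) • Q) (Y s ω) j

/-- `N` is a Poisson random measure on `(a, b] × S` with intensity `ds ⊗ ς(dζ)`, relative to the
filtration `𝓕`. Its realizations are finite sums of unit masses at points with distinct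
times. -/
structure IsPoissonRandomMeasure {S : Type*} [MeasurableSpace S] {Ω : Type*}
    [mΩ : MeasurableSpace Ω] (P : Measure Ω) (𝓕 : Filtration ℝ≥0 mΩ) (ς : Measure S)
    (N : Ω → Measure (ℝ≥0 × S)) (a b : ℝ≥0) : Prop where
  points : ∀ ω, ∃ F : Finset (ℝ≥0 × S), Set.InjOn Prod.fst (F : Set (ℝ≥0 × S)) ∧
    (N ω).restrict (Ioc a b ×ˢ univ) = ∑ p ∈ F, Measure.dirac p
  adapted : ∀ s ∈ Icc a b, ∀ C : Set (ℝ≥0 × S), MeasurableSet C → C ⊆ Ioc a s ×ˢ univ →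
    Measurable[𝓕 s] fun ω => N ω C
  poisson : ∀ C : Set (ℝ≥0 × S), MeasurableSet C → C ⊆ Ioc a b ×ˢ univ →
    P.map (fun ω => N ω C) =
      (poissonMeasure ((leb.prod ς) C).toNNReal).map (fun n : ℕ => (n : ℝ≥0∞))
  indep_disjoint : ∀ (n : ℕ) (C : Fin n → Set (ℝ≥0 × S)), (∀ k, MeasurableSet (C k)) →
    (∀ k, C k ⊆ Ioc a b ×ˢ univ) → Pairwise (fun k l => Disjoint (C k) (C l)) →
    iIndepFun (fun k ω => N ω (C k)) P
  indep_past : ∀ s ∈ Icc a b, ∀ C : Set (ℝ≥0 × S), MeasurableSet C → C ⊆ Ioc s b ×ˢ univ →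
    Indep (MeasurableSpace.comap (fun ω => N ω C) inferInstance) (𝓕 s) P

/-- The parameters of the market and their standing assumptions. The state `e_j` of the chain is
represented by its index `j : Fin K`. There is no market impact: the generator `Q` is a constant
matrix, which does not depend on the strategy. -/
structure Market (K : ℕ) (Z : Set ℝ) where
  /-- the horizon -/
  T : ℝ≥0
  /-- the bound on the fraction of wealth invested in the risky asset -/
  L : ℝ
  /-- the risk-free rate -/
  ρ : ℝ
  /-- the generator of the chain -/
  Q : Matrix (Fin K) (Fin K) ℝ
  /-- the intensity of the marks -/
  ς : Measure Z
  /-- the relative jump size of the price -/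
  G : ℝ≥0 → Fin K → Z → ℝ
  L_pos : 0 < L
  ρ_pos : 0 < ρ
  Q_nonneg : ∀ j k, j ≠ k → 0 ≤ Q j k
  Q_row : ∀ j, ∑ k, Q j k = 0
  ς_finite : IsFiniteMeasure ς
  G_measurable : ∀ j, Measurable fun p : ℝ≥0 × Z => G p.1 j p.2
  G_continuous : ∀ j ζ, ContinuousOn (fun s => G s j ζ) (Iic T)
  G_pos : ∀ s ≤ T, ∀ j ζ, 0 < 1 + G s j ζ

namespace Market

variable {K : ℕ} {Z : Set ℝ} (M : Market K Z)

/-- The local characteristic `η(s, e_j, dz)` of the jumps of the return process. -/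
def η (s : ℝ≥0) (j : Fin K) : Measure ℝ := (M.ς.map (M.G s j)).restrict {0}ᶜ

theorem η_apply (s : ℝ≥0) (j : Fin K) {A : Set ℝ} (hA : MeasurableSet A) :
    M.η s j A = M.ς {ζ | M.G s j ζ ∈ A \ {0}} := by
  have hG : Measurable (M.G s j) := (M.G_measurable j).comp measurable_prodMk_left
  rw [η, Measure.restrict_apply hA,
    Measure.map_apply hG (hA.inter (measurableSet_singleton 0).compl)]
  rfl

/-- Investing the fraction `x` keeps the wealth positive at all jump sizes charged by
`η(s, e_j, dz)`. -/
def KeepsPositive (s : ℝ≥0) (j : Fin K) (x : ℝ) : Prop := M.η s j {z | 1 + x * z ≤ 0} = 0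

/-- The first order condition at `(s, e_j)`. -/
def FirstOrder (s : ℝ≥0) (j : Fin K) (x : ℝ) : Prop :=
  Integrable (fun z => z / (1 + x * z)) (M.η s j) ∧ ∫ z, z / (1 + x * z) ∂(M.η s j) = M.ρ

/-- `x` is a boundary point of `[-L, L]` at which the criterion does not decrease towards the
boundary. -/
def BoundaryPoint (s : ℝ≥0) (j : Fin K) (x : ℝ) : Prop :=
  Integrable (fun z => z / (1 + x * z)) (M.η s j) ∧
    ((x = M.L ∧ M.ρ ≤ ∫ z, z / (1 + x * z) ∂(M.η s j)) ∨
      (x = -M.L ∧ ∫ z, z / (1 + x * z) ∂(M.η s j) ≤ M.ρ))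

section Dynamics

variable {Ω : Type*} [mΩ : MeasurableSpace Ω] (P : Measure Ω) (𝓕 : Filtration ℝ≥0 mΩ)
  (Y : ℝ≥0 → Ω → Fin K) (N : Ω → Measure (ℝ≥0 × Z)) (t : ℝ≥0)

/-- A filtered probability space carries the market on `[t, T]`, started at time `t` in the state
`e_i`: a Markov chain `Y` with generator `Q`, and an independent Poisson random
measure `N` with intensity `ds ⊗ ς(dζ)`, such that `E ∫∫ G(s, Y_{s-}, ζ)² ς(dζ) ds < ∞`. -/
structure Carries (i : Fin K) : Prop where
  chain : IsMarkovChain P 𝓕 M.Q Y t M.T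
  start : ∀ᵐ ω ∂P, Y t ω = i
  prm : IsPoissonRandomMeasure P 𝓕 M.ς N t M.T
  indep : Indep
    (⨆ (C : Set (ℝ≥0 × Z)) (_ : MeasurableSet C) (_ : C ⊆ Ioc t M.T ×ˢ univ),
      MeasurableSpace.comap (fun ω => N ω C) inferInstance)
    (⨆ s ∈ Icc t M.T, MeasurableSpace.comap (Y s) inferInstance) P
  square_integrable : ∫⁻ ω, ∫⁻ s in Ioc t M.T, ∫⁻ ζ,
    ENNReal.ofReal (M.G s (Function.leftLim (fun r => Y r ω) s) ζ ^ 2) ∂M.ς ∂leb ∂P < ∞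

/-- The return process since time `t`: `R_s = ∫_{(t, s] × Z} G(r, Y_{r-}, ζ) N(dr, dζ)`. -/
def returns (s : ℝ≥0) (ω : Ω) : ℝ :=
  ∫ p in Ioc t s ×ˢ univ, M.G p.1 (Function.leftLim (fun r => Y r ω) p.1) p.2 ∂(N ω)

/-- The random measure `μ(ds, dz)` of the jumps of the return process on `(t, T]`. -/
def μ (ω : Ω) : Measure (ℝ≥0 × ℝ) := jumpMeasure (fun s => M.returns Y N t s ω) t M.T

/-- Admissible strategies on `(t, T]`: predictable, with values in `[-L, L]`, and such that
`η(s, e_j, {z | 1 + h_s z ≤ 0}) = 0` for all times and states. -/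
def Admissible (h : ℝ≥0 → Ω → ℝ) : Prop :=
  IsStronglyPredictable 𝓕 (fun s ω => (Ioc t M.T).indicator (fun r => h r ω) s) ∧
    ∀ s ∈ Ioc t M.T, ∀ ω, h s ω ∈ Icc (-M.L) M.L ∧ ∀ j, M.KeepsPositive s j (h s ω)

/-- `W` is the wealth process on `[t, T]` of the strategy `h` with wealth `w` at time `t`: a
càdlàg adapted solution of
`dW_s = W_{s-} ((1 - h_s) ρ ds + h_s ∫ z μ(ds, dz))`, `W_t = w`. -/
structure IsWealth (w : ℝ) (h W : ℝ≥0 → Ω → ℝ) : Prop where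
  adapted : ∀ s ∈ Icc t M.T, Measurable[𝓕 s] (W s)
  cadlag : ∀ᵐ ω ∂P, CadlagOn (fun s => W s ω) t M.T
  dynamics : ∀ᵐ ω ∂P, ∀ u ∈ Icc t M.T,
    W u ω = w
      + ∫ s in Ioc t u, Function.leftLim (fun r => W r ω) s * ((1 - h s ω) * M.ρ) ∂leb
      + ∫ p in Ioc t u ×ˢ univ,
          Function.leftLim (fun r => W r ω) p.1 * (h p.1 ω * p.2) ∂(M.μ Y N t ω)

/-- The value function: the supremum of the expected utility of terminal wealth over all
admissible strategies. -/
def value (U : ℝ → ℝ) (w : ℝ) : EReal :=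
  ⨆ (h : ℝ≥0 → Ω → ℝ) (_ : M.Admissible 𝓕 t h) (W : ℝ≥0 → Ω → ℝ)
    (_ : M.IsWealth P 𝓕 Y N t w h W), expectation P fun ω => U (W M.T ω)

/-- `h` is an optimal strategy: it is admissible, it has a wealth process, and the expected
utility of its terminal wealth is the value of the problem. -/
def IsOptimal (U : ℝ → ℝ) (w : ℝ) (h : ℝ≥0 → Ω → ℝ) : Prop :=
  M.Admissible 𝓕 t h ∧ (∃ W, M.IsWealth P 𝓕 Y N t w h W) ∧
    ∀ W, M.IsWealth P 𝓕 Y N t w h W →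
      expectation P (fun ω => U (W M.T ω)) = M.value P 𝓕 Y N t U w

/-- The strategy `h_s = g(s, Y_{s-})`. -/
def feedback (Y : ℝ≥0 → Ω → Fin K) (g : ℝ≥0 → Fin K → ℝ) (s : ℝ≥0) (ω : Ω) : ℝ :=
  g s (Function.leftLim (fun r => Y r ω) s)

end Dynamics

end Market

end RegimeMarket

end

/-!
The logarithm turns the wealth equation into a sum. On every path the random measure `N` has
finitely many points, so the wealth equation is linear with finitely many jumps, and its only
càdlàg solution is `w * exp (∫ (1 - h) ρ ds) * ∏ (1 + h z)` (`SolvesLinear.unique`,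
`solvesLinear_linSol`, `Market.Carries.isWealth_unique`). Hence `log W_T` is `log w` plus the
integral of `(1 - h) ρ` plus the integral of `log (1 + h z)` with respect to `N`. The compensation
formula (`IsPoissonRandomMeasure.lintegral_lintegral`) replaces `N` by its intensity in the
expectation of the integral of a predictable integrand, so the expected utility of an admissible
strategy `h` is `log w + E ∫ f(s, Y_{s-}, h_s) ds` with the growth rate
`f(s, e_j, x) = (1 - x) ρ + ∫ log (1 + x z) η(s, e_j, dz)` (`Market.Carries.expectation_log`).
If the logarithmic losses have infinite expectation, the expected utility is `-∞`
(`Market.Carries.expectation_eq_bot`); the gains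
are always integrable, since `log (1 + x z) ≤ L |z|` and `G` is square integrable.

The strategy has no influence on `Y`, so it suffices to maximize `f(s, e_j, ·)` pointwise. It is
concave with derivative `∫ z / (1 + x z) η(s, e_j, dz) - ρ`, and a candidate is a point at which
this derivative vanishes or points out of `[-L, L]`. The tangent inequality `log r ≤ r - 1`, at
`r = (1 + x z) / (1 + y z)`, shows that a candidate `y` is a maximizer (`Candidate.criterion_le`),
and the same inequality in the form `-log r ≤ r⁻¹ - 1`, together with the sign of the derivative,
bounds the logarithmic losses of a candidate by a constant (`Candidate.lintegral_neg_log_le`). Thus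
the value is finite and attained by `h*` (`Market.IsCandidateRule.isOptimal_and_value_eq`).

The integrand `z / (1 + x z)` is strictly decreasing in `x` for `z ≠ 0`, so two candidates can
differ only if there are no jumps, which is excluded by `ρ > 0` (`Candidate.unique`). For existence
(`exists_candidate`), the derivative is continuous inside `[-L, L]`, and Fatou's lemma handles the
end points. Monotonicity also makes the candidate measurable in time: on which side of a given
level it lies is decided by the derivative at that level (`Market.measurableSet_candidate_lt`). As
`Y_{s-}` is predictable, so is the strategy `h*` (`Market.IsCandidateRule.admissible`).
-/

namespace RegimeMarket

/-! ### The first order condition -/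

section Candidate

variable {ν : Measure ℝ} {L ρ x y : ℝ}

/-- `x` is a candidate for the jump measure `ν`: it solves the first order condition, or it is a
boundary point of `[-L, L]` at which the criterion `(1 - x) ρ + ∫ log (1 + x z) ν(dz)` does not
decrease towards the boundary. -/
def Candidate (ν : Measure ℝ) (L ρ x : ℝ) : Prop :=
  Integrable (fun z => z / (1 + x * z)) ν ∧
    (∫ z, z / (1 + x * z) ∂ν = ρ ∨ (x = L ∧ ρ ≤ ∫ z, z / (1 + x * z) ∂ν) ∨
      (x = -L ∧ ∫ z, z / (1 + x * z) ∂ν ≤ ρ))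

/-- Almost all jump sizes keep the wealth positive when the fraction `x` is invested. -/
def KeepsPos (ν : Measure ℝ) (x : ℝ) : Prop := ∀ᵐ z ∂ν, 0 < 1 + x * z

lemma keepsPos_iff : KeepsPos ν x ↔ ν {z | 1 + x * z ≤ 0} = 0 := by
  simp [KeepsPos, ae_iff]

lemma KeepsPos.of_pos_of_le (hy : KeepsPos ν y) (hx : 0 ≤ x) (hxy : x ≤ y) : KeepsPos ν x := by
  filter_upwards [hy] with z hz
  rcases le_total 0 z with h | h
  · positivity
  · nlinarith

lemma KeepsPos.of_neg_of_le (hy : KeepsPos ν y) (hx : x ≤ 0) (hyx : y ≤ x) : KeepsPos ν x := by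
  filter_upwards [hy] with z hz
  rcases le_total 0 z with h | h
  · nlinarith
  · nlinarith [mul_nonneg_of_nonpos_of_nonpos hx h]

@[fun_prop]
lemma measurable_div_one_add : Measurable fun z : ℝ => z / (1 + x * z) :=
  measurable_id.div (by fun_prop)

lemma div_sub_div_eq {z : ℝ} (hx : 0 < 1 + x * z) (hy : 0 < 1 + y * z) :
    z / (1 + x * z) - z / (1 + y * z) = (y - x) * (z ^ 2 / ((1 + x * z) * (1 + y * z))) := by
  rw [div_sub_div _ _ hx.ne' hy.ne', ← mul_div_assoc]
  congr 1
  ring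

lemma div_antitone {z : ℝ} (hx : 0 < 1 + x * z) (hy : 0 < 1 + y * z) (hxy : x ≤ y) :
    z / (1 + y * z) ≤ z / (1 + x * z) := by
  have := div_sub_div_eq hx hy
  have : 0 ≤ (y - x) * (z ^ 2 / ((1 + x * z) * (1 + y * z))) :=
    mul_nonneg (sub_nonneg.2 hxy) (by positivity)
  linarith

lemma mul_div_le_one {z : ℝ} (hx : 0 < 1 + x * z) : x * (z / (1 + x * z)) ≤ 1 := by
  rw [← mul_div_assoc, div_le_one hx]
  linarith

lemma integral_div_anti (hx : KeepsPos ν x) (hy : KeepsPos ν y)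
    (hix : Integrable (fun z => z / (1 + x * z)) ν)
    (hiy : Integrable (fun z => z / (1 + y * z)) ν) (hxy : x ≤ y) :
    ∫ z, z / (1 + y * z) ∂ν ≤ ∫ z, z / (1 + x * z) ∂ν := by
  refine integral_mono_ae hiy hix ?_
  filter_upwards [hx, hy] with z h1 h2 using div_antitone h1 h2 hxy

/-- There is at most one candidate: the criterion is concave, and where it fails to be strictly
concave there are no jumps, so that all money goes to the bank account. -/
lemma Candidate.unique_of_le (hρ : 0 < ρ) (hxL : -L ≤ x) (hyL : y ≤ L)
    (hx : KeepsPos ν x) (hy : KeepsPos ν y) (hcx : Candidate ν L ρ x) (hcy : Candidate ν L ρ y)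
    (hxy : x ≤ y) : x = y := by
  by_contra hne
  have hlt : x < y := lt_of_le_of_ne hxy hne
  have h1 : ∫ z, z / (1 + x * z) ∂ν ≤ ρ := by
    rcases hcx.2 with h | ⟨h, _⟩ | ⟨_, h⟩ <;> linarith
  have h2 : ρ ≤ ∫ z, z / (1 + y * z) ∂ν := by
    rcases hcy.2 with h | ⟨_, h⟩ | ⟨h, _⟩ <;> linarith
  have h3 := integral_div_anti hx hy hcx.1 hcy.1 hxy
  have h4 : ∫ z, (z / (1 + x * z) - z / (1 + y * z)) ∂ν = 0 := by
    rw [integral_sub hcx.1 hcy.1]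
    linarith
  rw [integral_eq_zero_iff_of_nonneg_ae (f := fun z => z / (1 + x * z) - z / (1 + y * z)) _
    (hcx.1.sub hcy.1)] at h4
  · have h5 : ∫ z, z / (1 + y * z) ∂ν = 0 := by
      refine integral_eq_zero_of_ae ?_
      filter_upwards [h4, hx, hy] with z hz h1 h2
      have hz' : z / (1 + x * z) - z / (1 + y * z) = 0 := hz
      rw [div_sub_div_eq h1 h2, mul_eq_zero] at hz'
      rcases hz' with h | h
      · linarith
      · have : z = 0 := by
          rcases div_eq_zero_iff.1 h with h | h
          · simpa using h
          · exact absurd h (by positivity)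
        simp [this]
    linarith
  · filter_upwards [hx, hy] with z h1 h2
    have := div_antitone h1 h2 hxy
    simpa using this

lemma Candidate.unique (hρ : 0 < ρ) (hxL : x ∈ Icc (-L) L) (hyL : y ∈ Icc (-L) L)
    (hx : KeepsPos ν x) (hy : KeepsPos ν y) (hcx : Candidate ν L ρ x) (hcy : Candidate ν L ρ y) :
    x = y := by
  rcases le_total x y with h | h
  · exact hcx.unique_of_le hρ hxL.1 hyL.2 hx hy hcy h
  · exact (hcy.unique_of_le hρ hyL.1 hxL.2 hy hx hcx h).symm

/-- A positive level lies above the candidate iff the derivative of the criterion is negative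
there, or the criterion is not defined or has slope `-∞` there. -/
lemma Candidate.lt_iff_of_pos [IsFiniteMeasure ν] (hρ : 0 < ρ) (hxL : x ∈ Icc (-L) L)
    (hx : KeepsPos ν x) (hcx : Candidate ν L ρ x) {c : ℝ} (hc : 0 < c) (hcL : c ≤ L) :
    x < c ↔ ¬ (KeepsPos ν c ∧ Integrable (fun z => z / (1 + c * z)) ν ∧
      ρ ≤ ∫ z, z / (1 + c * z) ∂ν) := by
  rw [← not_le, not_iff_not]
  constructor
  · intro hle
    have hpc := hx.of_pos_of_le hc.le hle
    have hint : Integrable (fun z => z / (1 + c * z)) ν := by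
      refine integrable_of_le_of_le measurable_div_one_add.aestronglyMeasurable ?_ ?_
        hcx.1 (integrable_const (1 / c))
      · filter_upwards [hx, hpc] with z h1 h2 using div_antitone h2 h1 hle
      · filter_upwards [hpc] with z h
        rw [le_div_iff₀ hc, mul_comm]
        exact mul_div_le_one h
    refine ⟨hpc, hint, ?_⟩
    have := integral_div_anti hpc hx hint hcx.1 hle
    rcases hcx.2 with h | ⟨_, h⟩ | ⟨h, _⟩ <;> linarith
  · rintro ⟨hpc, hint, hle⟩
    by_contra hlt
    rw [not_le] at hlt
    have h1 := integral_div_anti hx hpc hcx.1 hint hlt.le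
    have h2 : ∫ z, z / (1 + x * z) ∂ν ≤ ρ := by
      rcases hcx.2 with h | ⟨h, _⟩ | ⟨_, h⟩ <;> linarith
    exact hlt.ne (hcx.unique hρ hxL ⟨by linarith [hxL.1], hcL⟩ hx hpc
      ⟨hint, Or.inl (le_antisymm (h1.trans h2) hle)⟩)

/-- A negative level lies above the candidate iff the derivative of the criterion is defined and
negative there. -/
lemma Candidate.lt_iff_of_neg [IsFiniteMeasure ν] (hρ : 0 < ρ) (hxL : x ∈ Icc (-L) L)
    (hx : KeepsPos ν x) (hcx : Candidate ν L ρ x) {c : ℝ} (hc : c < 0) (hcL : -L < c) :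
    x < c ↔ KeepsPos ν c ∧ Integrable (fun z => z / (1 + c * z)) ν ∧
      ∫ z, z / (1 + c * z) ∂ν < ρ := by
  constructor
  · intro hlt
    have hpc := hx.of_neg_of_le hc.le hlt.le
    have hint : Integrable (fun z => z / (1 + c * z)) ν := by
      refine integrable_of_le_of_le measurable_div_one_add.aestronglyMeasurable ?_ ?_
        (integrable_const (1 / c)) hcx.1
      · filter_upwards [hpc] with z h
        rw [div_le_iff_of_neg hc, mul_comm]
        exact mul_div_le_one h
      · filter_upwards [hx, hpc] with z h1 h2 using div_antitone h1 h2 hlt.le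
    refine ⟨hpc, hint, ?_⟩
    have h1 := integral_div_anti hx hpc hcx.1 hint hlt.le
    have h2 : ∫ z, z / (1 + x * z) ∂ν ≤ ρ := by
      rcases hcx.2 with h | ⟨h, _⟩ | ⟨_, h⟩ <;> linarith
    refine lt_of_le_of_ne (h1.trans h2) fun heq => hlt.ne ?_
    exact hcx.unique hρ hxL ⟨hcL.le, by linarith [hxL.1]⟩ hx hpc ⟨hint, Or.inl heq⟩
  · rintro ⟨hpc, hint, hlt⟩
    by_contra hle
    rw [not_lt] at hle
    have h1 := integral_div_anti hpc hx hint hcx.1 hle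
    have h2 : ρ ≤ ∫ z, z / (1 + x * z) ∂ν := by
      rcases hcx.2 with h | ⟨_, h⟩ | ⟨h, _⟩ <;> linarith
    linarith

lemma abs_le_of_keepsPos {z : ℝ} (h1 : 0 < 1 + L * z) (h2 : 0 < 1 + -L * z)
    (hx : |x| < L) : 0 < 1 + x * z ∧ |z / (1 + x * z)| ≤ 1 / (L - |x|) := by
  have hz : L * |z| ≤ 1 := by
    rcases abs_cases z with ⟨h, _⟩ | ⟨h, _⟩ <;> rw [h] <;> linarith
  have h3 : -(|x| * |z|) ≤ x * z := by
    rw [← abs_mul]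
    exact neg_abs_le _
  have h4 : |x| * |z| ≤ L * |z| := by gcongr
  have h5 : (L - |x|) * |z| ≤ 1 + x * z := by linarith
  have h6 : 0 < 1 + x * z := by
    rcases eq_or_ne z 0 with h | h
    · simp [h]
    · exact lt_of_lt_of_le (mul_pos (by linarith) (abs_pos.2 h)) h5
  refine ⟨h6, ?_⟩
  rw [abs_div, abs_of_pos h6, div_le_div_iff₀ h6 (by linarith)]
  linarith

lemma continuousOn_integral_div [IsFiniteMeasure ν] (h1 : KeepsPos ν L)
    (h2 : KeepsPos ν (-L)) : ContinuousOn (fun x => ∫ z, z / (1 + x * z) ∂ν) (Ioo (-L) L) := by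
  intro x hx
  have hx' : |x| < L := abs_lt.2 hx
  refine ContinuousAt.continuousWithinAt ?_
  obtain ⟨r, hr1, hr2⟩ := exists_between hx'
  have hnear : ∀ᶠ y in 𝓝 x, |y| < r := (continuous_abs.tendsto x).eventually (gt_mem_nhds hr1)
  refine continuousAt_of_dominated (bound := fun _ => 1 / (L - r)) ?_ ?_ ?_ ?_
  · exact Eventually.of_forall fun y => measurable_div_one_add.aestronglyMeasurable
  · filter_upwards [hnear] with y hy
    filter_upwards [h1, h2] with z hz1 hz2
    refine (abs_le_of_keepsPos hz1 hz2 (hy.trans hr2)).2.trans ?_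
    have : 0 < L - r := by linarith
    gcongr
  · exact integrable_const _
  · filter_upwards [h1, h2] with z hz1 hz2
    have := (abs_le_of_keepsPos hz1 hz2 hx').1.ne'
    fun_prop (disch := assumption)

lemma integrable_div [IsFiniteMeasure ν] (h1 : KeepsPos ν L)
    (h2 : KeepsPos ν (-L)) (hx : |x| < L) : Integrable (fun z => z / (1 + x * z)) ν := by
  refine Integrable.mono' (integrable_const (1 / (L - |x|)))
    measurable_div_one_add.aestronglyMeasurable ?_
  filter_upwards [h1, h2] with z hz1 hz2 using (abs_le_of_keepsPos hz1 hz2 hx).2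

/-- If the criterion does not decrease towards the boundary point `ε L`, `ε = ±1`, on the open
interval, then its derivative is finite at this point and the inequality extends to it, by Fatou's
lemma. -/
lemma boundary_of_forall [IsFiniteMeasure ν] (hL : 0 < L) (h1 : KeepsPos ν L)
    (h2 : KeepsPos ν (-L)) {ε : ℝ} (hε : ε = 1 ∨ ε = -1)
    (h : ∀ x, |x| < L → ε * ρ ≤ ε * ∫ z, z / (1 + x * z) ∂ν) :
    Integrable (fun z => z / (1 + ε * L * z)) ν ∧ ε * ρ ≤ ε * ∫ z, z / (1 + ε * L * z) ∂ν := by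
  have hεε : ε * ε = 1 := by rcases hε with h | h <;> rw [h] <;> norm_num
  have hb : KeepsPos ν (ε * L) := by rcases hε with h | h <;> rw [h] <;> simpa
  set x : ℕ → ℝ := fun n => ε * (L * (1 - 1 / ((n : ℝ) + 1))) with hxdef
  have hrange : ∀ n : ℕ, 0 ≤ 1 - 1 / ((n : ℝ) + 1) ∧ 1 - 1 / ((n : ℝ) + 1) < 1 := fun n => by
    have : 1 / ((n : ℝ) + 1) ≤ 1 := by
      rw [div_le_one (by positivity)]
      linarith [n.cast_nonneg (α := ℝ)]
    have : 0 < 1 / ((n : ℝ) + 1) := by positivity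
    constructor <;> linarith
  have hxL : ∀ n, |x n| < L := fun n => by
    have : |ε| = 1 := by rcases hε with h | h <;> rw [h] <;> norm_num
    rw [hxdef, abs_mul, this, one_mul, abs_of_nonneg (mul_nonneg hL.le (hrange n).1)]
    nlinarith [(hrange n).2]
  have hlim : Tendsto x atTop (𝓝 (ε * L)) := by
    have := (tendsto_one_div_add_atTop_nhds_zero_nat (𝕜 := ℝ)).const_sub 1
    simpa only [sub_zero, mul_one] using (this.const_mul L).const_mul ε
  have h0 : Integrable (fun z : ℝ => z) ν := by
    simpa using integrable_div h1 h2 (x := 0) (by simpa using hL)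
  -- the decrease of the derivative from `0` to `x`, in the direction of the boundary point
  set D : ℝ → ℝ → ℝ := fun x z => ε * (z - z / (1 + x * z)) with hD
  have hDint : ∀ x, |x| < L → Integrable (D x) ν := fun x hx =>
    (h0.sub (integrable_div h1 h2 hx)).const_mul ε
  have hDnonneg : ∀ n, ∀ᵐ z ∂ν, 0 ≤ D (x n) z := fun n => by
    filter_upwards [h1, h2] with z hz1 hz2
    have hpos := (abs_le_of_keepsPos hz1 hz2 (hxL n)).1
    have : D (x n) z = (ε * x n) * (z ^ 2 / (1 + x n * z)) := by
      simp only [hD]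
      rw [← mul_div_assoc, eq_div_iff hpos.ne', mul_assoc, sub_mul, div_mul_cancel₀ _ hpos.ne']
      ring
    rw [this, hxdef]
    simp only
    rw [← mul_assoc, hεε, one_mul]
    have := (hrange n).1
    have h3 : 0 ≤ z ^ 2 / (1 + x n * z) := by positivity
    exact mul_nonneg (mul_nonneg hL.le this) h3
  have hDlim : ∀ᵐ z ∂ν, Tendsto (fun n => D (x n) z) atTop (𝓝 (D (ε * L) z)) := by
    filter_upwards [hb] with z hz
    exact ((Tendsto.div tendsto_const_nhds ((hlim.mul_const z).const_add 1) hz.ne').const_sub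
      z).const_mul ε
  set C : ℝ := ε * ∫ z, z ∂ν - ε * ρ with hC
  have hDle : ∀ n, ∫ z, D (x n) z ∂ν ≤ C := fun n => by
    rw [hD, integral_const_mul, integral_sub h0 (integrable_div h1 h2 (hxL n))]
    have := h (x n) (hxL n)
    rw [mul_sub]
    linarith
  have hC0 : 0 ≤ C := (integral_nonneg_of_ae (hDnonneg 0)).trans (hDle 0)
  have hDnn : ∀ᵐ z ∂ν, 0 ≤ D (ε * L) z := by
    filter_upwards [hDlim, ae_all_iff.2 hDnonneg] with z hz hz'
    exact ge_of_tendsto' hz hz'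
  have hfatou : ∫⁻ z, ENNReal.ofReal (D (ε * L) z) ∂ν ≤ ENNReal.ofReal C := by
    calc ∫⁻ z, ENNReal.ofReal (D (ε * L) z) ∂ν
        = ∫⁻ z, liminf (fun n => ENNReal.ofReal (D (x n) z)) atTop ∂ν := by
          refine lintegral_congr_ae ?_
          filter_upwards [hDlim] with z hz
          exact ((ENNReal.tendsto_ofReal hz).liminf_eq).symm
      _ ≤ liminf (fun n => ∫⁻ z, ENNReal.ofReal (D (x n) z) ∂ν) atTop :=
          lintegral_liminf_le fun n => by fun_prop
      _ ≤ liminf (fun _ : ℕ => ENNReal.ofReal C) atTop := by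
          refine liminf_le_liminf (Eventually.of_forall fun n => ?_)
          rw [← ofReal_integral_eq_lintegral_ofReal (hDint _ (hxL n)) (hDnonneg n)]
          exact ENNReal.ofReal_le_ofReal (hDle n)
      _ = ENNReal.ofReal C := by simp
  have hDb : Integrable (D (ε * L)) ν :=
    ⟨by fun_prop, (hasFiniteIntegral_iff_ofReal hDnn).2 (hfatou.trans_lt ENNReal.ofReal_lt_top)⟩
  have heq : (fun z => z / (1 + ε * L * z)) = fun z => z - ε * D (ε * L) z := by
    funext z
    simp only [hD]
    rw [← mul_assoc, hεε]
    ring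
  have hint : Integrable (fun z => z / (1 + ε * L * z)) ν := by
    rw [heq]
    exact h0.sub (hDb.const_mul ε)
  refine ⟨hint, ?_⟩
  have h5 : ∫ z, D (ε * L) z ∂ν ≤ C := by
    rw [← ENNReal.ofReal_le_ofReal_iff hC0, ofReal_integral_eq_lintegral_ofReal hDb hDnn]
    exact hfatou
  rw [heq, integral_sub h0 (hDb.const_mul ε), integral_const_mul, mul_sub, ← mul_assoc, hεε]
  linarith

lemma exists_candidate [IsFiniteMeasure ν] (hL : 0 < L) (h1 : KeepsPos ν L)
    (h2 : KeepsPos ν (-L)) (ρ : ℝ) : ∃ x ∈ Icc (-L) L, Candidate ν L ρ x := by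
  by_cases hA : ∀ x, |x| < L → ρ ≤ ∫ z, z / (1 + x * z) ∂ν
  · have := boundary_of_forall hL h1 h2 (ε := 1) (Or.inl rfl) (ρ := ρ) (by simpa using hA)
    simp only [one_mul] at this
    exact ⟨L, ⟨by linarith, le_rfl⟩, this.1, Or.inr (Or.inl ⟨rfl, this.2⟩)⟩
  by_cases hB : ∀ x, |x| < L → ∫ z, z / (1 + x * z) ∂ν ≤ ρ
  · have := boundary_of_forall hL h1 h2 (ε := -1) (Or.inr rfl) (ρ := ρ) (by simpa using hB)
    simp only [neg_mul, one_mul, neg_le_neg_iff] at this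
    exact ⟨-L, ⟨le_rfl, by linarith⟩, by simpa using this.1,
      Or.inr (Or.inr ⟨rfl, by simpa using this.2⟩)⟩
  push Not at hA hB
  obtain ⟨a, ha, ha'⟩ := hA
  obtain ⟨b, hb, hb'⟩ := hB
  have hsub : uIcc a b ⊆ Ioo (-L) L := (ordConnected_Ioo).uIcc_subset (abs_lt.1 ha) (abs_lt.1 hb)
  obtain ⟨x, hx, hxρ⟩ := intermediate_value_uIcc ((continuousOn_integral_div h1 h2).mono hsub)
    (Icc_subset_uIcc ⟨ha'.le, hb'.le⟩)
  have hx' := hsub hx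
  exact ⟨x, Ioo_subset_Icc_self hx', integrable_div h1 h2 (abs_lt.2 hx'), Or.inl hxρ⟩

/-- The candidate maximizes the criterion, by the tangent inequality for the logarithm. -/
lemma Candidate.criterion_le (hx : KeepsPos ν x) (hcx : Candidate ν L ρ x)
    (hy : KeepsPos ν y) (hyL : y ∈ Icc (-L) L)
    (hix : Integrable (fun z => Real.log (1 + x * z)) ν)
    (hiy : Integrable (fun z => Real.log (1 + y * z)) ν) :
    (1 - y) * ρ + ∫ z, Real.log (1 + y * z) ∂ν ≤ (1 - x) * ρ + ∫ z, Real.log (1 + x * z) ∂ν := by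
  have h1 : ∫ z, Real.log (1 + y * z) ∂ν - ∫ z, Real.log (1 + x * z) ∂ν ≤
      (y - x) * ∫ z, z / (1 + x * z) ∂ν := by
    rw [← integral_sub hiy hix, ← integral_const_mul]
    refine integral_mono_ae (hiy.sub hix) (hcx.1.const_mul _) ?_
    filter_upwards [hx, hy] with z hz1 hz2
    rw [← Real.log_div hz2.ne' hz1.ne']
    refine (Real.log_le_sub_one_of_pos (div_pos hz2 hz1)).trans (le_of_eq ?_)
    rw [div_sub_one hz1.ne', ← mul_div_assoc]
    congr 1
    ring
  have h2 : (y - x) * ∫ z, z / (1 + x * z) ∂ν ≤ (y - x) * ρ := by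
    rcases hcx.2 with h | ⟨h, h'⟩ | ⟨h, h'⟩
    · rw [h]
    · exact mul_le_mul_of_nonpos_left h' (by linarith [hyL.2])
    · exact mul_le_mul_of_nonneg_left h' (by linarith [hyL.1])
  linarith

/-- The expected logarithmic loss of the candidate is bounded: the first order condition controls
`∫ x z / (1 + x z)` from below, and `log (1 + x z) ≥ x z / (1 + x z)`. -/
lemma Candidate.lintegral_neg_log_le [IsFiniteMeasure ν] (hL : 0 < L) (hρ : 0 < ρ)
    (hxL : x ∈ Icc (-L) L) (hx : KeepsPos ν x) (hcx : Candidate ν L ρ x) :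
    ∫⁻ z, ENNReal.ofReal (-Real.log (1 + x * z)) ∂ν ≤ ν univ + ENNReal.ofReal (L * ρ) := by
  have hlow : -(L * ρ) ≤ x * ∫ z, z / (1 + x * z) ∂ν := by
    rcases hcx.2 with h | ⟨h, h'⟩ | ⟨h, h'⟩
    · rw [h]
      nlinarith [hxL.1]
    · rw [h] at h' ⊢
      nlinarith
    · rw [h] at h' ⊢
      nlinarith
  have hint : Integrable (fun z => 1 - x * (z / (1 + x * z))) ν :=
    (integrable_const 1).sub (hcx.1.const_mul x)
  have hnn : ∀ᵐ z ∂ν, 0 ≤ 1 - x * (z / (1 + x * z)) := by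
    filter_upwards [hx] with z hz
    linarith [mul_div_le_one hz]
  calc ∫⁻ z, ENNReal.ofReal (-Real.log (1 + x * z)) ∂ν
      ≤ ∫⁻ z, ENNReal.ofReal (1 - x * (z / (1 + x * z))) ∂ν := by
        refine lintegral_mono_ae ?_
        filter_upwards [hx] with z hz
        refine ENNReal.ofReal_le_ofReal ?_
        have := Real.one_sub_inv_le_log_of_pos hz
        have h2 : x * (z / (1 + x * z)) = 1 - (1 + x * z)⁻¹ := by
          field_simp
          ring
        linarith
    _ = ENNReal.ofReal (∫ z, (1 - x * (z / (1 + x * z))) ∂ν) :=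
        (ofReal_integral_eq_lintegral_ofReal hint hnn).symm
    _ ≤ ENNReal.ofReal (ν.real univ + L * ρ) := by
        refine ENNReal.ofReal_le_ofReal ?_
        rw [integral_sub (integrable_const 1) (hcx.1.const_mul x), integral_const_mul]
        simp only [integral_const, smul_eq_mul, mul_one]
        linarith
    _ = ν univ + ENNReal.ofReal (L * ρ) := by
        rw [ENNReal.ofReal_add measureReal_nonneg (by positivity), ofReal_measureReal]

lemma log_one_add_mul_le {z : ℝ} (hx : x ∈ Icc (-L) L) (hz : 0 < 1 + x * z) :
    Real.log (1 + x * z) ≤ L * |z| := by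
  have h1 := Real.log_le_sub_one_of_pos hz
  have h2 : x * z ≤ |x| * |z| := by
    rw [← abs_mul]
    exact le_abs_self _
  have h3 : |x| * |z| ≤ L * |z| := by
    gcongr
    exact abs_le.2 hx
  linarith

end Candidate

/-! ### Lebesgue measure on the time axis -/

lemma map_coe_leb : leb.map ((↑) : ℝ≥0 → ℝ) = volume.restrict (Ici 0) := by
  have h : MeasurableEmbedding ((↑) : ℝ≥0 → ℝ) := MeasurableEmbedding.subtype_coe measurableSet_Ici
  rw [leb, h.map_comap]
  congr 1
  exact Subtype.range_coe

lemma preimage_coe_Ioc (a b : ℝ≥0) : ((↑) : ℝ≥0 → ℝ) ⁻¹' Ioc (a : ℝ) b = Ioc a b := by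
  ext; simp

lemma leb_Ioc (a b : ℝ≥0) : leb (Ioc a b) = ENNReal.ofReal (b - a) := by
  rw [← preimage_coe_Ioc, ← Measure.map_apply NNReal.continuous_coe.measurable measurableSet_Ioc,
    map_coe_leb, Measure.restrict_apply measurableSet_Ioc, inter_eq_left.2, Real.volume_Ioc]
  intro x hx
  exact a.2.trans hx.1.le

instance : SFinite leb := by
  have h : MeasurableEmbedding ((↑) : ℝ≥0 → ℝ) := MeasurableEmbedding.subtype_coe measurableSet_Ici
  have : leb = (volume.restrict (Ici (0 : ℝ))).map Real.toNNReal := by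
    rw [← map_coe_leb, Measure.map_map measurable_real_toNNReal h.measurable]
    have : Real.toNNReal ∘ ((↑) : ℝ≥0 → ℝ) = id := by ext; simp
    rw [this, Measure.map_id]
  rw [this]
  infer_instance

instance (a b : ℝ≥0) : IsFiniteMeasure (leb.restrict (Ioc a b)) :=
  ⟨by rw [Measure.restrict_apply_univ, leb_Ioc]; exact ENNReal.ofReal_lt_top⟩

lemma setIntegral_leb (f : ℝ≥0 → ℝ) {a b : ℝ≥0} (hab : a ≤ b) :
    ∫ s in Ioc a b, f s ∂leb = ∫ x in (a : ℝ)..b, f x.toNNReal := by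
  have h : MeasurableEmbedding ((↑) : ℝ≥0 → ℝ) := MeasurableEmbedding.subtype_coe measurableSet_Ici
  rw [intervalIntegral.integral_of_le (by exact_mod_cast hab)]
  have h1 : volume.restrict (Ioc (a : ℝ) b) =
      (leb.map ((↑) : ℝ≥0 → ℝ)).restrict (Ioc (a : ℝ) b) := by
    rw [map_coe_leb, Measure.restrict_restrict measurableSet_Ioc, inter_eq_left.2]
    intro x hx
    exact a.2.trans hx.1.le
  rw [h1, h.setIntegral_map, preimage_coe_Ioc]
  simp

lemma integrableOn_leb_iff (f : ℝ≥0 → ℝ) {a b : ℝ≥0} (hab : a ≤ b) :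
    IntegrableOn f (Ioc a b) leb ↔
      IntervalIntegrable (fun x : ℝ => f x.toNNReal) volume (a : ℝ) b := by
  have h : MeasurableEmbedding ((↑) : ℝ≥0 → ℝ) := MeasurableEmbedding.subtype_coe measurableSet_Ici
  rw [intervalIntegrable_iff_integrableOn_Ioc_of_le (by exact_mod_cast hab)]
  have h1 : volume.restrict (Ioc (a : ℝ) b) =
      (leb.map ((↑) : ℝ≥0 → ℝ)).restrict (Ioc (a : ℝ) b) := by
    rw [map_coe_leb, Measure.restrict_restrict measurableSet_Ioc, inter_eq_left.2]
    intro x hx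
    exact a.2.trans hx.1.le
  rw [IntegrableOn, IntegrableOn, h1, ← IntegrableOn, ← IntegrableOn, h.integrableOn_map_iff,
    preimage_coe_Ioc]
  simp [Function.comp_def]

/-! ### Paths with left limits -/

lemma neBot_nhdsLT {a s : ℝ≥0} (h : a < s) : (𝓝[<] s).NeBot :=
  nhdsLT_neBot_of_exists_lt ⟨a, h⟩

lemma CadlagOn.tendsto_leftLim {E : Type*} [TopologicalSpace E] {f : ℝ≥0 → E} {a b s : ℝ≥0}
    (hf : CadlagOn f a b) (hs : s ∈ Ioc a b) :
    Tendsto f (𝓝[<] s) (𝓝 (Function.leftLim f s)) :=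
  tendsto_leftLim_of_tendsto (hf.2 s hs)

lemma CadlagOn.sub {f g : ℝ≥0 → ℝ} {a b : ℝ≥0} (hf : CadlagOn f a b) (hg : CadlagOn g a b) :
    CadlagOn (fun s => f s - g s) a b :=
  ⟨fun s hs => (hf.1 s hs).sub (hg.1 s hs), fun _ hs =>
    ⟨_, (hf.tendsto_leftLim hs).sub (hg.tendsto_leftLim hs)⟩⟩

lemma CadlagOn.leftLim_sub {f g : ℝ≥0 → ℝ} {a b s : ℝ≥0} (hf : CadlagOn f a b)
    (hg : CadlagOn g a b) (hs : s ∈ Ioc a b) :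
    Function.leftLim (fun s => f s - g s) s = Function.leftLim f s - Function.leftLim g s :=
  haveI := neBot_nhdsLT hs.1
  leftLim_eq_of_tendsto ((hf.tendsto_leftLim hs).sub (hg.tendsto_leftLim hs))

lemma CadlagOn.congr {f f' : ℝ≥0 → ℝ} {a b : ℝ≥0} (hf : CadlagOn f a b)
    (h : ∀ s ∈ Icc a b, f' s = f s) : CadlagOn f' a b := by
  refine ⟨fun s hs => ?_, fun s hs => ⟨_, (hf.tendsto_leftLim hs).congr' ?_⟩⟩
  · refine (hf.1 s hs).congr_of_eventuallyEq ?_ (h s ⟨hs.1, hs.2.le⟩)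
    filter_upwards [Ioo_mem_nhdsGT hs.2] with r hr using h r ⟨hs.1.trans hr.1.le, hr.2.le⟩
  · filter_upwards [Ioo_mem_nhdsLT hs.1] with r hr using (h r ⟨hr.1.le, hr.2.le.trans hs.2⟩).symm

lemma CadlagOn.leftLim_congr {f f' : ℝ≥0 → ℝ} {a b s : ℝ≥0} (hf : CadlagOn f a b)
    (h : ∀ s ∈ Icc a b, f' s = f s) (hs : s ∈ Ioc a b) :
    Function.leftLim f' s = Function.leftLim f s := by
  have := neBot_nhdsLT hs.1
  refine leftLim_eq_of_tendsto ((hf.tendsto_leftLim hs).congr' ?_)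
  filter_upwards [Ioo_mem_nhdsLT hs.1] with r hr using (h r ⟨hr.1.le, hr.2.le.trans hs.2⟩).symm

lemma CadlagOn.exists_bound {f : ℝ≥0 → ℝ} {a b : ℝ≥0} (hf : CadlagOn f a b) :
    ∃ C, ∀ s ∈ Icc a b, |f s| ≤ C := by
  refine isCompact_Icc.induction_on (p := fun S => ∃ C, ∀ s ∈ S, |f s| ≤ C) ⟨0, by simp⟩ ?_ ?_ ?_
  · rintro S S' hS ⟨C, hC⟩
    exact ⟨C, fun s hs => hC s (hS hs)⟩
  · rintro S S' ⟨C, hC⟩ ⟨C', hC'⟩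
    refine ⟨max C C', ?_⟩
    rintro s (hs | hs)
    · exact (hC s hs).trans (le_max_left _ _)
    · exact (hC' s hs).trans (le_max_right _ _)
  · intro s hs
    -- bounds on the left, at, and on the right of `s`
    have hleft : ∃ C, ∀ᶠ r in 𝓝[<] s, r ∈ Icc a b → |f r| ≤ C := by
      rcases hs.1.eq_or_lt with h | h
      · refine ⟨0, ?_⟩
        filter_upwards [self_mem_nhdsWithin] with r hr hr'
        exact absurd (h ▸ hr'.1) (not_le.2 hr)
      · obtain ⟨l, hl⟩ := hf.2 s ⟨h, hs.2⟩
        refine ⟨|l| + 1, ?_⟩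
        filter_upwards [hl.abs.eventually (gt_mem_nhds (lt_add_one _))] with r hr _ using hr.le
    have hright : ∃ C, ∀ᶠ r in 𝓝[>] s, r ∈ Icc a b → |f r| ≤ C := by
      rcases hs.2.eq_or_lt with h | h
      · refine ⟨0, ?_⟩
        filter_upwards [self_mem_nhdsWithin] with r hr hr'
        exact absurd (h ▸ hr'.2) (not_le.2 hr)
      · refine ⟨|f s| + 1, ?_⟩
        filter_upwards [(hf.1 s ⟨hs.1, h⟩).tendsto.abs.eventually
          (gt_mem_nhds (lt_add_one _))] with r hr _ using hr.le
    obtain ⟨C₁, h₁⟩ := hleft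
    obtain ⟨C₂, h₂⟩ := hright
    have h₃ : ∀ᶠ r in 𝓝 s, r ∈ Icc a b → |f r| ≤ max (max C₁ C₂) |f s| := by
      rw [← nhdsNE_sup_pure, ← nhdsLT_sup_nhdsGT, eventually_sup, eventually_sup]
      refine ⟨⟨?_, ?_⟩, fun _ => le_max_right _ _⟩
      · filter_upwards [h₁] with r hr hr'
        exact (hr hr').trans ((le_max_left _ _).trans (le_max_left _ _))
      · filter_upwards [h₂] with r hr hr'
        exact (hr hr').trans ((le_max_right _ _).trans (le_max_left _ _))
    refine ⟨{r | |f r| ≤ max (max C₁ C₂) |f s|}, mem_nhdsWithin_iff_eventually.2 ?_, _,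
      fun r hr => hr⟩
    filter_upwards [h₃] with r hr hr'
    exact hr hr'

lemma CadlagOn.abs_leftLim_le {f : ℝ≥0 → ℝ} {a b x s : ℝ≥0} (hf : CadlagOn f a b) {C : ℝ}
    (hax : a ≤ x) (hs : s ∈ Ioc x b) (hC : ∀ r ∈ Ioo x s, |f r| ≤ C) :
    |Function.leftLim f s| ≤ C := by
  have := neBot_nhdsLT hs.1
  refine le_of_tendsto (hf.tendsto_leftLim ⟨hax.trans_lt hs.1, hs.2⟩).abs ?_
  filter_upwards [Ioo_mem_nhdsLT hs.1] with r hr using hC r hr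

/-- Approximation of the time `s > t` from the left by the last grid point of mesh `1 / (n + 1)`
before `s`, or by `t` if there is no grid point between `t` and `s`. It depends on `s` through
`⌈(n + 1) s⌉` only. -/
noncomputable def gridPoint (t : ℝ≥0) (n k : ℕ) : ℝ≥0 := max t (((k - 1 : ℕ) : ℝ≥0) / (n + 1))

lemma gridPoint_lt {t s : ℝ≥0} (hs : t < s) (n : ℕ) : gridPoint t n ⌈(n + 1) * s⌉₊ < s := by
  refine max_lt hs ?_
  have hs0 : 0 < s := bot_le.trans_lt hs
  have hpos : 0 < (n + 1) * s := by positivity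
  rw [div_lt_iff₀ (by positivity), mul_comm s]
  exact Nat.lt_ceil.1 (Nat.sub_lt (Nat.ceil_pos.2 hpos) one_pos)

lemma tendsto_gridPoint {t s : ℝ≥0} (hs : t < s) :
    Tendsto (fun n : ℕ => gridPoint t n ⌈(n + 1) * s⌉₊) atTop (𝓝[<] s) := by
  refine tendsto_nhdsWithin_iff.2 ⟨?_, Eventually.of_forall fun n => gridPoint_lt hs n⟩
  have hlow : ∀ n : ℕ, s - 1 / ((n : ℝ≥0) + 1) ≤ gridPoint t n ⌈(n + 1) * s⌉₊ := fun n => by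
    refine le_max_of_le_right ?_
    rw [tsub_le_iff_right, ← add_div, le_div_iff₀ (by positivity), mul_comm]
    refine (Nat.le_ceil _).trans ?_
    have : ⌈((n : ℝ≥0) + 1) * s⌉₊ ≤ ⌈((n : ℝ≥0) + 1) * s⌉₊ - 1 + 1 := by omega
    exact_mod_cast this
  have h0 : Tendsto (fun n : ℕ => 1 / ((n : ℝ≥0) + 1)) atTop (𝓝 0) := by
    rw [← NNReal.tendsto_coe]
    simpa using tendsto_one_div_add_atTop_nhds_zero_nat (𝕜 := ℝ)
  have h1 : Tendsto (fun n : ℕ => s - 1 / ((n : ℝ≥0) + 1)) atTop (𝓝 s) := by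
    simpa using (tendsto_const_nhds (x := s)).sub h0
  exact tendsto_of_tendsto_of_tendsto_of_le_of_le h1 tendsto_const_nhds hlow
    fun n => (gridPoint_lt hs n).le

lemma CadlagOn.aestronglyMeasurable_leftLim {f : ℝ≥0 → ℝ} {a b : ℝ≥0} (hf : CadlagOn f a b) :
    AEStronglyMeasurable (Function.leftLim f) (leb.restrict (Ioc a b)) := by
  refine aestronglyMeasurable_of_tendsto_ae atTop
    (f := fun n : ℕ => fun s : ℝ≥0 => f (gridPoint a n ⌈(n + 1) * s⌉₊)) (fun n => ?_) ?_
  · have : Measurable fun s : ℝ≥0 => ⌈(n + 1) * s⌉₊ := Nat.measurable_ceil.comp (by fun_prop)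
    exact ((measurable_from_nat (f := fun k => f (gridPoint a n k))).comp
      this).aestronglyMeasurable
  · filter_upwards [ae_restrict_mem measurableSet_Ioc] with s hs
    exact (hf.tendsto_leftLim hs).comp (tendsto_gridPoint hs.1)

/-! ### The linear equation with finitely many jumps -/

section Linear

variable {t T : ℝ≥0} {w C : ℝ} {a b : ℝ≥0 → ℝ} {J : Finset ℝ≥0}

/-- `X` solves `dX_s = X_{s-} (b_s ds + dA_s)` on `[t, T]` with `X_t = w`, where `A` is the pure
jump path with jumps `a_k` at the times `k ∈ J`. -/
def SolvesLinear (t T : ℝ≥0) (w : ℝ) (b : ℝ≥0 → ℝ) (J : Finset ℝ≥0) (a X : ℝ≥0 → ℝ) : Prop :=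
  ∀ u ∈ Icc t T, X u = w + ∫ s in Ioc t u, Function.leftLim X s * b s ∂leb +
    ∑ k ∈ J with k ≤ u, Function.leftLim X k * a k

lemma integrableOn_leftLim_mul {X : ℝ≥0 → ℝ} (hX : CadlagOn X t T)
    (hb : IntegrableOn b (Ioc t T) leb) {r u : ℝ≥0} (hr : t ≤ r) (hu : u ≤ T) :
    IntegrableOn (fun s => Function.leftLim X s * b s) (Ioc r u) leb := by
  obtain ⟨M, hM⟩ := hX.exists_bound
  refine IntegrableOn.mono_set ?_ (Ioc_subset_Ioc hr hu)
  refine Integrable.bdd_mul (c := M) hb hX.aestronglyMeasurable_leftLim ?_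
  filter_upwards [ae_restrict_mem measurableSet_Ioc] with s hs
  exact hX.abs_leftLim_le le_rfl hs fun r hr => hM r ⟨hr.1.le, hr.2.le.trans hs.2⟩

/-- A càdlàg solution of the homogeneous equation started at `0` vanishes: the first time at which
it leaves `0` cannot be a jump time, and after that time the equation is a contraction for a
short while. -/
lemma SolvesLinear.eq_zero {D : ℝ≥0 → ℝ} (hD : CadlagOn D t T) (hJ : ∀ k ∈ J, t < k)
    (hb : IntegrableOn b (Ioc t T) leb) (hbC : ∀ s ∈ Ioc t T, |b s| ≤ C)
    (h : SolvesLinear t T 0 b J a D) : ∀ u ∈ Icc t T, D u = 0 := by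
  set S : Set ℝ≥0 := {u | ∀ s ∈ Icc t u, D s = 0} with hS
  have hleft : ∀ x s, t < s → s ≤ T → s ≤ x → (∀ r ∈ Ico t x, D r = 0) →
      Function.leftLim D s = 0 := fun x s h1 h2 h3 h4 => by
    have := hD.abs_leftLim_le (C := 0) le_rfl ⟨h1, h2⟩ fun r hr => by
      rw [h4 r ⟨hr.1.le, hr.2.trans_le h3⟩, abs_zero]
    exact abs_nonpos_iff.1 this
  have hstep : ∀ x ∈ Icc t T, (∀ r ∈ Ico t x, D r = 0) → D x = 0 := fun x hx hr => by
    rw [h x hx, Finset.sum_eq_zero, setIntegral_eq_zero_of_forall_eq_zero]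
    · simp
    · intro s hs
      rw [hleft x s hs.1 (hs.2.trans hx.2) hs.2 hr, zero_mul]
    · intro k hk
      rw [Finset.mem_filter] at hk
      rw [hleft x k (hJ k hk.1) (hk.2.trans hx.2) hk.2 hr, zero_mul]
  intro u hu
  have htT : t ≤ T := hu.1.trans hu.2
  have hsub : Icc t T ⊆ S := by
    refine IsClosed.Icc_subset_of_forall_exists_gt ?_ ?_ ?_
    · refine isClosed_of_closure_subset fun x hx => ?_
      have hxT : x ∈ Icc t T :=
        (closure_minimal inter_subset_right isClosed_Icc) hx
      have hlt : ∀ r ∈ Ico t x, D r = 0 := fun r hr => by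
        obtain ⟨y, hy, hyS⟩ := mem_closure_iff.1 hx (Ioi r) isOpen_Ioi hr.2
        exact hyS.1 r ⟨hr.1, le_of_lt hy⟩
      refine ⟨fun s hs => ?_, hxT⟩
      rcases hs.2.eq_or_lt with heq | hlt'
      · rw [heq]
        exact hstep x hxT hlt
      · exact hlt s ⟨hs.1, hlt'⟩
    · intro s hs
      rw [le_antisymm hs.2 hs.1]
      exact hstep t ⟨le_rfl, htT⟩ fun r hr => absurd hr.1 (not_le.2 hr.2)
    · rintro x ⟨hxS, hx⟩ y hy
      have hC : 0 ≤ C := (abs_nonneg _).trans (hbC T ⟨hx.1.trans_lt hx.2, le_rfl⟩)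
      -- a short interval after `x` without jumps
      have hnear : ∀ᶠ z in 𝓝[>] x, (∀ k ∈ J, ¬ (x < k ∧ k ≤ z)) ∧ C * ((z : ℝ) - x) < 1 ∧
          z ≤ T ∧ z ≤ y := by
        refine Eventually.and ?_ (Eventually.and ?_ (Eventually.and ?_ ?_))
        · rw [Filter.eventually_all_finset]
          intro k _
          by_cases hk : x < k
          · filter_upwards [Ioo_mem_nhdsGT hk] with z hz h'
            exact absurd h'.2 (not_le.2 hz.2)
          · exact Eventually.of_forall fun z h' => hk h'.1
        · refine nhdsWithin_le_nhds ?_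
          have : Continuous fun z : ℝ≥0 => C * ((z : ℝ) - x) := by fun_prop
          exact (this.tendsto x).eventually (gt_mem_nhds (by simp))
        · filter_upwards [Ioo_mem_nhdsGT hx.2] with z hz using hz.2.le
        · filter_upwards [Ioo_mem_nhdsGT hy] with z hz using hz.2.le
      obtain ⟨z, ⟨hzJ, hzC, hzT, hzy⟩, hxz⟩ := (hnear.and self_mem_nhdsWithin).exists
      have hxz : x < z := hxz
      refine ⟨z, ?_, hxz, hzy⟩
      -- contraction for the supremum of `|D|` on this interval
      obtain ⟨M₀, hM₀⟩ := hD.exists_bound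
      set M : ℝ := sSup ((fun s => |D s|) '' Icc x z) with hM
      have hbdd : BddAbove ((fun s => |D s|) '' Icc x z) := by
        refine ⟨M₀, ?_⟩
        rintro _ ⟨s, hs, rfl⟩
        exact hM₀ s ⟨hx.1.trans hs.1, hs.2.trans hzT⟩
      have hDM : ∀ s ∈ Icc x z, |D s| ≤ M := fun s hs => le_csSup hbdd ⟨s, hs, rfl⟩
      have hM0 : 0 ≤ M := (abs_nonneg _).trans (hDM x ⟨le_rfl, hxz.le⟩)
      have hcontr : ∀ s ∈ Icc x z, |D s| ≤ C * ((z : ℝ) - x) * M := fun s hs => by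
        have hsT : s ∈ Icc t T := ⟨hx.1.trans hs.1, hs.2.trans hzT⟩
        have hsum : ∑ k ∈ J with k ≤ s, Function.leftLim D k * a k = 0 := by
          refine Finset.sum_eq_zero fun k hk => ?_
          rw [Finset.mem_filter] at hk
          have hkx : k ≤ x := by
            by_contra hkx
            exact hzJ k hk.1 ⟨not_le.1 hkx, hk.2.trans hs.2⟩
          rw [hleft x k (hJ k hk.1) (hkx.trans hx.2.le) hkx fun r hr => hxS r ⟨hr.1, hr.2.le⟩,
            zero_mul]
        have hint : ∫ r in Ioc t s, Function.leftLim D r * b r ∂leb =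
            ∫ r in Ioc x s, Function.leftLim D r * b r ∂leb := by
          rw [← Ioc_union_Ioc_eq_Ioc hx.1 hs.1, setIntegral_union (Ioc_disjoint_Ioc_of_le le_rfl)
            measurableSet_Ioc (integrableOn_leftLim_mul hD hb le_rfl hx.2.le)
            (integrableOn_leftLim_mul hD hb hx.1 hsT.2), setIntegral_eq_zero_of_forall_eq_zero,
            zero_add]
          intro r hr
          rw [hleft x r hr.1 (hr.2.trans hx.2.le) hr.2 fun r hr => hxS r ⟨hr.1, hr.2.le⟩, zero_mul]
        rw [h s hsT, hsum, hint, zero_add, add_zero]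
        have h1 : ‖∫ r in Ioc x s, Function.leftLim D r * b r ∂leb‖ ≤
            (M * C) * leb.real (Ioc x s) := by
          refine norm_setIntegral_le_of_norm_le_const ?_ fun r hr => ?_
          · rw [leb_Ioc]
            exact ENNReal.ofReal_lt_top
          · rw [norm_mul]
            refine mul_le_mul ?_ (hbC r ⟨hx.1.trans_lt hr.1, hr.2.trans hsT.2⟩) (norm_nonneg _) hM0
            exact hD.abs_leftLim_le hx.1 ⟨hr.1, hr.2.trans hsT.2⟩ fun q hq =>
              hDM q ⟨hq.1.le, hq.2.le.trans (hr.2.trans hs.2)⟩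
        refine h1.trans ?_
        have hsx : (x : ℝ) ≤ s := by exact_mod_cast hs.1
        have hsz : (s : ℝ) ≤ z := by exact_mod_cast hs.2
        rw [measureReal_def, leb_Ioc, ENNReal.toReal_ofReal (by linarith)]
        calc M * C * ((s : ℝ) - x) ≤ M * C * ((z : ℝ) - x) := by gcongr
          _ = C * ((z : ℝ) - x) * M := by ring
      have hMle : M ≤ C * ((z : ℝ) - x) * M := by
        refine csSup_le ⟨_, x, ⟨le_rfl, hxz.le⟩, rfl⟩ ?_
        rintro _ ⟨s, hs, rfl⟩
        exact hcontr s hs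
      have hM' : M = 0 := by nlinarith
      intro s hs
      rcases le_total s x with hsx | hsx
      · exact hxS s ⟨hs.1, hsx⟩
      · exact abs_nonpos_iff.1 (hM' ▸ hDM s ⟨hsx, hs.2⟩)
  exact hsub hu u ⟨hu.1, le_rfl⟩

lemma SolvesLinear.unique {X X' : ℝ≥0 → ℝ} (hX : CadlagOn X t T) (hX' : CadlagOn X' t T)
    (hJ : ∀ k ∈ J, t < k) (hb : IntegrableOn b (Ioc t T) leb) (hbC : ∀ s ∈ Ioc t T, |b s| ≤ C)
    (h : SolvesLinear t T w b J a X) (h' : SolvesLinear t T w b J a X') {u : ℝ≥0}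
    (hu : u ∈ Icc t T) : X u = X' u := by
  refine sub_eq_zero.1 (SolvesLinear.eq_zero (D := fun s => X s - X' s) (a := a) (hX.sub hX') hJ hb
    hbC (fun v hv => ?_) u hu)
  have h1 : ∫ s in Ioc t v, Function.leftLim (fun s => X s - X' s) s * b s ∂leb =
      ∫ s in Ioc t v, Function.leftLim X s * b s ∂leb -
        ∫ s in Ioc t v, Function.leftLim X' s * b s ∂leb := by
    rw [← integral_sub (integrableOn_leftLim_mul hX hb le_rfl hv.2)
      (integrableOn_leftLim_mul hX' hb le_rfl hv.2)]
    refine setIntegral_congr_fun measurableSet_Ioc fun s hs => ?_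
    rw [hX.leftLim_sub hX' ⟨hs.1, hs.2.trans hv.2⟩, sub_mul]
  have h2 : ∑ k ∈ J with k ≤ v, Function.leftLim (fun s => X s - X' s) k * a k =
      ∑ k ∈ J with k ≤ v, Function.leftLim X k * a k -
        ∑ k ∈ J with k ≤ v, Function.leftLim X' k * a k := by
    rw [← Finset.sum_sub_distrib]
    refine Finset.sum_congr rfl fun k hk => ?_
    rw [Finset.mem_filter] at hk
    rw [hX.leftLim_sub hX' ⟨hJ k hk.1, hk.2.trans hv.2⟩, sub_mul]
  simp only
  rw [h1, h2, h v hv, h' v hv]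
  ring

lemma SolvesLinear.congr {X X' : ℝ≥0 → ℝ}
    (hX : SolvesLinear t T w b J a X) (hc : CadlagOn X t T) (hJ : ∀ k ∈ J, t < k)
    (h : ∀ s ∈ Icc t T, X' s = X s) : SolvesLinear t T w b J a X' := by
  intro u hu
  rw [h u hu, hX u hu]
  congr 1
  · congr 1
    refine setIntegral_congr_fun measurableSet_Ioc fun s hs => ?_
    rw [hc.leftLim_congr h ⟨hs.1, hs.2.trans hu.2⟩]
  · refine Finset.sum_congr rfl fun k hk => ?_
    rw [Finset.mem_filter] at hk
    rw [hc.leftLim_congr h ⟨hJ k hk.1, hk.2.trans hu.2⟩]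

/-- Fundamental theorem of calculus for the exponential of an integral. -/
lemma integral_exp_mul {f : ℝ → ℝ} {c d : ℝ} (hcd : c ≤ d)
    (hf : IntervalIntegrable f volume c d) (hfC : ∀ x ∈ Ioc c d, |f x| ≤ C) :
    ∫ x in c..d, Real.exp (∫ y in c..x, f y) * f x = Real.exp (∫ y in c..d, f y) - 1 := by
  set F : ℝ → ℝ := fun x => ∫ y in c..x, f y with hF
  have hint : ∀ x ∈ Icc c d, IntervalIntegrable f volume c x := fun x hx =>
    hf.mono_set (by rw [uIcc_of_le hx.1, uIcc_of_le hcd]; exact Icc_subset_Icc le_rfl hx.2)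
  have hC0 : 0 ≤ max C 0 := le_max_right _ _
  have hlip : LipschitzOnWith (max C 0).toNNReal F (Icc c d) := by
    refine LipschitzOnWith.of_dist_le_mul fun x hx y hy => ?_
    rw [Real.dist_eq, hF, intervalIntegral.integral_interval_sub_left (hint x hx) (hint y hy),
      Real.coe_toNNReal _ hC0, Real.dist_eq]
    refine intervalIntegral.norm_integral_le_of_norm_le_const (f := f) fun z hz => ?_
    refine (hfC z ?_).trans (le_max_left _ _)
    rw [mem_uIoc] at hz
    rcases hz with hz | hz
    · exact ⟨hy.1.trans_lt hz.1, hz.2.trans hx.2⟩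
    · exact ⟨hx.1.trans_lt hz.1, hz.2.trans hy.2⟩
  have hcont : ContinuousOn F (Icc c d) := hlip.continuousOn
  obtain ⟨B, hB⟩ := (isCompact_Icc.image_of_continuousOn hcont).isBounded.subset_closedBall 0
  obtain ⟨K, hK⟩ := (Real.contDiff_exp (n := 1)).contDiffOn.exists_lipschitzOnWith (by decide)
    (convex_closedBall (0 : ℝ) B) (isCompact_closedBall 0 B)
  have hac : AbsolutelyContinuousOnInterval (fun x => Real.exp (F x)) c d := by
    refine LipschitzOnWith.absolutelyContinuousOnInterval
      (K := K * (max C 0).toNNReal) ?_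
    rw [uIcc_of_le hcd]
    exact hK.comp hlip fun x hx => hB ⟨x, hx, rfl⟩
  have h0 : F c = 0 := by simp [hF]
  have := hac.integral_deriv_eq_sub
  rw [h0, Real.exp_zero] at this
  rw [← this]
  refine intervalIntegral.integral_congr_ae ?_
  filter_upwards [hf.ae_hasDerivAt_integral] with x hx hx'
  exact (((hx (uIoc_subset_uIcc hx') c left_mem_uIcc).exp).deriv).symm

/-- The exponential of the integral of `b`, times the product of the factors `1 + a_k` over the jump
times `k ∈ J` up to time `u`. -/
noncomputable def linSol (t : ℝ≥0) (w : ℝ) (b : ℝ≥0 → ℝ) (J : Finset ℝ≥0) (a : ℝ≥0 → ℝ)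
    (u : ℝ≥0) : ℝ :=
  w * (Real.exp (∫ s in Ioc t u, b s ∂leb) * ∏ k ∈ J with k ≤ u, (1 + a k))

lemma integral_exp_mul_leb (hb : IntegrableOn b (Ioc t T) leb) (hbC : ∀ s ∈ Ioc t T, |b s| ≤ C)
    {u : ℝ≥0} (hu : u ∈ Icc t T) :
    ∫ s in Ioc t u, Real.exp (∫ r in Ioc t s, b r ∂leb) * b s ∂leb =
      Real.exp (∫ r in Ioc t u, b r ∂leb) - 1 := by
  have htu : (t : ℝ) ≤ u := by exact_mod_cast hu.1
  have hb' : IntegrableOn b (Ioc t u) leb := hb.mono_set (Ioc_subset_Ioc_right hu.2)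
  rw [setIntegral_leb _ hu.1, setIntegral_leb _ hu.1,
    ← integral_exp_mul (C := C) htu ((integrableOn_leb_iff b hu.1).1 hb') fun x hx => hbC _ ?_]
  · refine intervalIntegral.integral_congr fun x hx => ?_
    rw [uIcc_of_le htu] at hx
    have hx0 : (0 : ℝ) ≤ x := t.2.trans hx.1
    rw [setIntegral_leb _ (NNReal.le_toNNReal_of_coe_le hx.1), Real.coe_toNNReal _ hx0]
  · have hx0 : (0 : ℝ) ≤ x := t.2.trans hx.1.le
    refine ⟨?_, ?_⟩
    · rw [← NNReal.coe_lt_coe, Real.coe_toNNReal _ hx0]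
      exact hx.1
    · rw [← NNReal.coe_le_coe, Real.coe_toNNReal _ hx0]
      exact hx.2.trans (by exact_mod_cast hu.2)

lemma abs_integral_sub_le (hb : IntegrableOn b (Ioc t T) leb) (hbC : ∀ s ∈ Ioc t T, |b s| ≤ C)
    {u v : ℝ≥0} (htu : t ≤ u) (huv : u ≤ v) (hvT : v ≤ T) :
    |∫ s in Ioc t v, b s ∂leb - ∫ s in Ioc t u, b s ∂leb| ≤ C * ((v : ℝ) - u) := by
  have h : ∫ s in Ioc t v, b s ∂leb = ∫ s in Ioc t u, b s ∂leb + ∫ s in Ioc u v, b s ∂leb := by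
    rw [← Ioc_union_Ioc_eq_Ioc htu huv, setIntegral_union (Ioc_disjoint_Ioc_of_le le_rfl)
      measurableSet_Ioc (hb.mono_set (Ioc_subset_Ioc_right (huv.trans hvT)))
      (hb.mono_set (Ioc_subset_Ioc htu hvT))]
  rw [h, add_sub_cancel_left]
  have := norm_setIntegral_le_of_norm_le_const (f := b) (C := C) (s := Ioc u v) (μ := leb)
    (by rw [leb_Ioc]; exact ENNReal.ofReal_lt_top)
    fun r hr => hbC r ⟨htu.trans_lt hr.1, hr.2.trans hvT⟩
  rwa [measureReal_def, leb_Ioc, ENNReal.toReal_ofReal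
    (sub_nonneg.2 (by exact_mod_cast huv))] at this

lemma continuousOn_integral_leb (hb : IntegrableOn b (Ioc t T) leb)
    (hbC : ∀ s ∈ Ioc t T, |b s| ≤ C) :
    ContinuousOn (fun u => ∫ s in Ioc t u, b s ∂leb) (Icc t T) := by
  have : LipschitzOnWith (max C 0).toNNReal (fun u => ∫ s in Ioc t u, b s ∂leb) (Icc t T) := by
    refine LipschitzOnWith.of_dist_le_mul fun x hx y hy => ?_
    rw [Real.coe_toNNReal _ (le_max_right _ _)]
    wlog hxy : y ≤ x generalizing x y
    · rw [dist_comm, dist_comm x]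
      exact this y hy x hx (le_of_not_ge hxy)
    rw [Real.dist_eq, NNReal.dist_eq, abs_of_nonneg (a := (x : ℝ) - y)
      (sub_nonneg.2 (by exact_mod_cast hxy))]
    refine (abs_integral_sub_le hb hbC hy.1 hxy hx.2).trans ?_
    have : (0 : ℝ) ≤ x - y := sub_nonneg.2 (by exact_mod_cast hxy)
    gcongr
    exact le_max_left _ _
  exact this.continuousOn

lemma eventually_filter_le_eq (J : Finset ℝ≥0) (s : ℝ≥0) :
    ∀ᶠ r in 𝓝[>] s, (J.filter (· ≤ r)) = J.filter (· ≤ s) := by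
  have : ∀ᶠ r in 𝓝[>] s, ∀ k ∈ J, (k ≤ r ↔ k ≤ s) := by
    rw [Filter.eventually_all_finset]
    intro k _
    by_cases hk : k ≤ s
    · filter_upwards [self_mem_nhdsWithin] with r hr
      simp [hk, hk.trans (le_of_lt hr)]
    · filter_upwards [Ioo_mem_nhdsGT (not_le.1 hk)] with r hr
      simp [hk, hr.2]
  filter_upwards [this] with r hr
  exact Finset.filter_congr hr

lemma eventually_filter_lt_eq (J : Finset ℝ≥0) {t s : ℝ≥0} (hts : t < s) :
    ∀ᶠ r in 𝓝[<] s, (J.filter (· ≤ r)) = J.filter (· < s) := by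
  have : ∀ᶠ r in 𝓝[<] s, ∀ k ∈ J, (k ≤ r ↔ k < s) := by
    rw [Filter.eventually_all_finset]
    intro k _
    by_cases hk : k < s
    · filter_upwards [Ioo_mem_nhdsLT hk] with r hr
      simp [hk, hr.1.le]
    · filter_upwards [Ioo_mem_nhdsLT hts] with r hr
      simp [hk, hr.2.trans_le (not_lt.1 hk)]
  filter_upwards [this] with r hr
  exact Finset.filter_congr hr

lemma tendsto_linSol_left (hb : IntegrableOn b (Ioc t T) leb) (hbC : ∀ s ∈ Ioc t T, |b s| ≤ C)
    {s : ℝ≥0} (hs : s ∈ Ioc t T) :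
    Tendsto (linSol t w b J a) (𝓝[<] s)
      (𝓝 (w * (Real.exp (∫ r in Ioc t s, b r ∂leb) * ∏ k ∈ J with k < s, (1 + a k)))) := by
  have h1 : Tendsto (fun u => ∫ r in Ioc t u, b r ∂leb) (𝓝[<] s)
      (𝓝 (∫ r in Ioc t s, b r ∂leb)) := by
    refine (continuousOn_integral_leb hb hbC s ⟨hs.1.le, hs.2⟩).tendsto.mono_left ?_
    rw [nhdsWithin_le_iff]
    filter_upwards [Ioo_mem_nhdsLT hs.1] with r hr using ⟨hr.1.le, hr.2.le.trans hs.2⟩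
  refine ((h1.rexp).mul (tendsto_const_nhds.congr' ?_)).const_mul w
  filter_upwards [eventually_filter_lt_eq J hs.1] with r hr
  rw [hr]

lemma cadlagOn_linSol (hb : IntegrableOn b (Ioc t T) leb) (hbC : ∀ s ∈ Ioc t T, |b s| ≤ C) :
    CadlagOn (linSol t w b J a) t T := by
  refine ⟨fun s hs => ?_, fun s hs => ⟨_, tendsto_linSol_left hb hbC hs⟩⟩
  have h1 : Tendsto (fun u => ∫ r in Ioc t u, b r ∂leb) (𝓝[>] s)
      (𝓝 (∫ r in Ioc t s, b r ∂leb)) := by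
    refine (continuousOn_integral_leb hb hbC s ⟨hs.1, hs.2.le⟩).tendsto.mono_left ?_
    rw [nhdsWithin_le_iff]
    filter_upwards [Ioo_mem_nhdsGT hs.2] with r hr using ⟨hs.1.trans hr.1.le, hr.2.le⟩
  refine ((h1.rexp).mul (tendsto_const_nhds.congr' ?_)).const_mul w
  filter_upwards [eventually_filter_le_eq J s] with r hr
  rw [hr]

lemma leftLim_linSol (hb : IntegrableOn b (Ioc t T) leb) (hbC : ∀ s ∈ Ioc t T, |b s| ≤ C)
    {s : ℝ≥0} (hs : s ∈ Ioc t T) : Function.leftLim (linSol t w b J a) s =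
      w * (Real.exp (∫ r in Ioc t s, b r ∂leb) * ∏ k ∈ J with k < s, (1 + a k)) :=
  haveI := neBot_nhdsLT hs.1
  leftLim_eq_of_tendsto (tendsto_linSol_left hb hbC hs)

/-- The integral equation for `linSol`, by induction on the jump times in increasing order. -/
lemma exp_mul_prod_eq (hb : IntegrableOn b (Ioc t T) leb) (hbC : ∀ s ∈ Ioc t T, |b s| ≤ C)
    (J : Finset ℝ≥0) (hJ : ∀ k ∈ J, k ∈ Ioc t T) : ∀ u ∈ Icc t T,
    Real.exp (∫ s in Ioc t u, b s ∂leb) * ∏ k ∈ J with k ≤ u, (1 + a k) =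
      1 + ∫ s in Ioc t u,
          Real.exp (∫ r in Ioc t s, b r ∂leb) * (∏ k ∈ J with k < s, (1 + a k)) * b s ∂leb +
        ∑ m ∈ J with m ≤ u,
          Real.exp (∫ r in Ioc t m, b r ∂leb) * (∏ k ∈ J with k < m, (1 + a k)) * a m := by
  induction J using Finset.induction_on_max with
  | empty =>
    intro u hu
    simp [integral_exp_mul_leb hb hbC hu]
  | insert m J hm ih =>
    have hmJ : m ∉ J := fun h => lt_irrefl _ (hm m h)
    have hmT : m ∈ Ioc t T := hJ m (Finset.mem_insert_self _ _)
    have ih' := ih fun k hk => hJ k (Finset.mem_insert_of_mem hk)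
    have hlt : ∀ s, s ≤ m → (insert m J).filter (· < s) = J.filter (· < s) := fun s hs => by
      rw [Finset.filter_insert, if_neg (not_lt.2 hs)]
    have hsum : ∀ v, ∑ n ∈ J with n ≤ v, Real.exp (∫ r in Ioc t n, b r ∂leb) *
          (∏ k ∈ insert m J with k < n, (1 + a k)) * a n =
        ∑ n ∈ J with n ≤ v, Real.exp (∫ r in Ioc t n, b r ∂leb) *
          (∏ k ∈ J with k < n, (1 + a k)) * a n := fun v => by
      refine Finset.sum_congr rfl fun n hn => ?_
      rw [hlt n (hm n (Finset.mem_filter.1 hn).1).le]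
    intro u hu
    rcases lt_or_ge u m with hum | hum
    · have h1 : (insert m J).filter (· ≤ u) = J.filter (· ≤ u) := by
        rw [Finset.filter_insert, if_neg (not_le.2 hum)]
      rw [h1, hsum, ih' u hu]
      congr 2
      refine setIntegral_congr_fun measurableSet_Ioc fun s hs => ?_
      rw [hlt s (hs.2.trans hum.le)]
    · have hgt : ∀ s, m < s → (insert m J).filter (· < s) = insert m (J.filter (· < s)) :=
        fun s hs => by rw [Finset.filter_insert, if_pos hs]
      have hnot : ∀ p : ℝ≥0 → Prop, ∀ [DecidablePred p], m ∉ J.filter p := fun p _ h =>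
        hmJ (Finset.mem_filter.1 h).1
      have h1 : (insert m J).filter (· ≤ u) = insert m (J.filter (· ≤ u)) := by
        rw [Finset.filter_insert, if_pos hum]
      have hall : ∀ s, m ≤ s → J.filter (· < s) = J := fun s hs =>
        Finset.filter_true_of_mem fun k hk => (hm k hk).trans_le hs
      have hall' : ∀ s, m ≤ s → J.filter (· ≤ s) = J := fun s hs =>
        Finset.filter_true_of_mem fun k hk => (hm k hk).le.trans hs
      -- the integrand without the jump at `m` is integrable, being bounded
      have hintg : ∀ v ≤ T, IntegrableOn (fun s => Real.exp (∫ r in Ioc t s, b r ∂leb) *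
          (∏ k ∈ J with k < s, (1 + a k)) * b s) (Ioc t v) leb := fun v hv => by
        refine (integrableOn_leftLim_mul (X := linSol t 1 b J a) (cadlagOn_linSol hb hbC) hb
          le_rfl hv).congr_fun (fun s hs => ?_) measurableSet_Ioc
        simp only
        rw [leftLim_linSol hb hbC ⟨hs.1, hs.2.trans hv⟩, one_mul]
      have e1 : ∫ s in Ioc t u, Real.exp (∫ r in Ioc t s, b r ∂leb) *
            (∏ k ∈ insert m J with k < s, (1 + a k)) * b s ∂leb =
          ∫ s in Ioc t m, Real.exp (∫ r in Ioc t s, b r ∂leb) *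
            (∏ k ∈ J with k < s, (1 + a k)) * b s ∂leb +
          (1 + a m) * ∫ s in Ioc m u, Real.exp (∫ r in Ioc t s, b r ∂leb) *
            (∏ k ∈ J with k < s, (1 + a k)) * b s ∂leb := by
        have c1 : EqOn (fun s => Real.exp (∫ r in Ioc t s, b r ∂leb) *
            (∏ k ∈ insert m J with k < s, (1 + a k)) * b s)
            (fun s => Real.exp (∫ r in Ioc t s, b r ∂leb) *
              (∏ k ∈ J with k < s, (1 + a k)) * b s) (Ioc t m) := fun s hs => by
          simp only
          rw [hlt s hs.2]
        have c2 : EqOn (fun s => Real.exp (∫ r in Ioc t s, b r ∂leb) *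
            (∏ k ∈ insert m J with k < s, (1 + a k)) * b s)
            (fun s => (1 + a m) * (Real.exp (∫ r in Ioc t s, b r ∂leb) *
              (∏ k ∈ J with k < s, (1 + a k)) * b s)) (Ioc m u) := fun s hs => by
          simp only
          rw [hgt s hs.1, Finset.prod_insert (hnot _)]
          ring
        rw [← Ioc_union_Ioc_eq_Ioc hmT.1.le hum, setIntegral_union
          (Ioc_disjoint_Ioc_of_le le_rfl) measurableSet_Ioc
          ((hintg m hmT.2).congr_fun c1.symm measurableSet_Ioc)
          (IntegrableOn.congr_fun (((hintg u hu.2).mono_set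
            (Ioc_subset_Ioc_left hmT.1.le)).const_mul (1 + a m)) c2.symm measurableSet_Ioc),
          setIntegral_congr_fun measurableSet_Ioc c1, setIntegral_congr_fun measurableSet_Ioc c2,
          integral_const_mul]
      have e2 : ∫ s in Ioc t u, Real.exp (∫ r in Ioc t s, b r ∂leb) *
            (∏ k ∈ J with k < s, (1 + a k)) * b s ∂leb =
          ∫ s in Ioc t m, Real.exp (∫ r in Ioc t s, b r ∂leb) *
            (∏ k ∈ J with k < s, (1 + a k)) * b s ∂leb +
          ∫ s in Ioc m u, Real.exp (∫ r in Ioc t s, b r ∂leb) *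
            (∏ k ∈ J with k < s, (1 + a k)) * b s ∂leb := by
        rw [← Ioc_union_Ioc_eq_Ioc hmT.1.le hum, setIntegral_union
          (Ioc_disjoint_Ioc_of_le le_rfl) measurableSet_Ioc (hintg m hmT.2)
          ((hintg u hu.2).mono_set (Ioc_subset_Ioc_left hmT.1.le))]
      have i1 := ih' u hu
      have i2 := ih' m ⟨hmT.1.le, hmT.2⟩
      rw [h1, Finset.prod_insert (hnot _), Finset.sum_insert (hnot _), hsum, e1, hlt m le_rfl,
        hall m le_rfl, hall' u hum]
      rw [e2, hall' u hum] at i1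
      rw [hall' m le_rfl] at i2
      linear_combination (1 + a m) * i1 - a m * i2

lemma solvesLinear_linSol (hb : IntegrableOn b (Ioc t T) leb) (hbC : ∀ s ∈ Ioc t T, |b s| ≤ C)
    (hJ : ∀ k ∈ J, k ∈ Ioc t T) : SolvesLinear t T w b J a (linSol t w b J a) := by
  intro u hu
  have h1 : ∫ s in Ioc t u, Function.leftLim (linSol t w b J a) s * b s ∂leb =
      w * ∫ s in Ioc t u,
          Real.exp (∫ r in Ioc t s, b r ∂leb) * (∏ k ∈ J with k < s, (1 + a k)) * b s ∂leb := by
    rw [← integral_const_mul]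
    refine setIntegral_congr_fun measurableSet_Ioc fun s hs => ?_
    rw [leftLim_linSol hb hbC ⟨hs.1, hs.2.trans hu.2⟩, mul_assoc]
  have h2 : ∑ m ∈ J with m ≤ u, Function.leftLim (linSol t w b J a) m * a m =
      w * ∑ m ∈ J with m ≤ u,
          Real.exp (∫ r in Ioc t m, b r ∂leb) * (∏ k ∈ J with k < m, (1 + a k)) * a m := by
    rw [Finset.mul_sum]
    refine Finset.sum_congr rfl fun m hm => ?_
    rw [leftLim_linSol hb hbC (hJ m (Finset.mem_filter.1 hm).1), mul_assoc]
  rw [h1, h2, linSol, exp_mul_prod_eq hb hbC J hJ u hu]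
  ring

end Linear

/-! ### Finite point measures and their jump measures -/

section PointMeasure

lemma setIntegral_sum_dirac {α ι : Type*} [MeasurableSpace α] [MeasurableSingletonClass α]
    (F : Finset ι) (e : ι → α) {A : Set α} (hA : MeasurableSet A) (p : ι → Prop) [DecidablePred p]
    (hp : ∀ i ∈ F, p i ↔ e i ∈ A) (f : α → ℝ) :
    ∫ x in A, f x ∂(∑ i ∈ F, Measure.dirac (e i)) = ∑ i ∈ F with p i, f (e i) := by
  classical
  rw [← integral_indicator hA, integral_finsetSum_measure fun i _ => integrable_dirac (by simp),
    Finset.sum_filter]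
  refine Finset.sum_congr rfl fun i hi => ?_
  rw [integral_dirac, indicator_apply]
  simp only [hp i hi]

lemma setLIntegral_sum_dirac {α ι : Type*} [MeasurableSpace α] [MeasurableSingletonClass α]
    (F : Finset ι) (e : ι → α) {A : Set α} (hA : MeasurableSet A) (p : ι → Prop) [DecidablePred p]
    (hp : ∀ i ∈ F, p i ↔ e i ∈ A) (f : α → ℝ≥0∞) :
    ∫⁻ x in A, f x ∂(∑ i ∈ F, Measure.dirac (e i)) = ∑ i ∈ F with p i, f (e i) := by
  classical
  rw [← lintegral_indicator hA, lintegral_finsetSum_measure, Finset.sum_filter]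
  refine Finset.sum_congr rfl fun i hi => ?_
  rw [lintegral_dirac, indicator_apply]
  simp only [hp i hi]

lemma jumpMeasure_eq_sum {R : ℝ≥0 → ℝ} {t T : ℝ≥0} {J : Finset ℝ≥0}
    (hJ : ∀ s, s ∈ J ↔ s ∈ Ioc t T ∧ R s ≠ Function.leftLim R s) :
    jumpMeasure R t T = ∑ s ∈ J, Measure.dirac (s, R s - Function.leftLim R s) := by
  have hset : {s : ℝ≥0 | s ∈ Ioc t T ∧ R s ≠ Function.leftLim R s} = ↑J := by
    ext s
    simpa using (hJ s).symm
  refine Measure.ext fun A hA => ?_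
  rw [jumpMeasure, Measure.sum_apply _ hA, Measure.finsetSum_apply,
    ← Finset.tsum_subtype J fun s => Measure.dirac (s, R s - Function.leftLim R s) A]
  exact (Equiv.subtypeEquivRight fun s => (hJ s).symm).tsum_eq
    (fun s : {s // s ∈ J} => Measure.dirac ((s : ℝ≥0), R s - Function.leftLim R s) A)

lemma setIntegral_jumpMeasure {R : ℝ≥0 → ℝ} {t T u : ℝ≥0} {J : Finset ℝ≥0}
    (hJ : ∀ s, s ∈ J ↔ s ∈ Ioc t T ∧ R s ≠ Function.leftLim R s) (f : ℝ≥0 × ℝ → ℝ) :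
    ∫ p in Ioc t u ×ˢ univ, f p ∂(jumpMeasure R t T) =
      ∑ s ∈ J with s ≤ u, f (s, R s - Function.leftLim R s) := by
  rw [jumpMeasure_eq_sum hJ]
  refine setIntegral_sum_dirac J (fun s => (s, R s - Function.leftLim R s))
    (measurableSet_Ioc.prod MeasurableSet.univ) (· ≤ u) (fun s hs => ?_) f
  simp [((hJ s).1 hs).1.1]

variable {S : Type*} [MeasurableSpace S] {n : Measure (ℝ≥0 × S)} {t T : ℝ≥0}
  {F : Finset (ℝ≥0 × S)}

/-- On `(t, T] × S` the measure `n` is the sum of the unit masses at the points of the finite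
set `F`, which lie at distinct times. -/
def IsFinitePoint (n : Measure (ℝ≥0 × S)) (t T : ℝ≥0) (F : Finset (ℝ≥0 × S)) : Prop :=
  Set.InjOn Prod.fst (F : Set (ℝ≥0 × S)) ∧
    n.restrict (Ioc t T ×ˢ univ) = ∑ p ∈ F, Measure.dirac p

lemma restrict_Ioc_prod_eq {u : ℝ≥0} (hu : u ≤ T) : n.restrict (Ioc t u ×ˢ univ) =
    (n.restrict (Ioc t T ×ˢ univ)).restrict (Ioc t u ×ˢ univ) := by
  rw [Measure.restrict_restrict (measurableSet_Ioc.prod MeasurableSet.univ), inter_eq_left.2]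
  exact prod_mono (Ioc_subset_Ioc_right hu) le_rfl

variable [MeasurableSingletonClass S]

lemma IsFinitePoint.mem_Ioc (hn : IsFinitePoint n t T F) {p : ℝ≥0 × S} (hp : p ∈ F) :
    p.1 ∈ Ioc t T := by
  by_contra hcon
  have h0 : (n.restrict (Ioc t T ×ˢ univ)) (Ioc t T ×ˢ (univ : Set S))ᶜ = 0 := by
    rw [Measure.restrict_apply (measurableSet_Ioc.prod MeasurableSet.univ).compl]
    simp
  rw [hn.2, Measure.finsetSum_apply, Finset.sum_eq_zero_iff] at h0
  have := h0 p hp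
  rw [Measure.dirac_apply] at this
  have hp' : p ∈ (Ioc t T ×ˢ (univ : Set S))ᶜ := fun h => hcon h.1
  simp [hp'] at this

lemma IsFinitePoint.setIntegral (hn : IsFinitePoint n t T F) {u : ℝ≥0} (hu : u ≤ T)
    (f : ℝ≥0 × S → ℝ) : ∫ p in Ioc t u ×ˢ univ, f p ∂n = ∑ p ∈ F with p.1 ≤ u, f p := by
  rw [restrict_Ioc_prod_eq hu, hn.2]
  exact setIntegral_sum_dirac F (fun p => p) (measurableSet_Ioc.prod MeasurableSet.univ)
    (fun p => p.1 ≤ u) (fun p hp => by simp [(hn.mem_Ioc hp).1]) f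

lemma IsFinitePoint.setLIntegral (hn : IsFinitePoint n t T F) (f : ℝ≥0 × S → ℝ≥0∞) :
    ∫⁻ p in Ioc t T ×ˢ univ, f p ∂n = ∑ p ∈ F, f p := by
  classical
  rw [restrict_Ioc_prod_eq le_rfl, hn.2]
  rw [setLIntegral_sum_dirac F (fun p => p) (measurableSet_Ioc.prod MeasurableSet.univ)
    (fun p => p.1 ≤ T) (fun p hp => by simp [(hn.mem_Ioc hp).1]) f]
  rw [Finset.filter_true_of_mem fun p hp => (hn.mem_Ioc hp).2]

lemma IsFinitePoint.integrableOn (hn : IsFinitePoint n t T F) (f : ℝ≥0 × S → ℝ) :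
    IntegrableOn f (Ioc t T ×ˢ univ) n := by
  rw [IntegrableOn, hn.2, integrable_finsetSum_measure]
  exact fun p _ => integrable_dirac (by simp)

lemma IsFinitePoint.leftLim_integral (hn : IsFinitePoint n t T F) {s : ℝ≥0} (hs : s ∈ Ioc t T)
    (f : ℝ≥0 × S → ℝ) : Function.leftLim (fun r => ∫ p in Ioc t r ×ˢ univ, f p ∂n) s =
      ∑ p ∈ F with p.1 < s, f p := by
  have := neBot_nhdsLT hs.1
  refine leftLim_eq_of_tendsto (tendsto_const_nhds.congr' ?_)
  have hev : ∀ᶠ r in 𝓝[<] s, ∀ p ∈ F, (p.1 ≤ r ↔ p.1 < s) := by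
    rw [Filter.eventually_all_finset]
    intro p _
    by_cases hk : p.1 < s
    · filter_upwards [Ioo_mem_nhdsLT hk] with r hr
      simp [hk, hr.1.le]
    · filter_upwards [Ioo_mem_nhdsLT hs.1] with r hr
      simp [hk, hr.2.trans_le (not_lt.1 hk)]
  filter_upwards [hev, Ioo_mem_nhdsLT hs.1] with r hr hrs
  rw [hn.setIntegral (hrs.2.le.trans hs.2)]
  exact Finset.sum_congr (Finset.filter_congr fun p hp => (hr p hp).symm) fun _ _ => rfl

/-- The jump of the integral process at time `s` is the integrand at the point at time `s`. -/
lemma IsFinitePoint.jump_eq (hn : IsFinitePoint n t T F) {s : ℝ≥0} (hs : s ∈ Ioc t T)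
    (f : ℝ≥0 × S → ℝ) : ∫ p in Ioc t s ×ˢ univ, f p ∂n -
      Function.leftLim (fun r => ∫ p in Ioc t r ×ˢ univ, f p ∂n) s =
        ∑ p ∈ F with p.1 = s, f p := by
  rw [hn.leftLim_integral hs, hn.setIntegral hs.2, sub_eq_iff_eq_add]
  simp only [Finset.sum_filter]
  rw [← Finset.sum_add_distrib]
  refine Finset.sum_congr rfl fun p _ => ?_
  rcases lt_trichotomy p.1 s with h | h | h
  · simp [h, h.le, h.ne]
  · simp [h]
  · simp [h.not_ge, h.not_gt, h.ne']

lemma IsFinitePoint.jump_at (hn : IsFinitePoint n t T F) {q : ℝ≥0 × S} (hq : q ∈ F)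
    (f : ℝ≥0 × S → ℝ) : ∫ p in Ioc t q.1 ×ˢ univ, f p ∂n -
      Function.leftLim (fun r => ∫ p in Ioc t r ×ˢ univ, f p ∂n) q.1 = f q := by
  rw [hn.jump_eq (hn.mem_Ioc hq), Finset.sum_eq_single_of_mem q (by simp [hq])]
  intro p hp hpq
  rw [Finset.mem_filter] at hp
  exact absurd (hn.1 hp.1 hq hp.2) hpq

open Classical in
/-- The jump times of the integral process are the times of the points where the integrand does not
vanish. -/
lemma IsFinitePoint.mem_jumpTimes (hn : IsFinitePoint n t T F) (f : ℝ≥0 × S → ℝ) (s : ℝ≥0) :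
    s ∈ (F.filter (f · ≠ 0)).image Prod.fst ↔ s ∈ Ioc t T ∧
      ∫ p in Ioc t s ×ˢ univ, f p ∂n ≠
        Function.leftLim (fun r => ∫ p in Ioc t r ×ˢ univ, f p ∂n) s := by
  rw [Finset.mem_image]
  constructor
  · rintro ⟨q, hq, rfl⟩
    rw [Finset.mem_filter] at hq
    refine ⟨hn.mem_Ioc hq.1, ?_⟩
    rw [← sub_ne_zero, hn.jump_at hq.1]
    exact hq.2
  · rintro ⟨hs, hne⟩
    rw [← sub_ne_zero, hn.jump_eq hs] at hne
    obtain ⟨q, hq, hq0⟩ := Finset.exists_ne_zero_of_sum_ne_zero hne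
    rw [Finset.mem_filter] at hq
    exact ⟨q, Finset.mem_filter.2 ⟨hq.1, hq0⟩, hq.2⟩

open Classical in
/-- If all factors are positive, the product of the factors `1 + h ΔR` over the jump times is the
exponential of the integral of `log (1 + h f)` with respect to the point measure. -/
lemma IsFinitePoint.prod_eq_exp (hn : IsFinitePoint n t T F) (f : ℝ≥0 × S → ℝ) (h : ℝ≥0 → ℝ)
    (hpos : ∀ p ∈ F, 0 < 1 + h p.1 * f p) {u : ℝ≥0} (hu : u ≤ T) :
    ∏ s ∈ (F.filter (f · ≠ 0)).image Prod.fst with s ≤ u,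
        (1 + h s * (∫ p in Ioc t s ×ˢ univ, f p ∂n -
          Function.leftLim (fun r => ∫ p in Ioc t r ×ˢ univ, f p ∂n) s)) =
      Real.exp (∫ p in Ioc t u ×ˢ univ, Real.log (1 + h p.1 * f p) ∂n) := by
  rw [hn.setIntegral hu, Real.exp_sum, Finset.filter_image, Finset.prod_image]
  · rw [Finset.filter_filter, Finset.prod_filter, Finset.prod_filter]
    refine Finset.prod_congr rfl fun p hp => ?_
    by_cases hf : f p = 0
    · simp [hf]
    · simp only [ne_eq, hf, not_false_eq_true, true_and]
      rw [hn.jump_at hp, Real.exp_log (hpos p hp)]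
  · refine hn.1.mono ?_
    intro p hp
    exact (Finset.mem_filter.1 (Finset.mem_filter.1 (Finset.mem_coe.1 hp)).1).1

end PointMeasure

/-! ### The compensation formula -/

lemma isSFiniteKernel_of_forall_lt_top {α β : Type*} {mα : MeasurableSpace α}
    {mβ : MeasurableSpace β} (κ : Kernel α β) (h : ∀ a, κ a univ < ∞) : IsSFiniteKernel κ := by
  classical
  have hm : Measurable fun a => ⌊(κ a univ).toReal⌋₊ :=
    Nat.measurable_floor.comp (κ.measurable_coe MeasurableSet.univ).ennreal_toReal
  have hs : ∀ n : ℕ, MeasurableSet {a | ⌊(κ a univ).toReal⌋₊ = n} := fun n =>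
    hm (measurableSet_singleton n)
  have hfin : ∀ n : ℕ, IsFiniteKernel (Kernel.piecewise (hs n) κ 0) := fun n => by
    refine ⟨ENNReal.ofReal (n + 1), ENNReal.ofReal_lt_top, fun a => ?_⟩
    rw [Kernel.piecewise_apply]
    split_ifs with ha
    · have ha' : ⌊(κ a univ).toReal⌋₊ = n := ha
      rw [← ENNReal.ofReal_toReal (h a).ne]
      refine ENNReal.ofReal_le_ofReal ?_
      rw [← ha']
      exact (Nat.lt_floor_add_one _).le
    · simp
  have hsum : κ = Kernel.sum fun n => Kernel.piecewise (hs n) κ 0 := by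
    ext a A hA
    rw [Kernel.sum_apply, Measure.sum_apply _ hA, tsum_eq_single ⌊(κ a univ).toReal⌋₊]
    · rw [Kernel.piecewise_apply, if_pos]
      rfl
    · intro n hn
      rw [Kernel.piecewise_apply, if_neg]
      · simp
      · exact fun h => hn h.symm
  rw [hsum]
  infer_instance

lemma measurable_restrict {α β : Type*} {mα : MeasurableSpace α} {mβ : MeasurableSpace β}
    {n : α → Measure β} {A : Set β} (hA : MeasurableSet A)
    (h : ∀ C, MeasurableSet C → C ⊆ A → Measurable fun a => n a C) :
    Measurable fun a => (n a).restrict A := by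
  refine Measure.measurable_of_measurable_coe _ fun C hC => ?_
  simp only [Measure.restrict_apply hC]
  exact h _ (hC.inter hA) inter_subset_right

lemma lintegral_poissonMeasure_cast (r : ℝ≥0) : ∫⁻ n : ℕ, (n : ℝ≥0∞) ∂(poissonMeasure r) = r := by
  have hs : HasSum (fun n : ℕ => Real.exp (-r) * (r : ℝ) ^ n / n.factorial * n) r := by
    rw [← hasSum_nat_add_iff' 1]
    have := (hasSum_one_poissonMeasure r).mul_right (r : ℝ)
    simp only [Finset.range_one, Finset.sum_singleton, Nat.cast_zero, mul_zero, sub_zero]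
    rw [one_mul] at this
    convert! this using 1
    funext n
    have h1 : ((n : ℝ) + 1) ≠ 0 := by positivity
    rw [Nat.factorial_succ]
    push_cast
    field_simp
    ring
  rw [poissonMeasure, lintegral_sum_measure]
  simp only [lintegral_smul_measure, lintegral_dirac, smul_eq_mul]
  have h1 : ∀ n : ℕ, ENNReal.ofReal (Real.exp (-r) * (r : ℝ) ^ n / n.factorial) * (n : ℝ≥0∞) =
      ENNReal.ofReal (Real.exp (-r) * (r : ℝ) ^ n / n.factorial * n) := fun n => by
    rw [ENNReal.ofReal_mul (by positivity), ENNReal.ofReal_natCast]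
  simp only [h1]
  rw [← ENNReal.ofReal_tsum_of_nonneg (fun n => by positivity) hs.summable, hs.tsum_eq,
    ENNReal.ofReal_coe_nnreal]

/-- Two measures on a product that agree on rectangles over a generator integrate all jointly
measurable functions in the same way. Here the first one is the random measure `κ`, the second one
the product of its intensity and the probability; both are transported to `X × S` by a map `e` of
the scenario and the time. -/
lemma lintegral_eq_of_generator {Ω S X : Type*} {mΩ : MeasurableSpace Ω} [MeasurableSpace S]
    {mX : MeasurableSpace X} {P : Measure Ω} [IsFiniteMeasure P] (κ : Kernel Ω (ℝ≥0 × S))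
    [IsSFiniteKernel κ] (l : Measure ℝ≥0) [IsFiniteMeasure l] (ς : Measure S) [IsFiniteMeasure ς]
    {e : ℝ≥0 × Ω → X} (he : Measurable e) {𝒞 : Set (Set X)}
    (hgen : mX = MeasurableSpace.generateFrom 𝒞) (hpi : IsPiSystem 𝒞) (huniv : univ ∈ 𝒞)
    (h : ∀ A ∈ 𝒞, ∀ B : Set S, MeasurableSet B →
      ∫⁻ ω, κ ω {p | e (p.1, ω) ∈ A ∧ p.2 ∈ B} ∂P = ∫⁻ ω, l {s | e (s, ω) ∈ A} * ς B ∂P)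
    {H : X × S → ℝ≥0∞} (hH : Measurable H) :
    ∫⁻ ω, ∫⁻ p, H (e (p.1, ω), p.2) ∂(κ ω) ∂P =
      ∫⁻ ω, ∫⁻ s, ∫⁻ ζ, H (e (s, ω), ζ) ∂ς ∂l ∂P := by
  set φ : Ω × (ℝ≥0 × S) → X × S := fun q => (e (q.2.1, q.1), q.2.2) with hφ
  have hφm : Measurable φ := by
    refine Measurable.prodMk (he.comp ?_) ?_ <;> fun_prop
  set m₁ : Measure (X × S) := (P ⊗ₘ κ).map φ with hm₁
  set m₂ : Measure (X × S) := (P.prod (l.prod ς)).map φ with hm₂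
  have hrect : ∀ A ∈ 𝒞, ∀ B : Set S, MeasurableSet B → m₁ (A ×ˢ B) = m₂ (A ×ˢ B) := by
    intro A hA B hB
    have hAm : MeasurableSet A := hgen ▸ MeasurableSpace.measurableSet_generateFrom hA
    rw [hm₁, hm₂, Measure.map_apply hφm (hAm.prod hB), Measure.map_apply hφm (hAm.prod hB),
      Measure.compProd_apply (hφm (hAm.prod hB)), Measure.prod_apply (hφm (hAm.prod hB))]
    refine (h A hA B hB).trans (lintegral_congr fun ω => ?_)
    have : Prod.mk ω ⁻¹' (φ ⁻¹' A ×ˢ B) = {s | e (s, ω) ∈ A} ×ˢ B := by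
      ext p
      simp [hφ]
    rw [this, Measure.prod_prod]
  have heq : m₂ = m₁ := by
    refine ext_of_generate_finite (image2 (· ×ˢ ·) 𝒞 {B | MeasurableSet B})
      (generateFrom_eq_prod hgen.symm MeasurableSpace.generateFrom_measurableSet
        ⟨fun _ => univ, fun _ => huniv, iUnion_const _⟩
        ⟨fun _ => univ, fun _ => MeasurableSet.univ, iUnion_const _⟩).symm
      (hpi.prod MeasurableSpace.isPiSystem_measurableSet) ?_ ?_
    · rintro _ ⟨A, hA, B, hB, rfl⟩
      exact (hrect A hA B hB).symm
    · rw [← univ_prod_univ]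
      exact (hrect _ huniv _ MeasurableSet.univ).symm
  calc ∫⁻ ω, ∫⁻ p, H (e (p.1, ω), p.2) ∂(κ ω) ∂P = ∫⁻ x, H x ∂m₁ := by
        rw [hm₁, lintegral_map hH hφm]
        exact (Measure.lintegral_compProd (f := fun q => H (φ q)) (hH.comp hφm)).symm
    _ = ∫⁻ x, H x ∂m₂ := by rw [heq]
    _ = ∫⁻ ω, ∫⁻ s, ∫⁻ ζ, H (e (s, ω), ζ) ∂ς ∂l ∂P := by
        rw [hm₂, lintegral_map hH hφm, lintegral_prod (fun q => H (φ q)) (hH.comp hφm).aemeasurable]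
        refine lintegral_congr fun ω => ?_
        exact lintegral_prod (fun q => H (φ (ω, q)))
          ((hH.comp hφm).comp (measurable_prodMk_left (x := ω))).aemeasurable

lemma predictable_le_prod {Ω : Type*} {mΩ : MeasurableSpace Ω} (𝓕 : Filtration ℝ≥0 mΩ) :
    𝓕.predictable ≤ (inferInstance : MeasurableSpace (ℝ≥0 × Ω)) :=
  measurableSpace_le_predictable_of_measurableSet
    (fun A hA => (measurableSet_singleton _).prod (𝓕.le _ A hA))
    (fun i A hA => measurableSet_Ioi.prod (𝓕.le i A hA))

/-- Before time `u`, a predictable process is jointly measurable with respect to `𝓕 u`. -/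
lemma measurable_min_predictable {Ω : Type*} {mΩ : MeasurableSpace Ω} (𝓕 : Filtration ℝ≥0 mΩ)
    (u : ℝ≥0) : @Measurable (Ω × ℝ≥0) (ℝ≥0 × Ω) ((𝓕 u).prod inferInstance) 𝓕.predictable
      fun q => (min q.2 u, q.1) := by
  have h : @Measurable (Ω × ℝ≥0) (Iic u × Ω) ((𝓕 u).prod inferInstance)
      (Subtype.instMeasurableSpace.prod (𝓕 u))
      fun q => (⟨min q.2 u, mem_Iic.2 (min_le_right _ _)⟩, q.1) := by
    let : MeasurableSpace Ω := 𝓕 u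
    refine Measurable.prodMk (Measurable.subtype_mk ?_) measurable_fst
    exact measurable_snd.min measurable_const
  exact measurable_inclusion_predictable.comp h

namespace IsPoissonRandomMeasure

variable {Ω S : Type*} {mΩ : MeasurableSpace Ω} [MeasurableSpace S] {P : Measure Ω}
  {𝓕 : Filtration ℝ≥0 mΩ} {ς : Measure S} {N : Ω → Measure (ℝ≥0 × S)} {t T : ℝ≥0}

lemma exists_isFinitePoint (hN : IsPoissonRandomMeasure P 𝓕 ς N t T) (ω : Ω) :
    ∃ F, IsFinitePoint (N ω) t T F := hN.points ω

lemma measure_lt_top (hN : IsPoissonRandomMeasure P 𝓕 ς N t T) (ω : Ω) {u : ℝ≥0} (hu : u ≤ T) :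
    N ω (Ioc t u ×ˢ univ) < ∞ := by
  obtain ⟨F, _, hF⟩ := hN.points ω
  refine (measure_mono (prod_mono (Ioc_subset_Ioc_right hu) le_rfl)).trans_lt
    (b := N ω (Ioc t T ×ˢ univ)) ?_
  have : N ω (Ioc t T ×ˢ univ) = ∑ p ∈ F, Measure.dirac p univ := by
    rw [← Measure.finsetSum_apply, ← hF, Measure.restrict_apply_univ]
  rw [this]
  simp

/-- The Poisson random measure on `(t, u] × S`, as a kernel from `(Ω, 𝓕 u)`. -/
noncomputable def kernel (hN : IsPoissonRandomMeasure P 𝓕 ς N t T) {u : ℝ≥0} (hu : u ∈ Icc t T) :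
    @Kernel Ω (ℝ≥0 × S) (𝓕 u) _ :=
  @Kernel.mk Ω (ℝ≥0 × S) (𝓕 u) _ (fun ω => (N ω).restrict (Ioc t u ×ˢ univ))
    (measurable_restrict (mα := 𝓕 u) (measurableSet_Ioc.prod MeasurableSet.univ)
      (hN.adapted u hu))

lemma isSFiniteKernel_kernel (hN : IsPoissonRandomMeasure P 𝓕 ς N t T) {u : ℝ≥0}
    (hu : u ∈ Icc t T) : @IsSFiniteKernel Ω (ℝ≥0 × S) (𝓕 u) _ (hN.kernel hu) := by
  let : MeasurableSpace Ω := 𝓕 u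
  refine isSFiniteKernel_of_forall_lt_top _ fun ω => ?_
  change (N ω).restrict (Ioc t u ×ˢ univ) univ < ∞
  rw [Measure.restrict_apply_univ]
  exact hN.measure_lt_top ω hu.2

lemma measurable_min_predictable_prod (𝓕 : Filtration ℝ≥0 mΩ) (u : ℝ≥0) :
    @Measurable (Ω × (ℝ≥0 × S)) ((ℝ≥0 × Ω) × S) ((𝓕 u).prod inferInstance)
      (𝓕.predictable.prod inferInstance) fun q => ((min q.2.1 u, q.1), q.2.2) := by
  let m1 : MeasurableSpace (ℝ≥0 × Ω) := 𝓕.predictable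
  let m2 : MeasurableSpace Ω := 𝓕 u
  have h : Measurable fun q : Ω × (ℝ≥0 × S) => (q.1, q.2.1) := by fun_prop
  exact ((measurable_min_predictable 𝓕 u).comp h).prodMk (by fun_prop)

/-- The integral of a predictable function over `(t, u] × S` is `𝓕 u`-measurable. -/
lemma measurable_setIntegral (hN : IsPoissonRandomMeasure P 𝓕 ς N t T) {u : ℝ≥0}
    (hu : u ∈ Icc t T) {f : (ℝ≥0 × Ω) × S → ℝ}
    (hf : Measurable[𝓕.predictable.prod inferInstance] f) :
    Measurable[𝓕 u] fun ω => ∫ p in Ioc t u ×ˢ univ, f ((p.1, ω), p.2) ∂(N ω) := by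
  have h1 := hf.comp (measurable_min_predictable_prod (S := S) 𝓕 u)
  have h2 : (fun ω => ∫ p in Ioc t u ×ˢ univ, f ((p.1, ω), p.2) ∂(N ω)) =
      fun ω => ∫ p in Ioc t u ×ˢ univ, f ((min p.1 u, ω), p.2) ∂(N ω) := by
    funext ω
    refine setIntegral_congr_fun (measurableSet_Ioc.prod MeasurableSet.univ) fun p hp => ?_
    simp only [min_eq_left hp.1.2]
  rw [h2]
  have := hN.isSFiniteKernel_kernel hu
  let : MeasurableSpace Ω := 𝓕 u
  exact (StronglyMeasurable.integral_kernel_prod_right' (κ := hN.kernel hu)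
    (Measurable.stronglyMeasurable h1)).measurable

lemma measurable_setLIntegral (hN : IsPoissonRandomMeasure P 𝓕 ς N t T) {u : ℝ≥0}
    (hu : u ∈ Icc t T) {f : (ℝ≥0 × Ω) × S → ℝ≥0∞}
    (hf : Measurable[𝓕.predictable.prod inferInstance] f) :
    Measurable[𝓕 u] fun ω => ∫⁻ p in Ioc t u ×ˢ univ, f ((p.1, ω), p.2) ∂(N ω) := by
  have h1 := hf.comp (measurable_min_predictable_prod (S := S) 𝓕 u)
  have h2 : (fun ω => ∫⁻ p in Ioc t u ×ˢ univ, f ((p.1, ω), p.2) ∂(N ω)) =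
      fun ω => ∫⁻ p in Ioc t u ×ˢ univ, f ((min p.1 u, ω), p.2) ∂(N ω) := by
    funext ω
    refine setLIntegral_congr_fun (measurableSet_Ioc.prod MeasurableSet.univ) fun p hp => ?_
    simp only [min_eq_left hp.1.2]
  rw [h2]
  have := hN.isSFiniteKernel_kernel hu
  let : MeasurableSpace Ω := 𝓕 u
  exact Measurable.lintegral_kernel_prod_right' (κ := hN.kernel hu) h1

lemma lintegral_apply [IsProbabilityMeasure P] [IsFiniteMeasure ς]
    (hN : IsPoissonRandomMeasure P 𝓕 ς N t T) (htT : t ≤ T) {C : Set (ℝ≥0 × S)}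
    (hC : MeasurableSet C) (hCT : C ⊆ Ioc t T ×ˢ univ) :
    ∫⁻ ω, N ω C ∂P = (leb.prod ς) C := by
  have hm : Measurable fun ω => N ω C := (hN.adapted T ⟨htT, le_rfl⟩ C hC hCT).mono (𝓕.le T) le_rfl
  have hfin : (leb.prod ς) C ≠ ∞ := by
    refine ne_top_of_le_ne_top ?_ (measure_mono hCT)
    rw [Measure.prod_prod, leb_Ioc]
    exact ENNReal.mul_ne_top ENNReal.ofReal_ne_top (measure_ne_top _ _)
  calc ∫⁻ ω, N ω C ∂P = ∫⁻ x, x ∂(P.map fun ω => N ω C) := (lintegral_map measurable_id hm).symm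
    _ = ((leb.prod ς) C).toNNReal := by
      rw [hN.poisson C hC hCT]
      exact (lintegral_map measurable_id (by fun_prop)).trans (lintegral_poissonMeasure_cast _)
    _ = (leb.prod ς) C := ENNReal.coe_toNNReal hfin

/-- The compensation formula on `(s, T] × B`, for events of the past of `s`. -/
lemma setLIntegral_apply [IsProbabilityMeasure P] [IsFiniteMeasure ς]
    (hN : IsPoissonRandomMeasure P 𝓕 ς N t T) {s : ℝ≥0} (hs : s ∈ Icc t T) {A : Set Ω}
    (hA : MeasurableSet[𝓕 s] A) {B : Set S} (hB : MeasurableSet B) :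
    ∫⁻ ω in A, N ω (Ioc s T ×ˢ B) ∂P = P A * (leb (Ioc s T) * ς B) := by
  have htT : t ≤ T := hs.1.trans hs.2
  set C : Set (ℝ≥0 × S) := Ioc s T ×ˢ B with hC
  have hCm : MeasurableSet C := measurableSet_Ioc.prod hB
  have hCT : C ⊆ Ioc t T ×ˢ univ := prod_mono (Ioc_subset_Ioc_left hs.1) (subset_univ _)
  have hm : Measurable fun ω => N ω C :=
    (hN.adapted T ⟨htT, le_rfl⟩ C hCm hCT).mono (𝓕.le T) le_rfl
  have hAm : MeasurableSet A := 𝓕.le s A hA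
  have hind : Indep (MeasurableSpace.comap (fun ω => N ω C) inferInstance) (𝓕 s) P :=
    hN.indep_past s hs C hCm (prod_mono le_rfl (subset_univ _))
  have key := lintegral_mul_indicator_eq_lintegral_mul_lintegral_indicator
    (f := fun ω => N ω C) (μ := P) (T := A) hm.comap_le 1 hAm
    (indepSets_of_indepSets_of_le_right ((Indep_iff_IndepSets _ _ _).1 hind)
      (singleton_subset_iff.2 hA)) (comap_measurable _)
  rw [hN.lintegral_apply htT hCm hCT, lintegral_indicator hAm, lintegral_one,
    Measure.restrict_apply_univ, hC, Measure.prod_prod] at key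
  rw [mul_comm (P A), ← key, ← lintegral_indicator hAm]
  refine lintegral_congr fun ω => ?_
  by_cases hω : ω ∈ A <;> simp [hω, hC]

/-- The compensation formula: the expected integral of a predictable function with respect to the
Poisson random measure is its expected integral with respect to the intensity. -/
lemma lintegral_lintegral [IsProbabilityMeasure P] [IsFiniteMeasure ς]
    (hN : IsPoissonRandomMeasure P 𝓕 ς N t T) (htT : t ≤ T) {H : (ℝ≥0 × Ω) × S → ℝ≥0∞}
    (hH : Measurable[𝓕.predictable.prod inferInstance] H) :
    ∫⁻ ω, ∫⁻ p in Ioc t T ×ˢ univ, H ((p.1, ω), p.2) ∂(N ω) ∂P =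
      ∫⁻ ω, ∫⁻ s in Ioc t T, ∫⁻ ζ, H ((s, ω), ζ) ∂ς ∂leb ∂P := by
  have hT : T ∈ Icc t T := ⟨htT, le_rfl⟩
  let κ : Kernel Ω (ℝ≥0 × S) :=
    ⟨fun ω => (N ω).restrict (Ioc t T ×ˢ univ), (hN.kernel hT).measurable.mono (𝓕.le T) le_rfl⟩
  have hκ : IsSFiniteKernel κ := isSFiniteKernel_of_forall_lt_top κ fun ω => by
    change (N ω).restrict (Ioc t T ×ˢ univ) univ < ∞
    rw [Measure.restrict_apply_univ]
    exact hN.measure_lt_top ω le_rfl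
  -- the rectangles over `(i, ∞) × A`
  have hIoi : ∀ (i : ℝ≥0) (A : Set Ω), MeasurableSet[𝓕 i] A → ∀ B : Set S, MeasurableSet B →
      ∫⁻ ω, κ ω {p | (p.1, ω) ∈ Ioi i ×ˢ A ∧ p.2 ∈ B} ∂P =
        ∫⁻ ω, leb.restrict (Ioc t T) {s | (s, ω) ∈ Ioi i ×ˢ A} * ς B ∂P := by
    intro i A hA B hB
    have hAm : MeasurableSet A := 𝓕.le i A hA
    have e1 : ∀ ω, κ ω {p | (p.1, ω) ∈ Ioi i ×ˢ A ∧ p.2 ∈ B} =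
        A.indicator (fun ω => N ω (Ioc (max t i) T ×ˢ B)) ω := fun ω => by
      change (N ω).restrict (Ioc t T ×ˢ univ) _ = _
      by_cases hω : ω ∈ A
      · have : {p : ℝ≥0 × S | (p.1, ω) ∈ Ioi i ×ˢ A ∧ p.2 ∈ B} = Ioi i ×ˢ B := by
          ext p
          simp [hω]
        rw [this, Measure.restrict_apply (measurableSet_Ioi.prod hB), indicator_of_mem hω,
          prod_inter_prod, inter_univ, inter_comm, Ioc_inter_Ioi]
      · simp [hω]
    have e2 : ∀ ω, leb.restrict (Ioc t T) {s | (s, ω) ∈ Ioi i ×ˢ A} * ς B =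
        A.indicator (fun _ => leb (Ioc (max t i) T) * ς B) ω := fun ω => by
      by_cases hω : ω ∈ A
      · have : {s : ℝ≥0 | (s, ω) ∈ Ioi i ×ˢ A} = Ioi i := by
          ext s
          simp [hω]
        rw [this, Measure.restrict_apply measurableSet_Ioi, indicator_of_mem hω, inter_comm,
          Ioc_inter_Ioi]
      · simp [hω]
    simp only [e1, e2]
    rw [lintegral_indicator hAm, lintegral_indicator hAm, setLIntegral_const]
    rcases le_total (max t i) T with h | h
    · rw [hN.setLIntegral_apply ⟨le_max_left _ _, h⟩ (𝓕.mono (le_max_right t i) A hA) hB, mul_comm]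
    · simp [Ioc_eq_empty_of_le h]
  refine @lintegral_eq_of_generator Ω S (ℝ≥0 × Ω) mΩ _ 𝓕.predictable P _ κ hκ
    (leb.restrict (Ioc t T)) _ ς _ (fun x => x) (measurable_id.mono le_rfl (predictable_le_prod 𝓕))
    (insert univ ({s | ∃ A, MeasurableSet[𝓕 ⊥] A ∧ s = {⊥} ×ˢ A} ∪
      {s | ∃ i A, MeasurableSet[𝓕 i] A ∧ s = Set.Ioi i ×ˢ A})) ?_ ?_ (mem_insert _ _) ?_ H hH
  · rw [MeasurableSpace.generateFrom_insert_univ]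
    rfl
  · refine IsPiSystem.insert_univ ?_
    rintro _ (⟨A, hA, rfl⟩ | ⟨i, A, hA, rfl⟩) _ (⟨A', hA', rfl⟩ | ⟨i', A', hA', rfl⟩) hne
    · exact Or.inl ⟨A ∩ A', hA.inter hA', by rw [prod_inter_prod, inter_self]⟩
    · obtain ⟨x, hx, hx'⟩ := hne
      exact absurd (hx.1 ▸ hx'.1 : i' < ⊥) not_lt_bot
    · obtain ⟨x, hx, hx'⟩ := hne
      exact absurd (hx'.1 ▸ hx.1 : i < ⊥) not_lt_bot
    · refine Or.inr ⟨max i i', A ∩ A', ?_, by rw [prod_inter_prod, Ioi_inter_Ioi]⟩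
      exact (𝓕.mono (le_max_left _ _) A hA).inter (𝓕.mono (le_max_right _ _) A' hA')
  · rintro _ (rfl | ⟨A, hA, rfl⟩ | ⟨i, A, hA, rfl⟩) B hB
    · have := hIoi t univ MeasurableSet.univ B hB
      refine Eq.trans (lintegral_congr fun ω => ?_) (this.trans (lintegral_congr fun ω => ?_))
      · change (N ω).restrict (Ioc t T ×ˢ univ) _ = (N ω).restrict (Ioc t T ×ˢ univ) _
        have hS : MeasurableSet {p : ℝ≥0 × S | (p.1, ω) ∈ Ioi t ×ˢ (univ : Set Ω) ∧ p.2 ∈ B} := by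
          have : {p : ℝ≥0 × S | (p.1, ω) ∈ Ioi t ×ˢ (univ : Set Ω) ∧ p.2 ∈ B} = Ioi t ×ˢ B := by
            ext p
            simp
          rw [this]
          exact measurableSet_Ioi.prod hB
        have hS' : MeasurableSet {p : ℝ≥0 × S | (p.1, ω) ∈ (univ : Set (ℝ≥0 × Ω)) ∧ p.2 ∈ B} := by
          simp only [mem_univ, true_and]
          exact measurable_snd hB
        rw [Measure.restrict_apply hS, Measure.restrict_apply hS']
        congr 1
        ext p
        simp only [mem_inter_iff, mem_ofPred_eq, mem_prod, mem_univ, mem_Ioc, mem_Ioi]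
        tauto
      · congr 1
        have e1 : {s : ℝ≥0 | (s, ω) ∈ Ioi t ×ˢ (univ : Set Ω)} = Ioi t := by
          ext s
          simp
        have e2 : {s : ℝ≥0 | (s, ω) ∈ (univ : Set (ℝ≥0 × Ω))} = univ := by
          ext s
          simp
        rw [e1, e2, Measure.restrict_apply measurableSet_Ioi, Measure.restrict_apply_univ,
          inter_eq_right.2]
        exact fun s hs => hs.1
    · have e1 : ∀ ω, κ ω {p | (p.1, ω) ∈ {(⊥ : ℝ≥0)} ×ˢ A ∧ p.2 ∈ B} = 0 := fun ω => by
        refine measure_mono_null (t := (Ioc t T ×ˢ univ)ᶜ) ?_ ?_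
        · rintro p ⟨hp, _⟩ hp'
          exact absurd (hp.1 ▸ hp'.1.1 : t < ⊥) not_lt_bot
        · change (N ω).restrict (Ioc t T ×ˢ univ) _ = 0
          rw [Measure.restrict_apply (measurableSet_Ioc.prod MeasurableSet.univ).compl]
          simp
      have e2 : ∀ ω, leb.restrict (Ioc t T) {s | (s, ω) ∈ {(⊥ : ℝ≥0)} ×ˢ A} = 0 := fun ω => by
        refine measure_mono_null (t := (Ioc t T)ᶜ) ?_ ?_
        · rintro s hs hs'
          exact absurd (hs.1 ▸ hs'.1 : t < ⊥) not_lt_bot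
        · rw [Measure.restrict_apply measurableSet_Ioc.compl]
          simp
      simp only [e1, e2, zero_mul]
    · exact hIoi i A hA B hB

end IsPoissonRandomMeasure

/-! ### Expectations of integrals with respect to the Poisson random measure -/

lemma expectation_eq_integral {Ω : Type*} [MeasurableSpace Ω] {P : Measure Ω} {X : Ω → ℝ}
    (hX : Integrable X P) : expectation P X = ((∫ ω, X ω ∂P : ℝ) : EReal) := by
  have h1 : ∫⁻ ω, ENNReal.ofReal (X ω) ∂P ≠ ∞ := hX.lintegral_lt_top.ne
  have h2 : ∫⁻ ω, ENNReal.ofReal (-X ω) ∂P ≠ ∞ := hX.neg.lintegral_lt_top.ne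
  rw [expectation, integral_eq_lintegral_pos_part_sub_lintegral_neg_part hX, EReal.coe_sub,
    EReal.coe_ennreal_toReal h1, EReal.coe_ennreal_toReal h2]

lemma expectation_eq_bot {Ω : Type*} [MeasurableSpace Ω] {P : Measure Ω} {X : Ω → ℝ}
    (hX : ∫⁻ ω, ENNReal.ofReal (-X ω) ∂P = ∞) : expectation P X = ⊥ := by
  rw [expectation, hX, EReal.coe_ennreal_top, EReal.sub_top]

lemma expectation_congr_ae {Ω : Type*} [MeasurableSpace Ω] {P : Measure Ω} {X X' : Ω → ℝ}
    (h : X =ᵐ[P] X') : expectation P X = expectation P X' := by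
  have h1 : ∫⁻ ω, ENNReal.ofReal (X ω) ∂P = ∫⁻ ω, ENNReal.ofReal (X' ω) ∂P :=
    lintegral_congr_ae (h.mono fun ω hω => by simp only [hω])
  have h2 : ∫⁻ ω, ENNReal.ofReal (-X ω) ∂P = ∫⁻ ω, ENNReal.ofReal (-X' ω) ∂P :=
    lintegral_congr_ae (h.mono fun ω hω => by simp only [hω])
  rw [expectation, expectation, h1, h2]

namespace IsPoissonRandomMeasure

variable {Ω S : Type*} {mΩ : MeasurableSpace Ω} [MeasurableSpace S]
  {P : Measure Ω} {𝓕 : Filtration ℝ≥0 mΩ} {ς : Measure S} {N : Ω → Measure (ℝ≥0 × S)}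
  {t T : ℝ≥0} {Λ : (ℝ≥0 × Ω) × S → ℝ} {D : Ω → ℝ}

lemma setIntegral_eq_sub [MeasurableSingletonClass S]
    (hN : IsPoissonRandomMeasure P 𝓕 ς N t T) (f : ℝ≥0 × S → ℝ) (ω : Ω) :
    ∫ p in Ioc t T ×ˢ univ, f p ∂(N ω) =
      (∫⁻ p in Ioc t T ×ˢ univ, ENNReal.ofReal (f p) ∂(N ω)).toReal -
        (∫⁻ p in Ioc t T ×ˢ univ, ENNReal.ofReal (-f p) ∂(N ω)).toReal := by
  obtain ⟨F, hF⟩ := hN.exists_isFinitePoint ω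
  exact integral_eq_lintegral_pos_part_sub_lintegral_neg_part (hF.integrableOn f)

lemma setLIntegral_ofReal_ne_top [MeasurableSingletonClass S]
    (hN : IsPoissonRandomMeasure P 𝓕 ς N t T) (f : ℝ≥0 × S → ℝ)
    (ω : Ω) : ∫⁻ p in Ioc t T ×ˢ univ, ENNReal.ofReal (f p) ∂(N ω) ≠ ∞ := by
  obtain ⟨F, hF⟩ := hN.exists_isFinitePoint ω
  exact (Integrable.lintegral_lt_top (hF.integrableOn f)).ne

lemma measurable_reorder {H : (ℝ≥0 × Ω) × S → ℝ≥0∞}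
    (hH : Measurable[𝓕.predictable.prod inferInstance] H) :
    Measurable fun q : (Ω × ℝ≥0) × S => H ((q.1.2, q.1.1), q.2) := by
  have h1 : Measurable H :=
    hH.mono (sup_le_sup (MeasurableSpace.comap_mono (predictable_le_prod 𝓕)) le_rfl) le_rfl
  exact h1.comp (by fun_prop)

/-- If the expected integral of the negative part is infinite, then so is the expectation of the
negative part of the integral. -/
lemma lintegral_neg_eq_top [IsProbabilityMeasure P] [IsFiniteMeasure ς]
    [MeasurableSingletonClass S]
    (hN : IsPoissonRandomMeasure P 𝓕 ς N t T) (htT : t ≤ T)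
    (hΛ : Measurable[𝓕.predictable.prod inferInstance] Λ) (hD : Integrable D P)
    (hpos : ∫⁻ ω, ∫⁻ s in Ioc t T, ∫⁻ ζ, ENNReal.ofReal (Λ ((s, ω), ζ)) ∂ς ∂leb ∂P ≠ ∞)
    (hneg : ∫⁻ ω, ∫⁻ s in Ioc t T, ∫⁻ ζ, ENNReal.ofReal (-Λ ((s, ω), ζ)) ∂ς ∂leb ∂P = ∞) :
    ∫⁻ ω, ENNReal.ofReal
      (-(D ω + ∫ p in Ioc t T ×ˢ univ, Λ ((p.1, ω), p.2) ∂(N ω))) ∂P = ∞ := by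
  have hp : Measurable[𝓕.predictable.prod inferInstance] fun x => ENNReal.ofReal (Λ x) :=
    hΛ.ennreal_ofReal
  have hm : Measurable[𝓕.predictable.prod inferInstance] fun x => ENNReal.ofReal (-Λ x) :=
    hΛ.neg.ennreal_ofReal
  rw [← hN.lintegral_lintegral htT hp] at hpos
  rw [← hN.lintegral_lintegral htT hm] at hneg
  have hpm := (hN.measurable_setLIntegral ⟨htT, le_rfl⟩ hp).mono (𝓕.le T) le_rfl
  by_contra hcon
  have hle : ∀ ω, ∫⁻ p in Ioc t T ×ˢ univ, ENNReal.ofReal (-Λ ((p.1, ω), p.2)) ∂(N ω) ≤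
      ENNReal.ofReal (-(D ω + ∫ p in Ioc t T ×ˢ univ, Λ ((p.1, ω), p.2) ∂(N ω))) +
      (ENNReal.ofReal (D ω) +
        ∫⁻ p in Ioc t T ×ˢ univ, ENNReal.ofReal (Λ ((p.1, ω), p.2)) ∂(N ω)) := fun ω => by
    rw [hN.setIntegral_eq_sub (fun p => Λ ((p.1, ω), p.2)) ω]
    have h1 := hN.setLIntegral_ofReal_ne_top (fun p => Λ ((p.1, ω), p.2)) ω
    have h2 := hN.setLIntegral_ofReal_ne_top (fun p => -Λ ((p.1, ω), p.2)) ω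
    conv_lhs => rw [← ENNReal.ofReal_toReal h2]
    conv_rhs =>
      rw [← ENNReal.ofReal_toReal h1]
    rw [ENNReal.toReal_ofReal ENNReal.toReal_nonneg]
    refine le_trans (ENNReal.ofReal_le_ofReal ?_)
      (ENNReal.ofReal_add_le.trans (add_le_add le_rfl ENNReal.ofReal_add_le))
    linarith
  have := lintegral_mono (μ := P) hle
  have hsum : AEMeasurable (fun ω => ENNReal.ofReal (D ω) +
      ∫⁻ p in Ioc t T ×ˢ univ, ENNReal.ofReal (Λ ((p.1, ω), p.2)) ∂(N ω)) P :=
    hD.aemeasurable.ennreal_ofReal.add hpm.aemeasurable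
  rw [hneg, lintegral_add_right' _ hsum, lintegral_add_right _ hpm, top_le_iff] at this
  exact ENNReal.add_ne_top.2 ⟨hcon, ENNReal.add_ne_top.2 ⟨hD.lintegral_lt_top.ne, hpos⟩⟩ this

lemma lintegral_prod_eq [IsProbabilityMeasure P] [IsFiniteMeasure ς] {H : (ℝ≥0 × Ω) × S → ℝ≥0∞}
    (hH : Measurable[𝓕.predictable.prod inferInstance] H) :
    ∫⁻ q : (Ω × ℝ≥0) × S, H ((q.1.2, q.1.1), q.2) ∂((P.prod (leb.restrict (Ioc t T))).prod ς) =
      ∫⁻ ω, ∫⁻ s in Ioc t T, ∫⁻ ζ, H ((s, ω), ζ) ∂ς ∂leb ∂P := by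
  have hm := measurable_reorder hH
  rw [lintegral_prod _ hm.aemeasurable, lintegral_prod _ hm.lintegral_prod_right'.aemeasurable]

lemma integrable_prod [IsProbabilityMeasure P] [IsFiniteMeasure ς]
    (hΛ : Measurable[𝓕.predictable.prod inferInstance] Λ)
    (hpos : ∫⁻ ω, ∫⁻ s in Ioc t T, ∫⁻ ζ, ENNReal.ofReal (Λ ((s, ω), ζ)) ∂ς ∂leb ∂P ≠ ∞)
    (hneg : ∫⁻ ω, ∫⁻ s in Ioc t T, ∫⁻ ζ, ENNReal.ofReal (-Λ ((s, ω), ζ)) ∂ς ∂leb ∂P ≠ ∞) :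
    Integrable (fun q : (Ω × ℝ≥0) × S => Λ ((q.1.2, q.1.1), q.2))
      ((P.prod (leb.restrict (Ioc t T))).prod ς) := by
  have hp : Measurable[𝓕.predictable.prod inferInstance] fun x => ENNReal.ofReal (Λ x) :=
    hΛ.ennreal_ofReal
  have hm : Measurable[𝓕.predictable.prod inferInstance] fun x => ENNReal.ofReal (-Λ x) :=
    hΛ.neg.ennreal_ofReal
  rw [← lintegral_prod_eq hp] at hpos
  rw [← lintegral_prod_eq hm] at hneg
  have hΛm : Measurable fun q : (Ω × ℝ≥0) × S => Λ ((q.1.2, q.1.1), q.2) := by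
    have h1 : Measurable Λ :=
      hΛ.mono (sup_le_sup (MeasurableSpace.comap_mono (predictable_le_prod 𝓕)) le_rfl) le_rfl
    exact h1.comp (by fun_prop)
  refine ⟨hΛm.aestronglyMeasurable, ?_⟩
  rw [hasFiniteIntegral_iff_enorm]
  refine lt_of_le_of_lt (lintegral_mono fun q => ?_)
    ((lintegral_add_left (measurable_reorder hp) _).trans_lt
      (ENNReal.add_lt_top.2 ⟨hpos.lt_top, hneg.lt_top⟩))
  rw [Real.enorm_eq_ofReal_abs]
  rcases abs_cases (Λ ((q.1.2, q.1.1), q.2)) with ⟨h, _⟩ | ⟨h, _⟩ <;> rw [h]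
  · exact le_self_add
  · exact le_add_self

/-- The compensation formula for integrable predictable functions, together with a random
variable `D`. -/
lemma integrable_add_setIntegral [IsProbabilityMeasure P] [IsFiniteMeasure ς]
    [MeasurableSingletonClass S]
    (hN : IsPoissonRandomMeasure P 𝓕 ς N t T) (htT : t ≤ T)
    (hΛ : Measurable[𝓕.predictable.prod inferInstance] Λ) (hD : Integrable D P)
    (hpos : ∫⁻ ω, ∫⁻ s in Ioc t T, ∫⁻ ζ, ENNReal.ofReal (Λ ((s, ω), ζ)) ∂ς ∂leb ∂P ≠ ∞)
    (hneg : ∫⁻ ω, ∫⁻ s in Ioc t T, ∫⁻ ζ, ENNReal.ofReal (-Λ ((s, ω), ζ)) ∂ς ∂leb ∂P ≠ ∞) :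
    Integrable (fun ω => D ω + ∫ p in Ioc t T ×ˢ univ, Λ ((p.1, ω), p.2) ∂(N ω)) P ∧
      ∫ ω, (D ω + ∫ p in Ioc t T ×ˢ univ, Λ ((p.1, ω), p.2) ∂(N ω)) ∂P =
        ∫ ω, D ω ∂P + ∫ q : (Ω × ℝ≥0) × S, Λ ((q.1.2, q.1.1), q.2)
          ∂((P.prod (leb.restrict (Ioc t T))).prod ς) := by
  have hint := integrable_prod hΛ hpos hneg
  have hp : Measurable[𝓕.predictable.prod inferInstance] fun x => ENNReal.ofReal (Λ x) :=
    hΛ.ennreal_ofReal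
  have hm : Measurable[𝓕.predictable.prod inferInstance] fun x => ENNReal.ofReal (-Λ x) :=
    hΛ.neg.ennreal_ofReal
  have hpm := (hN.measurable_setLIntegral ⟨htT, le_rfl⟩ hp).mono (𝓕.le T) le_rfl
  have hmm := (hN.measurable_setLIntegral ⟨htT, le_rfl⟩ hm).mono (𝓕.le T) le_rfl
  have e : (fun ω => ∫ p in Ioc t T ×ˢ univ, Λ ((p.1, ω), p.2) ∂(N ω)) = fun ω =>
      (∫⁻ p in Ioc t T ×ˢ univ, ENNReal.ofReal (Λ ((p.1, ω), p.2)) ∂(N ω)).toReal -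
        (∫⁻ p in Ioc t T ×ˢ univ, ENNReal.ofReal (-Λ ((p.1, ω), p.2)) ∂(N ω)).toReal :=
    funext fun ω => hN.setIntegral_eq_sub (fun p => Λ ((p.1, ω), p.2)) ω
  have hpos' := hpos
  have hneg' := hneg
  rw [← hN.lintegral_lintegral htT hp] at hpos'
  rw [← hN.lintegral_lintegral htT hm] at hneg'
  have ip := integrable_toReal_of_lintegral_ne_top hpm.aemeasurable hpos'
  have im := integrable_toReal_of_lintegral_ne_top hmm.aemeasurable hneg'
  have iI : Integrable (fun ω => ∫ p in Ioc t T ×ˢ univ, Λ ((p.1, ω), p.2) ∂(N ω)) P := by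
    rw [e]
    exact ip.sub im
  refine ⟨hD.add iI, ?_⟩
  rw [integral_add hD iI, e, integral_sub ip im,
    integral_toReal hpm.aemeasurable (ae_lt_top hpm hpos'),
    integral_toReal hmm.aemeasurable (ae_lt_top hmm hneg'),
    integral_eq_lintegral_pos_part_sub_lintegral_neg_part hint, lintegral_prod_eq hp,
    lintegral_prod_eq hm, hN.lintegral_lintegral htT hp, hN.lintegral_lintegral htT hm]

end IsPoissonRandomMeasure

/-! ### The state before a jump is predictable -/

section PreState

variable {K : ℕ} {Ω : Type*}

/-- The left limit `Y_{s-}` of the chain at times `s ∈ (t, T]`, extended by the constant `i`. -/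
noncomputable def preState (Y : ℝ≥0 → Ω → Fin K) (t T : ℝ≥0) (i : Fin K) (x : ℝ≥0 × Ω) : Fin K :=
  open Classical in
  if x.1 ∈ Ioc t T then Function.leftLim (fun r => Y r x.2) x.1 else i

lemma preState_of_mem {Y : ℝ≥0 → Ω → Fin K} {t T : ℝ≥0} {i : Fin K} {s : ℝ≥0} (hs : s ∈ Ioc t T)
    (ω : Ω) : preState Y t T i (s, ω) = Function.leftLim (fun r => Y r ω) s := if_pos hs

variable {mΩ : MeasurableSpace Ω} {P : Measure Ω} {𝓕 : Filtration ℝ≥0 mΩ}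
  {Q : Matrix (Fin K) (Fin K) ℝ} {Y : ℝ≥0 → Ω → Fin K} {t T : ℝ≥0}

lemma measurable_fst_predictable (𝓕 : Filtration ℝ≥0 mΩ) :
    Measurable[𝓕.predictable] (Prod.fst : ℝ≥0 × Ω → ℝ≥0) := by
  let : MeasurableSpace (ℝ≥0 × Ω) := 𝓕.predictable
  refine measurable_of_Ioi fun a => ?_
  have : (Prod.fst : ℝ≥0 × Ω → ℝ≥0) ⁻¹' Ioi a = Ioi a ×ˢ univ := by
    ext x
    simp
  rw [this]
  exact measurableSet_predictable_Ioi_prod MeasurableSet.univ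

open Classical in
lemma IsMarkovChain.measurable_preState (hY : IsMarkovChain P 𝓕 Q Y t T) (i : Fin K) :
    Measurable[𝓕.predictable] (preState Y t T i) := by
  -- the chain sampled at the last grid point before `s`
  set Yn : ℕ → ℝ≥0 × Ω → Fin K := fun n x =>
    if x.1 ∈ Ioc t T then Y (gridPoint t n ⌈(n + 1) * x.1⌉₊) x.2 else i with hYn
  have hcell : ∀ n : ℕ, ∀ j : Fin K, MeasurableSet[𝓕.predictable]
      {x : ℝ≥0 × Ω | x.1 ∈ Ioc t T ∧ Y (gridPoint t n ⌈(n + 1) * x.1⌉₊) x.2 = j} := by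
    intro n j
    have : {x : ℝ≥0 × Ω | x.1 ∈ Ioc t T ∧ Y (gridPoint t n ⌈(n + 1) * x.1⌉₊) x.2 = j} =
        ⋃ k : ℕ, Ioc (gridPoint t n k) (min ((k : ℝ≥0) / (n + 1)) T) ×ˢ
          {ω | Y (gridPoint t n k) ω = j} := by
      ext ⟨s, ω⟩
      simp only [mem_ofPred_eq, mem_iUnion, mem_prod]
      constructor
      · rintro ⟨hs, hj⟩
        refine ⟨⌈(n + 1) * s⌉₊, ⟨gridPoint_lt hs.1 n, le_min ?_ hs.2⟩, hj⟩
        rw [le_div_iff₀ (by positivity), mul_comm s]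
        exact Nat.le_ceil _
      · rintro ⟨k, ⟨h1, h2⟩, hj⟩
        have hts : t < s := (le_max_left _ _).trans_lt h1
        have hk : ⌈((n : ℝ≥0) + 1) * s⌉₊ = k := by
          have h3 : s ≤ (k : ℝ≥0) / (n + 1) := h2.trans (min_le_left _ _)
          rw [le_div_iff₀ (by positivity), mul_comm s] at h3
          have h4 : ((k - 1 : ℕ) : ℝ≥0) / (n + 1) < s := (le_max_right _ _).trans_lt h1
          rw [div_lt_iff₀ (by positivity), mul_comm s] at h4
          have hk0 : k ≠ 0 := by
            rintro rfl
            have hs0 : 0 < s := bot_le.trans_lt hts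
            have : 0 < ((n : ℝ≥0) + 1) * s := by positivity
            simp only [Nat.cast_zero] at h3
            exact absurd h3 (not_le.2 this)
          exact (Nat.ceil_eq_iff hk0).2 ⟨h4, h3⟩
        exact ⟨⟨hts, h2.trans (min_le_right _ _)⟩, by rw [hk]; exact hj⟩
    rw [this]
    refine MeasurableSet.iUnion fun k => ?_
    by_cases hk : gridPoint t n k ≤ T
    · exact measurableSet_predictable_Ioc_prod _ _
        (hY.adapted _ ⟨le_max_left _ _, hk⟩ (measurableSet_singleton j))
    · rw [Ioc_eq_empty_of_le ((min_le_right _ _).trans (not_le.1 hk).le), empty_prod]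
      exact @MeasurableSet.empty _ 𝓕.predictable
  have hYnm : ∀ n, Measurable[𝓕.predictable] (Yn n) := by
    intro n
    refine @measurable_to_countable' _ _ _ _ 𝓕.predictable _ fun j => ?_
    have hout : MeasurableSet[𝓕.predictable] {x : ℝ≥0 × Ω | x.1 ∉ Ioc t T ∧ i = j} := by
      by_cases hij : i = j
      · simp only [hij, and_true]
        exact (measurable_fst_predictable 𝓕) measurableSet_Ioc.compl
      · simp only [hij, and_false, ofPred_false]
        exact @MeasurableSet.empty _ 𝓕.predictable
    convert! (hcell n j).union hout using 1
    ext x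
    simp only [hYn, mem_preimage, mem_singleton_iff, mem_union, mem_ofPred_eq]
    by_cases hx : x.1 ∈ Ioc t T
    · simp [hx]
    · simp only [hx, if_false, false_and, not_false_eq_true, true_and, false_or]
  let : MeasurableSpace (ℝ≥0 × Ω) := 𝓕.predictable
  refine measurable_of_tendsto_metrizable hYnm (tendsto_pi_nhds.2 fun x => ?_)
  by_cases hx : x.1 ∈ Ioc t T
  · simp only [hYn, hx, if_true, preState]
    exact ((hY.cadlag x.2).tendsto_leftLim hx).comp (tendsto_gridPoint hx.1)
  · simp only [hYn, hx, if_false, preState]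
    exact tendsto_const_nhds

end PreState

namespace Market

variable {K : ℕ} {Z : Set ℝ} (M : Market K Z)

/-! ### The local characteristic as an image of the intensity of the marks -/

instance : IsFiniteMeasure M.ς := M.ς_finite

instance (s : ℝ≥0) (j : Fin K) : IsFiniteMeasure (M.η s j) := by
  rw [η]
  infer_instance

lemma measurable_G (s : ℝ≥0) (j : Fin K) : Measurable (M.G s j) :=
  (M.G_measurable j).comp measurable_prodMk_left

lemma η_univ_le (s : ℝ≥0) (j : Fin K) : M.η s j univ ≤ M.ς univ := by
  rw [M.η_apply s j MeasurableSet.univ]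
  exact measure_mono (subset_univ _)

lemma lintegral_η (s : ℝ≥0) (j : Fin K) {f : ℝ → ℝ≥0∞} (hf : Measurable f) (h0 : f 0 = 0) :
    ∫⁻ z, f z ∂(M.η s j) = ∫⁻ ζ, f (M.G s j ζ) ∂M.ς := by
  rw [η, setLIntegral_eq_of_support_subset, lintegral_map hf (M.measurable_G s j)]
  intro z hz hz0
  rw [mem_singleton_iff] at hz0
  exact hz (hz0 ▸ h0)

lemma integral_η (s : ℝ≥0) (j : Fin K) {f : ℝ → ℝ} (hf : Measurable f) (h0 : f 0 = 0) :
    ∫ z, f z ∂(M.η s j) = ∫ ζ, f (M.G s j ζ) ∂M.ς := by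
  rw [η, setIntegral_eq_integral_of_forall_compl_eq_zero,
    integral_map (M.measurable_G s j).aemeasurable hf.aestronglyMeasurable]
  intro z hz
  rw [notMem_compl_iff, mem_singleton_iff] at hz
  rw [hz, h0]

lemma integrable_η_iff (s : ℝ≥0) (j : Fin K) {f : ℝ → ℝ} (hf : Measurable f) (h0 : f 0 = 0) :
    Integrable f (M.η s j) ↔ Integrable (fun ζ => f (M.G s j ζ)) M.ς := by
  have h1 := M.lintegral_η s j hf.enorm (by simp [h0])
  constructor
  · rintro ⟨_, h⟩
    refine ⟨(hf.comp (M.measurable_G s j)).aestronglyMeasurable, ?_⟩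
    rw [hasFiniteIntegral_iff_enorm] at h ⊢
    rwa [← h1]
  · rintro ⟨_, h⟩
    refine ⟨hf.aestronglyMeasurable, ?_⟩
    rw [hasFiniteIntegral_iff_enorm] at h ⊢
    rwa [h1]

lemma keepsPositive_iff_keepsPos (s : ℝ≥0) (j : Fin K) (x : ℝ) :
    M.KeepsPositive s j x ↔ KeepsPos (M.η s j) x := keepsPos_iff.symm

lemma keepsPositive_iff (s : ℝ≥0) (j : Fin K) (x : ℝ) :
    M.KeepsPositive s j x ↔ M.ς {ζ | 1 + x * M.G s j ζ ≤ 0} = 0 := by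
  rw [KeepsPositive, M.η_apply s j (measurableSet_le (by fun_prop) (by fun_prop))]
  have : {ζ | M.G s j ζ ∈ {z : ℝ | 1 + x * z ≤ 0} \ {0}} = {ζ | 1 + x * M.G s j ζ ≤ 0} := by
    ext ζ
    simp only [mem_ofPred_eq, Set.mem_sdiff, mem_singleton_iff, and_iff_left_iff_imp]
    intro h h0
    rw [h0] at h
    norm_num at h
  rw [this]

lemma firstOrder_or_boundaryPoint_iff (s : ℝ≥0) (j : Fin K) (x : ℝ) :
    M.FirstOrder s j x ∨ M.BoundaryPoint s j x ↔ Candidate (M.η s j) M.L M.ρ x := by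
  rw [FirstOrder, BoundaryPoint, Candidate]
  tauto

lemma existsUnique_candidate (s : ℝ≥0) (j : Fin K)
    (h : ∀ x ∈ Icc (-M.L) M.L, M.KeepsPositive s j x) :
    ∃! x, x ∈ Icc (-M.L) M.L ∧ (M.FirstOrder s j x ∨ M.BoundaryPoint s j x) := by
  simp only [firstOrder_or_boundaryPoint_iff]
  simp only [keepsPositive_iff_keepsPos] at h
  have hL := M.L_pos
  obtain ⟨x, hx, hcx⟩ := exists_candidate hL (h M.L ⟨by linarith, le_rfl⟩)
    (h (-M.L) ⟨le_rfl, by linarith⟩) M.ρ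
  exact ⟨x, ⟨hx, hcx⟩, fun y ⟨hy, hcy⟩ => hcy.unique M.ρ_pos hy hx (h y hy) (h x hx) hcx⟩

/-! ### The candidate is measurable in time -/

lemma measurableSet_keepsPositive (j : Fin K) (c : ℝ) :
    MeasurableSet {s | M.KeepsPositive s j c} := by
  simp only [keepsPositive_iff]
  have hS : MeasurableSet {p : ℝ≥0 × Z | 1 + c * M.G p.1 j p.2 ≤ 0} :=
    measurableSet_le (((M.G_measurable j).const_mul c).const_add 1) measurable_const
  exact measurable_measure_prodMk_left (ν := M.ς) hS (measurableSet_singleton 0)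

lemma measurable_div_G (j : Fin K) (c : ℝ) :
    Measurable fun p : ℝ≥0 × Z => M.G p.1 j p.2 / (1 + c * M.G p.1 j p.2) :=
  measurable_div_one_add.comp (M.G_measurable j)

lemma measurableSet_integrable_div (j : Fin K) (c : ℝ) :
    MeasurableSet {s | Integrable (fun z => z / (1 + c * z)) (M.η s j)} := by
  simp only [M.integrable_η_iff _ j (measurable_div_one_add (x := c)) (by simp)]
  exact _root_.measurableSet_integrable (μ := M.ς) (M.measurable_div_G j c).stronglyMeasurable

lemma measurable_integral_div (j : Fin K) (c : ℝ) :
    Measurable fun s => ∫ z, z / (1 + c * z) ∂(M.η s j) := by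
  simp only [M.integral_η _ j (measurable_div_one_add (x := c)) (by simp)]
  exact (M.measurable_div_G j c).stronglyMeasurable.integral_prod_right.measurable

/-- A choice of candidates at the times in a Borel set is measurable: by concavity of the criterion,
whether the candidate lies below a level is decided by the derivative at that level. -/
lemma measurableSet_candidate_lt {A : Set ℝ≥0} (hA : MeasurableSet A) (j : Fin K) {g : ℝ≥0 → ℝ}
    (hg : ∀ s ∈ A, g s ∈ Icc (-M.L) M.L ∧ M.KeepsPositive s j (g s) ∧
      (M.FirstOrder s j (g s) ∨ M.BoundaryPoint s j (g s))) (c : ℝ) :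
    MeasurableSet {s | s ∈ A ∧ g s < c} := by
  simp only [firstOrder_or_boundaryPoint_iff, keepsPositive_iff_keepsPos] at hg
  have hk := M.measurableSet_keepsPositive j
  simp only [keepsPositive_iff_keepsPos] at hk
  have hpos : ∀ c, 0 < c → c ≤ M.L → MeasurableSet {s | s ∈ A ∧ g s < c} := fun c hc hcL => by
    have : {s | s ∈ A ∧ g s < c} = A ∩ ({s | KeepsPos (M.η s j) c} ∩
        ({s | Integrable (fun z => z / (1 + c * z)) (M.η s j)} ∩
          {s | M.ρ ≤ ∫ z, z / (1 + c * z) ∂(M.η s j)}))ᶜ := by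
      ext s
      by_cases hs : s ∈ A
      · have := (hg s hs).2.2.lt_iff_of_pos M.ρ_pos (hg s hs).1 (hg s hs).2.1 hc hcL
        simpa [hs] using this
      · simp [hs]
    rw [this]
    exact hA.inter ((hk c).inter ((M.measurableSet_integrable_div j c).inter
      (measurableSet_le measurable_const (M.measurable_integral_div j c)))).compl
  have hneg : ∀ c, c < 0 → -M.L < c → MeasurableSet {s | s ∈ A ∧ g s < c} := fun c hc hcL => by
    have : {s | s ∈ A ∧ g s < c} = A ∩ ({s | KeepsPos (M.η s j) c} ∩
        ({s | Integrable (fun z => z / (1 + c * z)) (M.η s j)} ∩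
          {s | ∫ z, z / (1 + c * z) ∂(M.η s j) < M.ρ})) := by
      ext s
      by_cases hs : s ∈ A
      · have := (hg s hs).2.2.lt_iff_of_neg M.ρ_pos (hg s hs).1 (hg s hs).2.1 hc hcL
        simpa [hs] using this
      · simp [hs]
    rw [this]
    exact hA.inter ((hk c).inter ((M.measurableSet_integrable_div j c).inter
      (measurableSet_lt (M.measurable_integral_div j c) measurable_const)))
  rcases lt_trichotomy c 0 with hc | hc | hc
  · by_cases hcL : -M.L < c
    · exact hneg c hc hcL
    · convert! MeasurableSet.empty using 1
      refine eq_empty_of_forall_notMem fun s hs => ?_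
      linarith [(hg s hs.1).1.1, hs.2]
  · -- at the level `0` the integrand `z` need not be integrable, so smaller levels are used
    have hL := M.L_pos
    have : {s | s ∈ A ∧ g s < c} = ⋃ n : ℕ, {s | s ∈ A ∧ g s < -(M.L / (n + 2))} := by
      ext s
      simp only [mem_ofPred_eq, mem_iUnion, exists_and_left, hc]
      refine and_congr_right fun _ => ⟨fun h => ?_, fun ⟨n, h⟩ => ?_⟩
      · obtain ⟨n, hn⟩ := exists_nat_gt (M.L / -g s)
        refine ⟨n, ?_⟩
        rw [div_lt_iff₀ (by linarith)] at hn
        rw [lt_neg, div_lt_iff₀ (by positivity)]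
        nlinarith
      · have : 0 < M.L / ((n : ℝ) + 2) := by positivity
        linarith
    rw [this]
    refine MeasurableSet.iUnion fun n => hneg _ ?_ ?_
    · have : 0 < M.L / ((n : ℝ) + 2) := by positivity
      linarith
    · rw [neg_lt_neg_iff, div_lt_iff₀ (by positivity)]
      nlinarith [n.cast_nonneg (α := ℝ)]
  · by_cases hcL : c ≤ M.L
    · exact hpos c hc hcL
    · convert! hA using 1
      ext s
      simp only [mem_ofPred_eq, and_iff_left_iff_imp]
      intro hs
      linarith [(hg s hs).1.2, not_le.1 hcL]

lemma measurable_indicator_candidate {A : Set ℝ≥0} (hA : MeasurableSet A) (j : Fin K)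
    {g : ℝ≥0 → ℝ} (hg : ∀ s ∈ A, g s ∈ Icc (-M.L) M.L ∧ M.KeepsPositive s j (g s) ∧
      (M.FirstOrder s j (g s) ∨ M.BoundaryPoint s j (g s))) :
    Measurable (A.indicator g) := by
  refine measurable_of_Iio fun c => ?_
  have : A.indicator g ⁻¹' Iio c = {s | s ∈ A ∧ g s < c} ∪ Aᶜ ∩ {_s | (0 : ℝ) < c} := by
    ext s
    by_cases hs : s ∈ A <;> simp [hs]
  rw [this]
  exact (M.measurableSet_candidate_lt hA j hg c).union (hA.compl.inter (MeasurableSet.const _))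

section Dynamics

variable {M} {Ω : Type*} {mΩ : MeasurableSpace Ω} {P : Measure Ω} {𝓕 : Filtration ℝ≥0 mΩ}
  {Y : ℝ≥0 → Ω → Fin K} {N : Ω → Measure (ℝ≥0 × Z)} {t : ℝ≥0} {i : Fin K}
  {h : ℝ≥0 → Ω → ℝ} {w : ℝ}

/-- The hypothesis on the function `g` of time and state: its values on `(t, T]` are candidates
which keep the wealth positive in all states. -/
def IsCandidateRule (M : Market K Z) (t : ℝ≥0) (g : ℝ≥0 → Fin K → ℝ) : Prop :=
  ∀ s ∈ Ioc t M.T, ∀ j, g s j ∈ Icc (-M.L) M.L ∧ (∀ k, M.KeepsPositive s k (g s j)) ∧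
    (M.FirstOrder s j (g s j) ∨ M.BoundaryPoint s j (g s j))

lemma IsCandidateRule.admissible {g : ℝ≥0 → Fin K → ℝ} (hg : IsCandidateRule M t g)
    (hM : M.Carries P 𝓕 Y N t i) : M.Admissible 𝓕 t (feedback Y g) := by
  refine ⟨?_, fun s hs ω => ⟨(hg s hs _).1, (hg s hs _).2.1⟩⟩
  have hmg : ∀ j, Measurable ((Ioc t M.T).indicator fun s => g s j) := fun j =>
    M.measurable_indicator_candidate measurableSet_Ioc j fun s hs =>
      ⟨(hg s hs j).1, (hg s hs j).2.1 j, (hg s hs j).2.2⟩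
  have hjoint : Measurable fun y : Fin K × ℝ≥0 => (Ioc t M.T).indicator (fun s => g s y.1) y.2 :=
    measurable_from_prod_countable_right hmg
  let : MeasurableSpace (ℝ≥0 × Ω) := 𝓕.predictable
  have hstate : Measurable fun x : ℝ≥0 × Ω => (preState Y t M.T i x, x.1) :=
    Measurable.prodMk (hM.chain.measurable_preState i) (measurable_fst_predictable 𝓕)
  refine Measurable.stronglyMeasurable ?_
  convert! hjoint.comp hstate using 1
  funext x
  simp only [Function.uncurry, Function.comp_apply, feedback]
  by_cases hx : x.1 ∈ Ioc t M.T
  · rw [indicator_of_mem hx, indicator_of_mem hx, ← preState_of_mem (i := i) hx x.2]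
  · rw [indicator_of_notMem hx, indicator_of_notMem hx]

/-! ### Predictable versions of the strategy and of the jump sizes -/

/-- The strategy on `(t, T]`, extended by `0`, as a function of time and scenario. -/
noncomputable def strat (M : Market K Z) (t : ℝ≥0) (h : ℝ≥0 → Ω → ℝ) (x : ℝ≥0 × Ω) : ℝ :=
  (Ioc t M.T).indicator (fun r => h r x.2) x.1

/-- The jump of the return process at a point `ζ` of the Poisson random measure at time `s`. -/
noncomputable def jumpSize (M : Market K Z) (Y : ℝ≥0 → Ω → Fin K) (t : ℝ≥0) (i : Fin K)
    (x : (ℝ≥0 × Ω) × Z) : ℝ :=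
  M.G x.1.1 (preState Y t M.T i x.1) x.2

/-- The logarithmic return of the wealth at a point `ζ` of the Poisson random measure. -/
noncomputable def logGain (M : Market K Z) (Y : ℝ≥0 → Ω → Fin K) (t : ℝ≥0) (i : Fin K)
    (h : ℝ≥0 → Ω → ℝ) (x : (ℝ≥0 × Ω) × Z) : ℝ :=
  Real.log (1 + strat M t h x.1 * jumpSize M Y t i x)

lemma strat_of_mem {s : ℝ≥0} (hs : s ∈ Ioc t M.T) (ω : Ω) : strat M t h (s, ω) = h s ω :=
  indicator_of_mem hs _

lemma jumpSize_of_mem {s : ℝ≥0} (hs : s ∈ Ioc t M.T) (ω : Ω) (ζ : Z) :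
    jumpSize M Y t i ((s, ω), ζ) = M.G s (Function.leftLim (fun r => Y r ω) s) ζ := by
  rw [jumpSize, preState_of_mem hs]

lemma logGain_of_mem {s : ℝ≥0} (hs : s ∈ Ioc t M.T) (ω : Ω) (ζ : Z) :
    logGain M Y t i h ((s, ω), ζ) =
      Real.log (1 + h s ω * M.G s (Function.leftLim (fun r => Y r ω) s) ζ) := by
  rw [logGain, strat_of_mem hs, jumpSize_of_mem hs]

lemma Admissible.measurable_strat (hh : M.Admissible 𝓕 t h) :
    Measurable[𝓕.predictable] (strat M t h) := by
  let : MeasurableSpace (ℝ≥0 × Ω) := 𝓕.predictable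
  exact hh.1.measurable

lemma Carries.measurable_jumpSize (hM : M.Carries P 𝓕 Y N t i) :
    Measurable[𝓕.predictable.prod inferInstance] (jumpSize M Y t i) := by
  have hjoint : Measurable fun y : Fin K × (ℝ≥0 × Z) => M.G y.2.1 y.1 y.2.2 :=
    measurable_from_prod_countable_right M.G_measurable
  let : MeasurableSpace (ℝ≥0 × Ω) := 𝓕.predictable
  have hstate : Measurable fun x : (ℝ≥0 × Ω) × Z => (preState Y t M.T i x.1, (x.1.1, x.2)) :=
    Measurable.prodMk ((hM.chain.measurable_preState i).comp measurable_fst)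
      (Measurable.prodMk ((measurable_fst_predictable 𝓕).comp measurable_fst) measurable_snd)
  exact hjoint.comp hstate

lemma Carries.measurable_one_add (hM : M.Carries P 𝓕 Y N t i) (hh : M.Admissible 𝓕 t h) :
    Measurable[𝓕.predictable.prod inferInstance]
      fun x : (ℝ≥0 × Ω) × Z => 1 + strat M t h x.1 * jumpSize M Y t i x := by
  have h1 := hM.measurable_jumpSize
  have h2 := hh.measurable_strat
  let : MeasurableSpace (ℝ≥0 × Ω) := 𝓕.predictable
  exact ((h2.comp measurable_fst).mul h1).const_add 1

lemma Carries.measurable_logGain (hM : M.Carries P 𝓕 Y N t i) (hh : M.Admissible 𝓕 t h) :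
    Measurable[𝓕.predictable.prod inferInstance] (logGain M Y t i h) :=
  (hM.measurable_one_add hh).log

/-- Almost surely, no jump makes the wealth non-positive. -/
lemma Carries.ae_pos [IsProbabilityMeasure P] (ht : t ≤ M.T) (hM : M.Carries P 𝓕 Y N t i)
    (hh : M.Admissible 𝓕 t h) : ∀ᵐ ω ∂P, ∀ F, IsFinitePoint (N ω) t M.T F → ∀ p ∈ F,
      0 < 1 + h p.1 ω * M.G p.1 (Function.leftLim (fun r => Y r ω) p.1) p.2 := by
  set B : Set ((ℝ≥0 × Ω) × Z) := {x | 1 + strat M t h x.1 * jumpSize M Y t i x ≤ 0} with hB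
  have hH : Measurable[𝓕.predictable.prod inferInstance] (B.indicator fun _ => (1 : ℝ≥0∞)) := by
    have h1 := hM.measurable_one_add hh
    let : MeasurableSpace (ℝ≥0 × Ω) := 𝓕.predictable
    exact measurable_const.indicator (measurableSet_le h1 measurable_const)
  have hzero : ∫⁻ ω, ∫⁻ p in Ioc t M.T ×ˢ univ,
      B.indicator (fun _ => (1 : ℝ≥0∞)) ((p.1, ω), p.2) ∂(N ω) ∂P = 0 := by
    rw [hM.prm.lintegral_lintegral ht hH]
    refine lintegral_eq_zero_of_ae_eq_zero (Eventually.of_forall fun ω => ?_)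
    refine (setLIntegral_congr_fun measurableSet_Ioc fun s hs => ?_).trans lintegral_zero
    have h1 := (M.keepsPositive_iff s _ _).1
      ((hh.2 s hs ω).2 (Function.leftLim (fun r => Y r ω) s))
    refine lintegral_eq_zero_of_ae_eq_zero ?_
    filter_upwards [measure_eq_zero_iff_ae_notMem.1 h1] with ζ hζ
    refine indicator_of_notMem ?_ _
    rw [hB, mem_ofPred_eq, strat_of_mem hs, jumpSize_of_mem hs]
    exact hζ
  have hm := (hM.prm.measurable_setLIntegral ⟨ht, le_rfl⟩ hH).mono (𝓕.le _) le_rfl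
  rw [lintegral_eq_zero_iff hm] at hzero
  filter_upwards [hzero] with ω hω F hF p hp
  have hω' : ∫⁻ p in Ioc t M.T ×ˢ univ,
      B.indicator (fun _ => (1 : ℝ≥0∞)) ((p.1, ω), p.2) ∂(N ω) = 0 := hω
  rw [hF.setLIntegral (fun p => B.indicator (fun _ => (1 : ℝ≥0∞)) ((p.1, ω), p.2)),
    Finset.sum_eq_zero_iff] at hω'
  have h1 := hω' p hp
  rw [indicator_apply_eq_zero] at h1
  by_contra hcon
  refine one_ne_zero (h1 ?_)
  rw [hB, mem_ofPred_eq, strat_of_mem (hF.mem_Ioc hp), jumpSize_of_mem (hF.mem_Ioc hp)]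
  exact not_lt.1 hcon

/-! ### The wealth process -/

/-- The wealth process of the strategy `h`: its logarithm is an integral with respect to time and
the Poisson random measure. -/
noncomputable def wealth (M : Market K Z) (Y : ℝ≥0 → Ω → Fin K) (N : Ω → Measure (ℝ≥0 × Z))
    (t : ℝ≥0) (w : ℝ) (h : ℝ≥0 → Ω → ℝ) (u : ℝ≥0) (ω : Ω) : ℝ :=
  w * Real.exp (∫ s in Ioc t u, (1 - h s ω) * M.ρ ∂leb +
    ∫ p in Ioc t u ×ˢ univ,
      Real.log (1 + h p.1 ω * M.G p.1 (Function.leftLim (fun r => Y r ω) p.1) p.2) ∂(N ω))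

lemma Admissible.abs_drift_le (hh : M.Admissible 𝓕 t h) {s : ℝ≥0} (hs : s ∈ Ioc t M.T) (ω : Ω) :
    |(1 - h s ω) * M.ρ| ≤ (1 + M.L) * M.ρ := by
  rw [abs_mul, abs_of_pos M.ρ_pos]
  have := (hh.2 s hs ω).1
  refine mul_le_mul_of_nonneg_right (abs_le.2 ⟨?_, ?_⟩) M.ρ_pos.le <;>
    linarith [this.1, this.2, M.L_pos]

lemma Admissible.integrableOn_drift (hh : M.Admissible 𝓕 t h) (ω : Ω) :
    IntegrableOn (fun s => (1 - h s ω) * M.ρ) (Ioc t M.T) leb := by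
  have h1 : Measurable (strat M t h) := hh.measurable_strat.mono (predictable_le_prod 𝓕) le_rfl
  have h2 : Measurable fun s => (1 - strat M t h (s, ω)) * M.ρ :=
    ((h1.comp measurable_prodMk_right).const_sub 1).mul_const M.ρ
  have h3 : AEStronglyMeasurable (fun s => (1 - h s ω) * M.ρ) (leb.restrict (Ioc t M.T)) := by
    refine h2.aestronglyMeasurable.congr ?_
    filter_upwards [ae_restrict_mem measurableSet_Ioc] with s hs
    rw [strat_of_mem hs]
  refine Integrable.mono' (integrable_const ((1 + M.L) * M.ρ)) h3 ?_
  filter_upwards [ae_restrict_mem measurableSet_Ioc] with s hs using hh.abs_drift_le hs ω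

open Classical in
/-- The wealth process is pathwise the explicit solution of a linear equation with finitely many
jumps. -/
lemma Admissible.wealth_eq_linSol {ω : Ω} {F : Finset (ℝ≥0 × Z)}
    (hF : IsFinitePoint (N ω) t M.T F)
    (hpos : ∀ p ∈ F, 0 < 1 + h p.1 ω * M.G p.1 (Function.leftLim (fun r => Y r ω) p.1) p.2)
    {u : ℝ≥0} (hu : u ≤ M.T) : M.wealth Y N t w h u ω =
      linSol t w (fun s => (1 - h s ω) * M.ρ)
        ((F.filter fun p =>
          M.G p.1 (Function.leftLim (fun r => Y r ω) p.1) p.2 ≠ 0).image Prod.fst)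
        (fun s => h s ω * (M.returns Y N t s ω -
          Function.leftLim (fun s => M.returns Y N t s ω) s)) u := by
  rw [wealth, linSol, Real.exp_add]
  congr 2
  exact (hF.prod_eq_exp (fun p => M.G p.1 (Function.leftLim (fun r => Y r ω) p.1) p.2)
    (fun s => h s ω) hpos hu).symm

open Classical in
/-- The dynamics of the wealth are pathwise a linear equation with finitely many jumps. -/
lemma dynamics_iff_solvesLinear {ω : Ω} {F : Finset (ℝ≥0 × Z)} (hF : IsFinitePoint (N ω) t M.T F)
    (W : ℝ≥0 → Ω → ℝ) :
    (∀ u ∈ Icc t M.T, W u ω = w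
      + ∫ s in Ioc t u, Function.leftLim (fun r => W r ω) s * ((1 - h s ω) * M.ρ) ∂leb
      + ∫ p in Ioc t u ×ˢ univ,
          Function.leftLim (fun r => W r ω) p.1 * (h p.1 ω * p.2) ∂(M.μ Y N t ω)) ↔
    SolvesLinear t M.T w (fun s => (1 - h s ω) * M.ρ)
      ((F.filter fun p =>
        M.G p.1 (Function.leftLim (fun r => Y r ω) p.1) p.2 ≠ 0).image Prod.fst)
      (fun s => h s ω * (M.returns Y N t s ω -
        Function.leftLim (fun s => M.returns Y N t s ω) s)) (fun s => W s ω) := by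
  refine forall₂_congr fun u _ => ?_
  have := setIntegral_jumpMeasure (R := fun s => M.returns Y N t s ω) (u := u) (hF.mem_jumpTimes
    fun p => M.G p.1 (Function.leftLim (fun r => Y r ω) p.1) p.2)
    (fun p => Function.leftLim (fun r => W r ω) p.1 * (h p.1 ω * p.2))
  rw [μ, this]

lemma Carries.isWealth_wealth [IsProbabilityMeasure P] (ht : t ≤ M.T)
    (hM : M.Carries P 𝓕 Y N t i) (hh : M.Admissible 𝓕 t h) (w : ℝ) :
    M.IsWealth P 𝓕 Y N t w h (M.wealth Y N t w h) := by
  classical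
  have hpath : ∀ᵐ ω ∂P, CadlagOn (fun s => M.wealth Y N t w h s ω) t M.T ∧
      ∀ u ∈ Icc t M.T, M.wealth Y N t w h u ω = w
        + ∫ s in Ioc t u, Function.leftLim (fun r => M.wealth Y N t w h r ω) s *
            ((1 - h s ω) * M.ρ) ∂leb
        + ∫ p in Ioc t u ×ˢ univ, Function.leftLim (fun r => M.wealth Y N t w h r ω) p.1 *
            (h p.1 ω * p.2) ∂(M.μ Y N t ω) := by
    filter_upwards [hM.ae_pos ht hh] with ω hω
    obtain ⟨F, hF⟩ := hM.prm.exists_isFinitePoint ω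
    have heq := fun u (hu : u ∈ Icc t M.T) =>
      Admissible.wealth_eq_linSol (w := w) hF (hω F hF) hu.2
    have hJ := fun k => (hF.mem_jumpTimes
      (fun p => M.G p.1 (Function.leftLim (fun r => Y r ω) p.1) p.2) k).1
    have hbC := fun s hs => hh.abs_drift_le (s := s) hs ω
    have hc := cadlagOn_linSol (w := w) (J := ((F.filter fun p =>
        M.G p.1 (Function.leftLim (fun r => Y r ω) p.1) p.2 ≠ 0).image Prod.fst))
      (a := (fun s => h s ω * (M.returns Y N t s ω -
        Function.leftLim (fun s => M.returns Y N t s ω) s))) (hh.integrableOn_drift ω) hbC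
    refine ⟨hc.congr heq, ?_⟩
    refine (dynamics_iff_solvesLinear (w := w) hF (M.wealth Y N t w h)).2 ?_
    exact (solvesLinear_linSol (hh.integrableOn_drift ω) hbC fun k hk => (hJ k hk).1).congr hc
      (fun k hk => (hJ k hk).1.1) heq
  refine ⟨fun u hu => ?_, hpath.mono fun ω hω => hω.1, hpath.mono fun ω hω => hω.2⟩
  have h1 : Measurable[𝓕 u] fun ω => ∫ s in Ioc t u, (1 - h s ω) * M.ρ ∂leb := by
    have e : (fun ω => ∫ s in Ioc t u, (1 - h s ω) * M.ρ ∂leb) =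
        fun ω => ∫ s in Ioc t u, (1 - strat M t h (min s u, ω)) * M.ρ ∂leb := by
      funext ω
      refine setIntegral_congr_fun measurableSet_Ioc fun s hs => ?_
      rw [min_eq_left hs.2, strat_of_mem ⟨hs.1, hs.2.trans hu.2⟩]
    rw [e]
    have hm := hh.measurable_strat.comp (measurable_min_predictable 𝓕 u)
    let : MeasurableSpace Ω := 𝓕 u
    have hm' : Measurable fun q : Ω × ℝ≥0 => (1 - strat M t h (min q.2 u, q.1)) * M.ρ :=
      (Measurable.const_sub hm 1).mul_const M.ρ
    exact (hm'.stronglyMeasurable.integral_prod_right' (ν := leb.restrict (Ioc t u))).measurable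
  have h2 : Measurable[𝓕 u] fun ω => ∫ p in Ioc t u ×ˢ univ,
      Real.log (1 + h p.1 ω * M.G p.1 (Function.leftLim (fun r => Y r ω) p.1) p.2) ∂(N ω) := by
    convert! hM.prm.measurable_setIntegral hu (hM.measurable_logGain hh) using 1
    funext ω
    refine setIntegral_congr_fun (measurableSet_Ioc.prod MeasurableSet.univ) fun p hp => ?_
    rw [logGain_of_mem ⟨hp.1.1, hp.1.2.trans hu.2⟩]
  exact ((h1.add h2).exp).const_mul w

lemma Carries.isWealth_unique [IsProbabilityMeasure P] (ht : t ≤ M.T)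
    (hM : M.Carries P 𝓕 Y N t i) (hh : M.Admissible 𝓕 t h) {W : ℝ≥0 → Ω → ℝ}
    (hW : M.IsWealth P 𝓕 Y N t w h W) : W M.T =ᵐ[P] M.wealth Y N t w h M.T := by
  classical
  have hW' := hM.isWealth_wealth ht hh w
  filter_upwards [hW.cadlag, hW.dynamics, hW'.cadlag, hW'.dynamics] with ω h1 h2 h3 h4
  obtain ⟨F, hF⟩ := hM.prm.exists_isFinitePoint ω
  exact SolvesLinear.unique h1 h3
    (fun k hk => ((hF.mem_jumpTimes
      (fun p => M.G p.1 (Function.leftLim (fun r => Y r ω) p.1) p.2) k).1 hk).1.1)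
    (hh.integrableOn_drift ω) (fun s hs => hh.abs_drift_le (s := s) hs ω)
    ((dynamics_iff_solvesLinear hF W).1 h2) ((dynamics_iff_solvesLinear hF _).1 h4) ⟨ht, le_rfl⟩

/-! ### The expected logarithmic utility -/

lemma Admissible.ae_keepsPos (hh : M.Admissible 𝓕 t h) {s : ℝ≥0} (hs : s ∈ Ioc t M.T) (ω : Ω)
    (j : Fin K) : ∀ᵐ ζ ∂M.ς, 0 < 1 + h s ω * M.G s j ζ := by
  have := (M.keepsPositive_iff s j _).1 ((hh.2 s hs ω).2 j)
  filter_upwards [measure_eq_zero_iff_ae_notMem.1 this] with ζ hζ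
  exact not_le.1 hζ

/-- The positive part of the logarithmic return is integrable: it is at most
`L |G| ≤ L (1 + G²)`. -/
lemma Carries.lintegral_logGain_ne_top [IsProbabilityMeasure P] (hM : M.Carries P 𝓕 Y N t i)
    (hh : M.Admissible 𝓕 t h) : ∫⁻ ω, ∫⁻ s in Ioc t M.T, ∫⁻ ζ,
      ENNReal.ofReal (logGain M Y t i h ((s, ω), ζ)) ∂M.ς ∂leb ∂P ≠ ∞ := by
  have hinner : ∀ ω, ∀ s ∈ Ioc t M.T,
      ∫⁻ ζ, ENNReal.ofReal (logGain M Y t i h ((s, ω), ζ)) ∂M.ς ≤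
        ENNReal.ofReal M.L * (M.ς univ + ∫⁻ ζ,
          ENNReal.ofReal (M.G s (Function.leftLim (fun r => Y r ω) s) ζ ^ 2) ∂M.ς) := by
    intro ω s hs
    have e : M.ς univ + ∫⁻ ζ,
        ENNReal.ofReal (M.G s (Function.leftLim (fun r => Y r ω) s) ζ ^ 2) ∂M.ς =
        ∫⁻ ζ, (1 + ENNReal.ofReal (M.G s (Function.leftLim (fun r => Y r ω) s) ζ ^ 2)) ∂M.ς := by
      rw [lintegral_add_left measurable_const, lintegral_one]
    rw [e, ← lintegral_const_mul' _ _ ENNReal.ofReal_ne_top]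
    refine lintegral_mono_ae ?_
    filter_upwards [hh.ae_keepsPos hs ω (Function.leftLim (fun r => Y r ω) s)] with ζ hζ
    rw [logGain_of_mem hs, ← ENNReal.ofReal_one, ← ENNReal.ofReal_add zero_le_one (sq_nonneg _),
      ← ENNReal.ofReal_mul M.L_pos.le]
    refine ENNReal.ofReal_le_ofReal ((log_one_add_mul_le (hh.2 s hs ω).1 hζ).trans ?_)
    refine mul_le_mul_of_nonneg_left ?_ M.L_pos.le
    nlinarith [sq_nonneg (|M.G s (Function.leftLim (fun r => Y r ω) s) ζ| - 1),
      sq_abs (M.G s (Function.leftLim (fun r => Y r ω) s) ζ),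
      abs_nonneg (M.G s (Function.leftLim (fun r => Y r ω) s) ζ)]
  refine ne_top_of_le_ne_top ?_ (lintegral_mono fun ω =>
    setLIntegral_mono' measurableSet_Ioc (hinner ω))
  simp only [lintegral_const_mul' _ _ ENNReal.ofReal_ne_top]
  refine ENNReal.mul_ne_top ENNReal.ofReal_ne_top ?_
  simp only [lintegral_add_left measurable_const, setLIntegral_const]
  refine ENNReal.add_ne_top.2 ⟨?_, hM.square_integrable.ne⟩
  rw [lintegral_const, measure_univ (μ := P), mul_one, leb_Ioc]
  exact ENNReal.mul_ne_top (measure_ne_top _ _) ENNReal.ofReal_ne_top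

/-- The criterion of the strategy `h`: the expected growth rate of the logarithmic wealth. -/
noncomputable def growth (M : Market K Z) (Y : ℝ≥0 → Ω → Fin K) (t : ℝ≥0) (i : Fin K)
    (h : ℝ≥0 → Ω → ℝ) (q : Ω × ℝ≥0) : ℝ :=
  (1 - strat M t h (q.2, q.1)) * M.ρ + ∫ ζ, logGain M Y t i h ((q.2, q.1), ζ) ∂M.ς

lemma growth_of_mem {s : ℝ≥0} (hs : s ∈ Ioc t M.T) (ω : Ω) : growth M Y t i h (ω, s) =
    (1 - h s ω) * M.ρ + ∫ z, Real.log (1 + h s ω * z)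
      ∂(M.η s (Function.leftLim (fun r => Y r ω) s)) := by
  rw [growth, strat_of_mem hs, M.integral_η _ _ (by fun_prop) (by simp)]
  simp only [logGain_of_mem hs]

lemma ae_mem_Ioc (P : Measure Ω) [SFinite P] (t T : ℝ≥0) :
    ∀ᵐ q ∂(P.prod (leb.restrict (Ioc t T))), q.2 ∈ Ioc t T :=
  Measure.quasiMeasurePreserving_snd.ae (ae_restrict_mem measurableSet_Ioc)

lemma Admissible.integrable_drift [IsProbabilityMeasure P] (hh : M.Admissible 𝓕 t h) :
    Integrable (fun q : Ω × ℝ≥0 => (1 - strat M t h (q.2, q.1)) * M.ρ)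
      (P.prod (leb.restrict (Ioc t M.T))) := by
  have h1 : Measurable (strat M t h) := hh.measurable_strat.mono (predictable_le_prod 𝓕) le_rfl
  have h2 : Measurable fun q : Ω × ℝ≥0 => (1 - strat M t h (q.2, q.1)) * M.ρ :=
    ((h1.comp measurable_swap).const_sub 1).mul_const M.ρ
  refine Integrable.mono' (integrable_const ((1 + M.L) * M.ρ)) h2.aestronglyMeasurable ?_
  filter_upwards [ae_mem_Ioc P t M.T] with q hq
  rw [strat_of_mem hq]
  exact hh.abs_drift_le hq q.1

/-- The logarithm of the terminal wealth, in terms of predictable integrands. -/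
lemma Carries.log_wealth_ae_eq [IsProbabilityMeasure P] (ht : t ≤ M.T) (hw : 0 < w)
    (hM : M.Carries P 𝓕 Y N t i) (hh : M.Admissible 𝓕 t h) {W : ℝ≥0 → Ω → ℝ}
    (hW : M.IsWealth P 𝓕 Y N t w h W) : (fun ω => Real.log (W M.T ω)) =ᵐ[P] fun ω =>
      (Real.log w + ∫ s in Ioc t M.T, (1 - strat M t h (s, ω)) * M.ρ ∂leb) +
        ∫ p in Ioc t M.T ×ˢ univ, logGain M Y t i h ((p.1, ω), p.2) ∂(N ω) := by
  filter_upwards [hM.isWealth_unique ht hh hW] with ω hω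
  rw [hω, wealth, Real.log_mul hw.ne' (Real.exp_pos _).ne', Real.log_exp, ← add_assoc]
  congr 1
  · congr 1
    refine setIntegral_congr_fun measurableSet_Ioc fun s hs => ?_
    rw [strat_of_mem hs]
  · refine setIntegral_congr_fun (measurableSet_Ioc.prod MeasurableSet.univ) fun p hp => ?_
    rw [logGain_of_mem hp.1]

/-- A strategy whose logarithmic losses have infinite expectation has expected utility `-∞`. -/
lemma Carries.expectation_eq_bot [IsProbabilityMeasure P] (ht : t ≤ M.T) (hw : 0 < w)
    (hM : M.Carries P 𝓕 Y N t i) (hh : M.Admissible 𝓕 t h) {W : ℝ≥0 → Ω → ℝ}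
    (hW : M.IsWealth P 𝓕 Y N t w h W)
    (hneg : ∫⁻ ω, ∫⁻ s in Ioc t M.T, ∫⁻ ζ,
      ENNReal.ofReal (-logGain M Y t i h ((s, ω), ζ)) ∂M.ς ∂leb ∂P = ∞) :
    expectation P (fun ω => Real.log (W M.T ω)) = ⊥ := by
  have hD : Integrable
      (fun ω => Real.log w + ∫ s in Ioc t M.T, (1 - strat M t h (s, ω)) * M.ρ ∂leb) P :=
    (integrable_const _).add (hh.integrable_drift (P := P)).integral_prod_left
  rw [expectation_congr_ae (hM.log_wealth_ae_eq ht hw hh hW)]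
  exact RegimeMarket.expectation_eq_bot (hM.prm.lintegral_neg_eq_top ht (hM.measurable_logGain hh)
    hD (hM.lintegral_logGain_ne_top hh) hneg)

/-- If the logarithmic losses have finite expectation, then the expected utility is `log w` plus the
expected integral of the growth rate. -/
lemma Carries.expectation_log [IsProbabilityMeasure P] (ht : t ≤ M.T) (hw : 0 < w)
    (hM : M.Carries P 𝓕 Y N t i) (hh : M.Admissible 𝓕 t h) {W : ℝ≥0 → Ω → ℝ}
    (hW : M.IsWealth P 𝓕 Y N t w h W)
    (hneg : ∫⁻ ω, ∫⁻ s in Ioc t M.T, ∫⁻ ζ,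
      ENNReal.ofReal (-logGain M Y t i h ((s, ω), ζ)) ∂M.ς ∂leb ∂P ≠ ∞) :
    Integrable (growth M Y t i h) (P.prod (leb.restrict (Ioc t M.T))) ∧
    expectation P (fun ω => Real.log (W M.T ω)) =
      ((Real.log w + ∫ q, growth M Y t i h q ∂(P.prod (leb.restrict (Ioc t M.T))) : ℝ) :
        EReal) := by
  have hpos := hM.lintegral_logGain_ne_top hh
  have hΛ := hM.measurable_logGain hh
  have hd := hh.integrable_drift (P := P)
  have hint := IsPoissonRandomMeasure.integrable_prod hΛ hpos hneg
  have hlog : Integrable (fun q : Ω × ℝ≥0 => ∫ ζ, logGain M Y t i h ((q.2, q.1), ζ) ∂M.ς)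
      (P.prod (leb.restrict (Ioc t M.T))) := hint.integral_prod_left
  have hD : Integrable
      (fun ω => Real.log w + ∫ s in Ioc t M.T, (1 - strat M t h (s, ω)) * M.ρ ∂leb) P :=
    (integrable_const _).add hd.integral_prod_left
  obtain ⟨h1, h2⟩ := hM.prm.integrable_add_setIntegral ht hΛ hD hpos hneg
  refine ⟨hd.add hlog, ?_⟩
  rw [expectation_congr_ae (hM.log_wealth_ae_eq ht hw hh hW), expectation_eq_integral h1, h2,
    integral_add (integrable_const _) hd.integral_prod_left, integral_prod _ hint,
    ← integral_prod _ hd]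
  simp only [growth]
  rw [integral_add hd hlog]
  simp [add_assoc]

lemma IsCandidateRule.candidate {g : ℝ≥0 → Fin K → ℝ} (hg : IsCandidateRule M t g) {s : ℝ≥0}
    (hs : s ∈ Ioc t M.T) (j : Fin K) : g s j ∈ Icc (-M.L) M.L ∧ KeepsPos (M.η s j) (g s j) ∧
      Candidate (M.η s j) M.L M.ρ (g s j) :=
  ⟨(hg s hs j).1, (M.keepsPositive_iff_keepsPos s j _).1 ((hg s hs j).2.1 j),
    (M.firstOrder_or_boundaryPoint_iff s j _).1 (hg s hs j).2.2⟩

/-- The logarithmic losses of the candidate strategy have finite expectation. -/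
lemma IsCandidateRule.lintegral_neg_logGain_ne_top [IsProbabilityMeasure P]
    {g : ℝ≥0 → Fin K → ℝ} (hg : IsCandidateRule M t g) : ∫⁻ ω, ∫⁻ s in Ioc t M.T, ∫⁻ ζ,
      ENNReal.ofReal (-logGain M Y t i (feedback Y g) ((s, ω), ζ)) ∂M.ς ∂leb ∂P ≠ ∞ := by
  have hinner : ∀ ω, ∀ s ∈ Ioc t M.T,
      ∫⁻ ζ, ENNReal.ofReal (-logGain M Y t i (feedback Y g) ((s, ω), ζ)) ∂M.ς ≤
        M.ς univ + ENNReal.ofReal (M.L * M.ρ) := by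
    intro ω s hs
    obtain ⟨h1, h2, h3⟩ := hg.candidate hs (Function.leftLim (fun r => Y r ω) s)
    have := h3.lintegral_neg_log_le M.L_pos M.ρ_pos h1 h2
    rw [M.lintegral_η _ _ (by fun_prop) (by simp)] at this
    simp only [logGain_of_mem hs, feedback]
    exact this.trans (add_le_add (M.η_univ_le _ _) le_rfl)
  refine ne_top_of_le_ne_top ?_ (lintegral_mono fun ω =>
    setLIntegral_mono' measurableSet_Ioc (hinner ω))
  simp only [lintegral_const, measure_univ, mul_one]
  exact ENNReal.mul_ne_top (ENNReal.add_ne_top.2 ⟨measure_ne_top _ _, ENNReal.ofReal_ne_top⟩)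
    (measure_ne_top _ _)

/-- No admissible strategy has a larger expected growth rate than the candidate strategy. -/
lemma IsCandidateRule.integral_growth_le [IsProbabilityMeasure P] {g : ℝ≥0 → Fin K → ℝ}
    (hg : IsCandidateRule M t g) (hM : M.Carries P 𝓕 Y N t i) (hh : M.Admissible 𝓕 t h)
    (hneg : ∫⁻ ω, ∫⁻ s in Ioc t M.T, ∫⁻ ζ,
      ENNReal.ofReal (-logGain M Y t i h ((s, ω), ζ)) ∂M.ς ∂leb ∂P ≠ ∞)
    (hi : Integrable (growth M Y t i h) (P.prod (leb.restrict (Ioc t M.T))))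
    (hi' : Integrable (growth M Y t i (feedback Y g)) (P.prod (leb.restrict (Ioc t M.T)))) :
    ∫ q, growth M Y t i h q ∂(P.prod (leb.restrict (Ioc t M.T))) ≤
      ∫ q, growth M Y t i (feedback Y g) q ∂(P.prod (leb.restrict (Ioc t M.T))) := by
  have hadm := hg.admissible hM
  have h1 := IsPoissonRandomMeasure.integrable_prod (hM.measurable_logGain hh)
    (hM.lintegral_logGain_ne_top hh) hneg
  have h2 := IsPoissonRandomMeasure.integrable_prod (hM.measurable_logGain hadm)
    (hM.lintegral_logGain_ne_top hadm) hg.lintegral_neg_logGain_ne_top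
  refine integral_mono_ae hi hi' ?_
  filter_upwards [ae_mem_Ioc P t M.T, h1.prod_right_ae, h2.prod_right_ae] with q hq hq1 hq2
  simp only [logGain_of_mem hq] at hq1 hq2
  have e1 : growth M Y t i h q = _ := growth_of_mem hq q.1
  have e2 : growth M Y t i (feedback Y g) q = _ := growth_of_mem hq q.1
  rw [e1, e2]
  obtain ⟨_, c2, c3⟩ := hg.candidate hq (Function.leftLim (fun r => Y r q.1) q.2)
  refine c3.criterion_le c2 ((M.keepsPositive_iff_keepsPos _ _ _).1 ((hh.2 q.2 hq q.1).2 _))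
    (hh.2 q.2 hq q.1).1 ?_ ?_
  · exact (M.integrable_η_iff _ _ (by fun_prop) (by simp)).2 hq2
  · exact (M.integrable_η_iff _ _ (by fun_prop) (by simp)).2 hq1

/-- The strategy given by a candidate rule is optimal, and the value function is its expected
logarithmic growth: it attains this value, and every other admissible strategy has expected utility
`-∞` or an integral of the growth rate that is no larger. -/
lemma IsCandidateRule.isOptimal_and_value_eq [IsProbabilityMeasure P] (ht : t ≤ M.T) (hw : 0 < w)
    (hM : M.Carries P 𝓕 Y N t i) {g : ℝ≥0 → Fin K → ℝ} (hg : IsCandidateRule M t g) :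
    M.IsOptimal P 𝓕 Y N t Real.log w (feedback Y g) ∧
      (∫⁻ ω, ∫⁻ s in Ioc t M.T, ∫⁻ z, ‖Real.log (1 + feedback Y g s ω * z)‖ₑ
        ∂(M.η s (Function.leftLim (fun r => Y r ω) s)) ∂leb ∂P < ∞) ∧
      M.value P 𝓕 Y N t Real.log w =
        ((Real.log w + ∫ ω, ∫ s in Ioc t M.T, ((1 - feedback Y g s ω) * M.ρ +
          ∫ z, Real.log (1 + feedback Y g s ω * z)
            ∂(M.η s (Function.leftLim (fun r => Y r ω) s))) ∂leb ∂P : ℝ) : EReal) := by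
  have hadm := hg.admissible hM
  have hneg : ∫⁻ ω, ∫⁻ s in Ioc t M.T, ∫⁻ ζ,
      ENNReal.ofReal (-logGain M Y t i (feedback Y g) ((s, ω), ζ)) ∂M.ς ∂leb ∂P ≠ ∞ :=
    hg.lintegral_neg_logGain_ne_top
  have hpos := hM.lintegral_logGain_ne_top hadm
  have hΛ := hM.measurable_logGain hadm
  have hW := hM.isWealth_wealth ht hadm w
  obtain ⟨hi', hexp⟩ := hM.expectation_log ht hw hadm hW hneg
  have hvalue : M.value P 𝓕 Y N t Real.log w = ((Real.log w + ∫ q,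
      growth M Y t i (feedback Y g) q ∂(P.prod (leb.restrict (Ioc t M.T))) : ℝ) : EReal) := by
    refine le_antisymm ?_ ?_
    · refine iSup₂_le fun h hh => iSup₂_le fun W hWh => ?_
      by_cases htop : ∫⁻ ω, ∫⁻ s in Ioc t M.T, ∫⁻ ζ,
          ENNReal.ofReal (-logGain M Y t i h ((s, ω), ζ)) ∂M.ς ∂leb ∂P = ∞
      · rw [hM.expectation_eq_bot ht hw hh hWh htop]
        exact bot_le
      · obtain ⟨hi, hexp'⟩ := hM.expectation_log ht hw hh hWh htop
        rw [hexp', EReal.coe_le_coe_iff]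
        exact add_le_add le_rfl (hg.integral_growth_le hM hh htop hi hi')
    · rw [← hexp]
      exact le_iSup₂_of_le (feedback Y g) hadm
        (le_iSup₂_of_le (M.wealth Y N t w (feedback Y g)) hW le_rfl)
  refine ⟨⟨hadm, ⟨_, hW⟩, fun W hW' => ?_⟩, ?_, ?_⟩
  · rw [(hM.expectation_log ht hw hadm hW' hneg).2, hvalue]
  · have hfin := (IsPoissonRandomMeasure.integrable_prod hΛ hpos hneg).2
    have hm : Measurable[𝓕.predictable.prod inferInstance]
        fun x => ‖logGain M Y t i (feedback Y g) x‖ₑ := measurable_enorm.comp hΛ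
    rw [hasFiniteIntegral_iff_enorm, IsPoissonRandomMeasure.lintegral_prod_eq hm] at hfin
    convert! hfin using 1
    refine lintegral_congr fun ω => setLIntegral_congr_fun measurableSet_Ioc fun s hs => ?_
    simp only [logGain_of_mem hs]
    exact M.lintegral_η _ _ (by fun_prop) (by simp)
  · rw [hvalue, integral_prod _ hi']
    congr 3
    funext ω
    exact setIntegral_congr_fun measurableSet_Ioc fun s hs => growth_of_mem hs ω

end Dynamics

end Market

end RegimeMarket

theorem proposition3p2 {K : ℕ} {Z : Set ℝ} (M : RegimeMarket.Market K Z)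
    {Ω : Type*} [mΩ : MeasurableSpace Ω] (P : Measure Ω) [IsProbabilityMeasure P]
    (𝓕 : Filtration ℝ≥0 mΩ) (Y : ℝ≥0 → Ω → Fin K) (N : Ω → Measure (ℝ≥0 × Z))
    (t : ℝ≥0) (ht : t ≤ M.T) (i : Fin K) (hM : M.Carries P 𝓕 Y N t i)
    (w : ℝ) (hw : 0 < w) :
    -- where every fraction in `[-L, L]` keeps the wealth positive, there is exactly one candidate
    (∀ s ≤ M.T, ∀ j, (∀ x ∈ Icc (-M.L) M.L, M.KeepsPositive s j x) →
      ∃! x, x ∈ Icc (-M.L) M.L ∧ (M.FirstOrder s j x ∨ M.BoundaryPoint s j x)) ∧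
    -- the candidate is optimal, and the value function has the stated representation
    ∀ g : ℝ≥0 → Fin K → ℝ,
      (∀ s ∈ Ioc t M.T, ∀ j, g s j ∈ Icc (-M.L) M.L ∧ (∀ k, M.KeepsPositive s k (g s j)) ∧
        (M.FirstOrder s j (g s j) ∨ M.BoundaryPoint s j (g s j))) →
      M.IsOptimal P 𝓕 Y N t Real.log w (RegimeMarket.Market.feedback Y g) ∧
      (∫⁻ ω, ∫⁻ s in Ioc t M.T, ∫⁻ z,
        ‖Real.log (1 + RegimeMarket.Market.feedback Y g s ω * z)‖ₑ
          ∂(M.η s (Function.leftLim (fun r => Y r ω) s)) ∂(RegimeMarket.leb) ∂P < ∞) ∧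
      M.value P 𝓕 Y N t Real.log w =
        ((Real.log w + ∫ ω, ∫ s in Ioc t M.T,
          ((1 - RegimeMarket.Market.feedback Y g s ω) * M.ρ +
            ∫ z, Real.log (1 + RegimeMarket.Market.feedback Y g s ω * z)
              ∂(M.η s (Function.leftLim (fun r => Y r ω) s))) ∂(RegimeMarket.leb) ∂P : ℝ) :
          EReal) := by
  refine ⟨fun s _ j hpos => M.existsUnique_candidate s j hpos, fun g hg => ?_⟩
  have hg : RegimeMarket.Market.IsCandidateRule M t g := hg
  exact hg.isOptimal_and_value_eq ht hw hM
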